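/- **Setting.** A *periodic potential* is a pair $(u,u_y)$ of complex-valued functions on $[0,1]$ with $u\in W^{1,2}([0,1])$ (taken as its continuous representative), $u_y\in L^2([0,1])$ and $u(0)=u(1)$. For $\lambda\in\mathbb C^*$ put $$\alpha_\lambda=\frac14\begin{pmatrix} i\,u_y & -e^{u/2}-\lambda^{-1}e^{-u/2}\\ e^{u/2}+\lambda\,e^{-u/2} & -i\,u_y\end{pmatrix}\mathrm dx ,$$ and let $M(\lambda)=F_\lambda(1)F_\lambda(0)^{-1}=\begin{pmatrix}a(\lambda)&b(\lambda)\\ c(\lambda)&d(\lambda)\end{pmatrix}$ be the monodromy, where $F_\lambda:[0,1]\to GL(2,\mathbb C)$ is an absolutely continuous solution of $\mathrm dF_\lambda=\alpha_\lambda F_\lambda$ (such solutions exist and $M(\lambda)$ does not depend on the choice of $F_\lambda$). Let $\zeta(\lambda)=\frac14(\lambda^{1/2}+\lambda^{-1/2})$; the monodromy of the vacuum $(u,u_y)=(0,0)$ has the entries $a_0=d_0=\cos\zeta(\lambda)$, $b_0=-\lambda^{-1/2}\sin\zeta(\lambda)$, $c_0=\lambda^{1/2}\sin\zeta(\lambda)$.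 For $k\in\mathbb Z$ let $$S_k=\{\lambda\in\mathbb C^*: (|k|-\tfrac12)\pi\le|\zeta(\lambda)|\le(|k|+\tfrac12)\pi\},$$ with the additional condition $|\lambda|>1$ if $k>0$ and $|\lambda|<1$ if $k<0$ (so $S_0=\{|\zeta(\lambda)|\le\frac\pi2\}$). For $n,m\in\mathbb Z$ let $\ell^2_{n,m}$ be the space of sequences $(a_k)_{k\in\mathbb Z}$ with $\sum_{k\le-1}|k^ma_k|^2+|a_0|^2+\sum_{k\ge1}|k^na_k|^2<\infty$. For $s\ge0$, $\mathrm{As}(\mathbb C^*,\ell^2_{n,m},s)$ is the space of holomorphic functions $f:\mathbb C^*\to\mathbb C$ for which there is a sequence $(a_k)\in\ell^2_{n,m}$ of non-negative numbers with $$|f(\lambda)|\le a_k\,e^{s|\mathrm{Im}\,\zeta(\lambda)|}\qquad\text{for all }\lambda\in S_k$$ and all $k\in\mathbb Z$. If the estimate is required only for $k\ge0$ (with $\sum_{k\ge1}|k^na_k|^2<\infty$), resp. only for $k\le0$ (with $\sum_{k\le-1}|k^ma_k|^2<\infty$), one obtains the space $\mathrm{As}_\infty(\mathbb C^*,\ell^2_n,s)$,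 resp. $\mathrm{As}_0(\mathbb C^*,\ell^2_m,s)$. **Theorem.** Let $(u,u_y)$ be a periodic potential with monodromy entries $a,b,c,d$, and put $\tau=e^{-u(0)/2}$. Then 1. $a-a_0\in\mathrm{As}(\mathbb C^*,\ell^2_{0,0},1)$; 2. $b-\tau^{-1}b_0\in\mathrm{As}_\infty(\mathbb C^*,\ell^2_1,1)$ and $b-\tau\,b_0\in\mathrm{As}_0(\mathbb C^*,\ell^2_{-1},1)$; 3. $c-\tau\,c_0\in\mathrm{As}_\infty(\mathbb C^*,\ell^2_{-1},1)$ and $c-\tau^{-1}c_0\in\mathrm{As}_0(\mathbb C^*,\ell^2_1,1)$; 4. $d-d_0\in\mathrm{As}(\mathbb C^*,\ell^2_{0,0},1)$. -/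

import Mathlib

open MeasureTheory Set
open scoped ContDiff Matrix

namespace SinhGordon

noncomputable section

/-! ### Periodic potentials -/

/-- `w` is a weak derivative of `u` on the interval `(0,1)`. -/
def HasWeakDeriv (u w : ℝ → ℂ) : Prop :=
  ∀ φ : ℝ → ℝ, ContDiff ℝ ∞ φ → HasCompactSupport φ → tsupport φ ⊆ Ioo 0 1 →
    ∫ x in Ioo (0 : ℝ) 1, ((deriv φ x : ℝ) : ℂ) * u x
      = -∫ x in Ioo (0 : ℝ) 1, ((φ x : ℝ) : ℂ) * w x

/-- `u` is (the continuous representative on `[0,1]` of) a complex-valued function in the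
Sobolev space `W^{1,2}([0,1])`. Every class in `W^{1,2}([0,1])` has exactly one such
representative on `[0,1]`, and point values of `u` are those of this representative. -/
structure IsSobolevFun (u : ℝ → ℂ) : Prop where
  continuousOn : ContinuousOn u (Icc 0 1)
  memLp : MemLp u 2 (volume.restrict (Icc (0 : ℝ) 1))
  exists_weakDeriv : ∃ w : ℝ → ℂ,
    MemLp w 2 (volume.restrict (Icc (0 : ℝ) 1)) ∧ HasWeakDeriv u w

/-- The pair `(u, u_y)` is a periodic potential:
`(u, u_y) ∈ W^{1,2}([0,1]) × L^2([0,1])` and `u(0) = u(1)`. -/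
structure IsPotential (u uy : ℝ → ℂ) : Prop where
  sobolev : IsSobolevFun u
  memLp_uy : MemLp uy 2 (volume.restrict (Icc (0 : ℝ) 1))
  periodic : u 0 = u 1

/-! ### The monodromy -/

/-- The `dx`-part of the connection form `α_λ` at the point `x`. -/
def connection (u uy : ℝ → ℂ) (lam : ℂ) (x : ℝ) : Matrix (Fin 2) (Fin 2) ℂ :=
  (1 / 4 : ℂ) •
    !![Complex.I * uy x,
       -Complex.exp (u x / 2) - lam⁻¹ * Complex.exp (-(u x / 2));
       Complex.exp (u x / 2) + lam * Complex.exp (-(u x / 2)),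
       -(Complex.I * uy x)]

/-- `F` is a fundamental solution on `[0,1]` of `dF = α_λ F`. As the coefficients are only
square-integrable, solutions are understood in the sense of Carathéodory, i.e. `F` is continuous
and satisfies the integrated equation. -/
structure IsFundamentalSolution (u uy : ℝ → ℂ) (lam : ℂ)
    (F : ℝ → Matrix (Fin 2) (Fin 2) ℂ) : Prop where
  continuousOn : ContinuousOn F (Icc 0 1)
  integral_eq : ∀ x ∈ Icc (0 : ℝ) 1, ∀ i j : Fin 2,
    F x i j = F 0 i j + ∫ t in (0 : ℝ)..x, (connection u uy lam t * F t) i j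
  invertible : IsUnit (F 0)

/-- `N = F_λ(1) F_λ(0)⁻¹` for a fundamental solution `F_λ`. -/
def IsMonodromy (u uy : ℝ → ℂ) (lam : ℂ) (N : Matrix (Fin 2) (Fin 2) ℂ) : Prop :=
  ∃ F : ℝ → Matrix (Fin 2) (Fin 2) ℂ,
    IsFundamentalSolution u uy lam F ∧ N = F 1 * (F 0)⁻¹

/-! ### The vacuum -/

/-- The principal branch of `λ^{1/2}`. The functions `a₀, b₀, c₀, d₀`, `|ζ|` and `|Im ζ|` below
are even in `λ^{1/2}`, so that they do not depend on the choice of the branch. -/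
def sqrtLam (lam : ℂ) : ℂ := lam ^ (1 / 2 : ℂ)

/-- `ζ(λ) = (λ^{1/2} + λ^{-1/2}) / 4`. -/
def zeta (lam : ℂ) : ℂ := (1 / 4 : ℂ) * (sqrtLam lam + (sqrtLam lam)⁻¹)

/-- The entry `a₀` of the monodromy of the vacuum `(u, u_y) = (0, 0)`. -/
def a₀ (lam : ℂ) : ℂ := Complex.cos (zeta lam)

/-- The entry `b₀` of the monodromy of the vacuum. -/
def b₀ (lam : ℂ) : ℂ := -((sqrtLam lam)⁻¹ * Complex.sin (zeta lam))

/-- The entry `c₀` of the monodromy of the vacuum. -/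
def c₀ (lam : ℂ) : ℂ := sqrtLam lam * Complex.sin (zeta lam)

/-- The entry `d₀` of the monodromy of the vacuum. -/
def d₀ (lam : ℂ) : ℂ := Complex.cos (zeta lam)

/-! ### Asymptotic spaces of holomorphic functions on `ℂ*` -/

/-- The sets `S_k ⊆ ℂ*`. -/
def S (k : ℤ) : Set ℂ :=
  if 0 < k then
    {lam | lam ≠ 0 ∧ ((k : ℝ) - 1 / 2) * Real.pi ≤ ‖zeta lam‖ ∧
      ‖zeta lam‖ ≤ ((k : ℝ) + 1 / 2) * Real.pi ∧ 1 < ‖lam‖}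
  else if k = 0 then
    {lam | lam ≠ 0 ∧ ‖zeta lam‖ ≤ Real.pi / 2}
  else
    {lam | lam ≠ 0 ∧ (-(k : ℝ) - 1 / 2) * Real.pi ≤ ‖zeta lam‖ ∧
      ‖zeta lam‖ ≤ (-(k : ℝ) + 1 / 2) * Real.pi ∧ ‖lam‖ < 1}

/-- `∑_{k ≥ 1} |k^n a_k|² < ∞`. -/
def MemEllTwoPos (n : ℤ) (a : ℤ → ℝ) : Prop :=
  Summable fun k : ℕ => |((k : ℝ) + 1) ^ n * a ((k : ℤ) + 1)| ^ 2

/-- `∑_{k ≤ -1} |k^m a_k|² < ∞`. -/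
def MemEllTwoNeg (m : ℤ) (a : ℤ → ℝ) : Prop :=
  Summable fun k : ℕ => |(-((k : ℝ) + 1)) ^ m * a (-((k : ℤ) + 1))| ^ 2

/-- `(a_k)_{k ∈ ℤ}` lies in `ℓ²_{n,m}`. -/
def MemEllTwo (n m : ℤ) (a : ℤ → ℝ) : Prop :=
  MemEllTwoNeg m a ∧ MemEllTwoPos n a

/-- The space `As(ℂ*, ℓ²_{n,m}, s)`. -/
def As (n m : ℤ) (s : ℝ) : Set (ℂ → ℂ) :=
  {f | DifferentiableOn ℂ f {0}ᶜ ∧ ∃ a : ℤ → ℝ, (∀ k, 0 ≤ a k) ∧ MemEllTwo n m a ∧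
    ∀ k : ℤ, ∀ lam ∈ S k, ‖f lam‖ ≤ a k * Real.exp (s * |(zeta lam).im|)}

/-- The space `As_∞(ℂ*, ℓ²_n, s)`; only the `a_k` with `k ≥ 0` matter. -/
def AsInfty (n : ℤ) (s : ℝ) : Set (ℂ → ℂ) :=
  {f | DifferentiableOn ℂ f {0}ᶜ ∧ ∃ a : ℤ → ℝ, (∀ k, 0 ≤ a k) ∧ MemEllTwoPos n a ∧
    ∀ k : ℤ, 0 ≤ k → ∀ lam ∈ S k, ‖f lam‖ ≤ a k * Real.exp (s * |(zeta lam).im|)}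

/-- The space `As_0(ℂ*, ℓ²_m, s)`; only the `a_k` with `k ≤ 0` matter. -/
def AsZero (m : ℤ) (s : ℝ) : Set (ℂ → ℂ) :=
  {f | DifferentiableOn ℂ f {0}ᶜ ∧ ∃ a : ℤ → ℝ, (∀ k, 0 ≤ a k) ∧ MemEllTwoNeg m a ∧
    ∀ k : ℤ, k ≤ 0 → ∀ lam ∈ S k, ‖f lam‖ ≤ a k * Real.exp (s * |(zeta lam).im|)}

end

end SinhGordon

/-! Put `μ = λ^{1/2}`. For `λ` near infinity, gauge the system by `diag(e^{-u/4}, μ⁻¹ e^{u/4})` and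
pass to the eigenbasis of the vacuum. It becomes `f' = iζ f + q g + O(1/μ)`, `g' = -iζ g + q f +
O(1/μ)`, where `q = (i u_y - u')/4` is in `L²` and independent of `λ` (`isPrim_gaugedComponent`).
Since `u(0) = u(1)`, the gauge is the same at both ends and leaves only the powers of `τ` and `μ`
that normalize the off-diagonal entries (`monodromyDeviation_le`).

The distance of `f, g` from the free solutions `e^{±iζx}`, divided by `e^{|Im ζ|x}`, obeys an
integral inequality. Its inhomogeneity is the first Born term, a Fourier-Laplace integral of `q`
over `[0,x]`, plus `O(1/μ)`, and `|μ|` is comparable to `k` on `S_k`. Squaring and Gronwall give a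
bound that is linear in the squared inhomogeneities, so it can be summed over `k`
(`sq_freeDeviation_add_le`).

The estimate must be uniform on each `S_k`. So Born terms have to be square summable along every
choice of one point per annulus, with one constant; Bessel's inequality at lattice points is not
enough. The tool is the discrete maximal inequality `exists_sum_sq_norm_integral_exp_le`. By duality
it follows from an `L²` bound for exponential sums (`integral_sq_norm_exp_sum_le`), whose Gram
matrix is dominated by Poisson kernels. The truncated kernel satisfies `A Aᵀ ≤ C (A + Aᵀ)`
entrywise, which forces boundedness on `ℓ²` (`sum_sum_lowerPoisson_le`). Choosing near-maximizers
then produces the sequence `a_k` (`exists_summable_sq_bound`).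

Near `λ = 0` the symmetry `(λ, u) ↦ (λ⁻¹, -u)`, a conjugation by `diag(1, λ⁻¹)`, reduces everything
to infinity (`IsACPotential.isMonodromy_swap`). The set `S 0` lies in a compact annulus. Existence,
uniqueness and holomorphy of the monodromy come from inverting Volterra operators
(`isUnit_one_sub_volterra`, `differentiableOn_volterra_solution`). -/

namespace SinhGordon

/-! ### Primitives of integrable functions on `[0,1]` -/

theorem absolutelyContinuousOnInterval_of_dist_le {X Y : Type*} [PseudoMetricSpace X]
    [PseudoMetricSpace Y] {f : ℝ → X} {g : ℝ → Y} {a b K : ℝ}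
    (hg : AbsolutelyContinuousOnInterval g a b)
    (h : ∀ x ∈ uIcc a b, ∀ y ∈ uIcc a b, dist (f x) (f y) ≤ K * dist (g x) (g y)) :
    AbsolutelyContinuousOnInterval f a b := by
  rw [absolutelyContinuousOnInterval_iff] at hg ⊢
  intro ε hε
  -- The denominator `|K| + 1` is positive even when `K ≤ 0`.
  obtain ⟨δ, hδ, H⟩ := hg (ε / (|K| + 1)) (by positivity)
  refine ⟨δ, hδ, fun E hE hlt => ?_⟩
  calc ∑ i ∈ Finset.range E.1, dist (f (E.2 i).1) (f (E.2 i).2)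
      ≤ ∑ i ∈ Finset.range E.1, (|K| + 1) * dist (g (E.2 i).1) (g (E.2 i).2) := by
        refine Finset.sum_le_sum fun i hi => ?_
        obtain ⟨h1, h2⟩ := hE.1 i hi
        refine (h _ h1 _ h2).trans ?_
        gcongr
        linarith [le_abs_self K]
    _ = (|K| + 1) * ∑ i ∈ Finset.range E.1, dist (g (E.2 i).1) (g (E.2 i).2) := by
        rw [Finset.mul_sum]
    _ < (|K| + 1) * (ε / (|K| + 1)) := by gcongr; exact H E hE hlt
    _ = ε := by field_simp

/-- Increments of the primitive of `f` are bounded by increments of the real primitive of `‖f‖`. -/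
theorem absolutelyContinuousOnInterval_integral {E : Type*} [NormedAddCommGroup E]
    [NormedSpace ℝ E] {f : ℝ → E} {a b : ℝ} (hf : IntervalIntegrable f volume a b) :
    AbsolutelyContinuousOnInterval (fun x => ∫ t in a..x, f t) a b := by
  refine absolutelyContinuousOnInterval_of_dist_le (K := 1)
    (hf.norm.absolutelyContinuousOnInterval_intervalIntegral (c := a) left_mem_uIcc) ?_
  intro x hx y hy
  have hsub : uIcc a x ⊆ uIcc a b := uIcc_subset_uIcc left_mem_uIcc hx
  have hsub' : uIcc a y ⊆ uIcc a b := uIcc_subset_uIcc left_mem_uIcc hy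
  rw [dist_eq_norm, dist_eq_norm,
    intervalIntegral.integral_interval_sub_left (hf.mono_set hsub) (hf.mono_set hsub'),
    intervalIntegral.integral_interval_sub_left (hf.norm.mono_set hsub) (hf.norm.mono_set hsub'),
    one_mul, Real.norm_eq_abs]
  exact intervalIntegral.norm_integral_le_abs_integral_norm

/-- `f` is absolutely continuous on `[0,1]` with (almost everywhere) derivative `f'`. -/
structure IsPrim (f f' : ℝ → ℂ) : Prop where
  intervalIntegrable : IntervalIntegrable f' volume 0 1
  eq_add_integral : ∀ x ∈ Icc (0 : ℝ) 1, f x = f 0 + ∫ t in (0 : ℝ)..x, f' t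

namespace IsPrim

variable {f f' g g' : ℝ → ℂ}

theorem absolutelyContinuous (hf : IsPrim f f') : AbsolutelyContinuousOnInterval f 0 1 := by
  refine absolutelyContinuousOnInterval_of_dist_le (K := 1)
    (absolutelyContinuousOnInterval_integral hf.intervalIntegrable) ?_
  intro x hx y hy
  rw [uIcc_of_le zero_le_one] at hx hy
  rw [hf.eq_add_integral x hx, hf.eq_add_integral y hy, dist_add_left, one_mul]

theorem continuousOn (hf : IsPrim f f') : ContinuousOn f (Icc 0 1) := by
  have := hf.absolutelyContinuous.continuousOn
  rwa [uIcc_of_le zero_le_one] at this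

theorem ae_hasDerivAt (hf : IsPrim f f') :
    ∀ᵐ x, x ∈ uIcc (0 : ℝ) 1 → HasDerivAt f (f' x) x := by
  -- The integral formula for `f` is known on `[0,1]` only, so it holds in a neighbourhood of `x`
  -- only for interior `x`.
  have h0 : ∀ᵐ x : ℝ, x ≠ 0 := by simp [ae_iff, measure_singleton]
  have h1 : ∀ᵐ x : ℝ, x ≠ 1 := by simp [ae_iff, measure_singleton]
  filter_upwards [hf.intervalIntegrable.ae_hasDerivAt_integral, h0, h1] with x hx hx0 hx1 hmem
  rw [uIcc_of_le zero_le_one] at hmem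
  have hd := (hx (by rwa [uIcc_of_le zero_le_one]) 0 left_mem_uIcc).const_add (f 0)
  refine hd.congr_of_eventuallyEq ?_
  filter_upwards [Icc_mem_nhds (lt_of_le_of_ne hmem.1 (Ne.symm hx0))
    (lt_of_le_of_ne hmem.2 hx1)] with y hy
  exact hf.eq_add_integral y hy

/-- The difference of `f` and the primitive of `f'` is absolutely continuous with derivative zero
almost everywhere, hence constant. The sum, product and exponential rules rest on this criterion. -/
theorem of_absolutelyContinuous (hf : AbsolutelyContinuousOnInterval f 0 1)
    (hi : IntervalIntegrable f' volume 0 1)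
    (hd : ∀ᵐ x, x ∈ uIcc (0 : ℝ) 1 → HasDerivAt f (f' x) x) : IsPrim f f' := by
  refine ⟨hi, fun x hx => ?_⟩
  obtain ⟨C, hC⟩ := (hf.fun_sub (absolutelyContinuousOnInterval_integral hi)).const_of_ae_hasDerivAt_zero
    (by
      filter_upwards [hd, hi.ae_hasDerivAt_integral] with y h1 h2 hy
      simpa using (h1 hy).fun_sub (h2 hy 0 left_mem_uIcc))
  have e0 := hC 0 left_mem_uIcc
  have ex := hC x (by rwa [uIcc_of_le zero_le_one])
  simp only [intervalIntegral.integral_same, sub_zero] at e0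
  rw [← e0] at ex
  rw [← ex]; ring

theorem congr_deriv {h : ℝ → ℂ} (hf : IsPrim f f') (h_eq : ∀ x ∈ Icc (0 : ℝ) 1, f' x = h x) :
    IsPrim f h := by
  have hEq : EqOn f' h (uIcc 0 1) := by rw [uIcc_of_le zero_le_one]; exact h_eq
  refine ⟨hf.intervalIntegrable.congr (fun x hx => hEq (uIoc_subset_uIcc hx)), fun x hx => ?_⟩
  rw [hf.eq_add_integral x hx]
  congr 1
  refine intervalIntegral.integral_congr fun t ht => hEq ?_
  exact uIcc_subset_uIcc left_mem_uIcc (by rwa [uIcc_of_le zero_le_one]) ht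

theorem const (c : ℂ) : IsPrim (fun _ => c) (fun _ => 0) := ⟨by simp, by simp⟩

theorem add (hf : IsPrim f f') (hg : IsPrim g g') :
    IsPrim (fun x => f x + g x) (fun x => f' x + g' x) := by
  refine of_absolutelyContinuous (hf.absolutelyContinuous.fun_add hg.absolutelyContinuous)
    (hf.intervalIntegrable.add hg.intervalIntegrable) ?_
  filter_upwards [hf.ae_hasDerivAt, hg.ae_hasDerivAt] with x h1 h2 hx
  exact (h1 hx).fun_add (h2 hx)

theorem mul (hf : IsPrim f f') (hg : IsPrim g g') :
    IsPrim (fun x => f x * g x) (fun x => f' x * g x + f x * g' x) := by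
  have cf := hf.absolutelyContinuous.continuousOn
  have cg := hg.absolutelyContinuous.continuousOn
  refine of_absolutelyContinuous (hf.absolutelyContinuous.smul hg.absolutelyContinuous)
    ((hf.intervalIntegrable.mul_continuousOn cg).add
      (hg.intervalIntegrable.continuousOn_mul cf)) ?_
  filter_upwards [hf.ae_hasDerivAt, hg.ae_hasDerivAt] with x h1 h2 hx
  exact (h1 hx).mul (h2 hx)

theorem const_mul (c : ℂ) (hf : IsPrim f f') : IsPrim (fun x => c * f x) (fun x => c * f' x) :=
  ((const c).mul hf).congr_deriv fun x _ => by simp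

theorem of_hasDerivAt (hd : ∀ x, HasDerivAt f (f' x) x) (hc : Continuous f') : IsPrim f f' := by
  refine ⟨hc.intervalIntegrable _ _, fun x _ => ?_⟩
  rw [intervalIntegral.integral_eq_sub_of_hasDerivAt (fun t _ => hd t) (hc.intervalIntegrable _ _)]
  ring

/-- The range of `f` is bounded, and on the ball of radius `R` the exponential is Lipschitz with
constant `e^R`, so composition keeps absolute continuity. -/
theorem cexp (hf : IsPrim f f') :
    IsPrim (fun x => Complex.exp (f x)) (fun x => f' x * Complex.exp (f x)) := by
  have cf := hf.absolutelyContinuous.continuousOn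
  obtain ⟨R, hR⟩ := hf.absolutelyContinuous.exists_bound
  have hball : ∀ x ∈ uIcc (0 : ℝ) 1, f x ∈ Metric.closedBall (0 : ℂ) R := fun x hx => by
    simpa using hR x hx
  refine of_absolutelyContinuous (absolutelyContinuousOnInterval_of_dist_le (K := Real.exp R)
    hf.absolutelyContinuous ?_) (hf.intervalIntegrable.mul_continuousOn cf.cexp) ?_
  · intro x hx y hy
    rw [dist_eq_norm, dist_eq_norm]
    refine (convex_closedBall (0 : ℂ) R).norm_image_sub_le_of_norm_hasDerivWithin_le
      (fun z _ => (Complex.hasDerivAt_exp z).hasDerivWithinAt) ?_ (hball y hy) (hball x hx)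
    intro z hz
    rw [Complex.norm_exp]
    refine Real.exp_le_exp.2 ((Complex.re_le_norm z).trans ?_)
    simpa using hz
  · filter_upwards [hf.ae_hasDerivAt] with x h1 hx
    simpa [mul_comm] using (h1 hx).cexp

end IsPrim

/-! ### Sobolev functions have absolutely continuous representatives -/

theorem intervalIntegrable_of_memLp {E : Type*} [NormedAddCommGroup E] {f : ℝ → E}
    (hf : MemLp f 2 (volume.restrict (Icc (0 : ℝ) 1))) : IntervalIntegrable f volume 0 1 := by
  rw [intervalIntegrable_iff_integrableOn_Icc_of_le zero_le_one]
  exact hf.integrable (by norm_num)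

theorem exists_Icc_of_tsupport_subset {φ : ℝ → ℝ} (hc : HasCompactSupport φ)
    (hs : tsupport φ ⊆ Ioo 0 1) :
    ∃ ε > 0, ε < 1 / 2 ∧ ∀ x, x ∉ Icc ε (1 - ε) → φ x = 0 := by
  obtain ⟨ε, hε, h⟩ : ∃ ε > 0, ∀ x ∈ tsupport φ, ε ≤ x ∧ ε ≤ 1 - x := by
    rcases (tsupport φ).eq_empty_or_nonempty with he | hne
    · exact ⟨1, one_pos, by simp [he]⟩
    · have hcont : Continuous fun x : ℝ => min x (1 - x) := by fun_prop
      obtain ⟨x₀, hx₀, hmin⟩ := IsCompact.exists_isMinOn hc hne hcont.continuousOn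
      refine ⟨min x₀ (1 - x₀), lt_min (hs hx₀).1 (by linarith [(hs hx₀).2]), fun x hx => ?_⟩
      exact ⟨(hmin hx).trans (min_le_left _ _), (hmin hx).trans (min_le_right _ _)⟩
  refine ⟨min ε (1 / 4), lt_min hε (by norm_num), (min_le_right _ _).trans_lt (by norm_num),
    fun x hx => ?_⟩
  by_contra hne
  have := h x (subset_tsupport _ hne)
  exact hx ⟨(min_le_left _ _).trans this.1, by linarith [min_le_left ε (1 / 4)]⟩

/-- Zero mean makes the primitive vanish again to the right of the support. Such primitives are the
test functions inserted into the weak derivative. -/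
theorem isTestFunction_integral {χ : ℝ → ℝ} (hχ : ContDiff ℝ ∞ χ) (hc : HasCompactSupport χ)
    (hs : tsupport χ ⊆ Ioo 0 1) (h0 : ∫ x in (0 : ℝ)..1, χ x = 0) :
    ContDiff ℝ ∞ (fun x => ∫ t in (0 : ℝ)..x, χ t) ∧
    HasCompactSupport (fun x => ∫ t in (0 : ℝ)..x, χ t) ∧
    tsupport (fun x => ∫ t in (0 : ℝ)..x, χ t) ⊆ Ioo 0 1 := by
  obtain ⟨ε, hε, hε2, hz⟩ := exists_Icc_of_tsupport_subset hc hs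
  have hd : ∀ x, HasDerivAt (fun x => ∫ t in (0 : ℝ)..x, χ t) (χ x) x := fun x =>
    intervalIntegral.integral_hasDerivAt_right (hχ.continuous.intervalIntegrable _ _)
      (hχ.continuous.stronglyMeasurableAtFilter _ _) hχ.continuous.continuousAt
  have hii : ∀ a b : ℝ, IntervalIntegrable χ volume a b :=
    fun a b => hχ.continuous.intervalIntegrable _ _
  have hsup : ∀ x, x ∉ Icc ε (1 - ε) → ∫ t in (0 : ℝ)..x, χ t = 0 := by
    intro x hx
    rcases lt_or_ge x ε with h | h
    · refine intervalIntegral.integral_zero_ae (Filter.Eventually.of_forall fun t ht => hz t ?_)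
      intro ht2
      rcases le_total 0 x with h3 | h3
      · rw [uIoc_of_le h3] at ht; linarith [ht.2, ht2.1]
      · rw [uIoc_of_ge h3] at ht; linarith [ht.2, ht2.1]
    · have h4 : 1 - ε < x := by by_contra h5; exact hx ⟨h, not_lt.1 h5⟩
      rw [← intervalIntegral.integral_add_adjacent_intervals (hii 0 1) (hii 1 x), h0, zero_add]
      refine intervalIntegral.integral_zero_ae (Filter.Eventually.of_forall fun t ht => hz t ?_)
      intro ht2
      rcases le_total 1 x with h3 | h3
      · rw [uIoc_of_le h3] at ht; linarith [ht.1, ht2.2]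
      · rw [uIoc_of_ge h3] at ht; linarith [ht.1, ht2.2]
  have hts : tsupport (fun x => ∫ t in (0 : ℝ)..x, χ t) ⊆ Icc ε (1 - ε) :=
    closure_minimal (fun x hx => by by_contra h; exact hx (hsup x h)) isClosed_Icc
  refine ⟨?_, ?_, hts.trans (Icc_subset_Ioo hε (by linarith))⟩
  · have hderiv : deriv (fun x => ∫ t in (0 : ℝ)..x, χ t) = χ := funext fun x => (hd x).deriv
    rw [show (∞ : WithTop ℕ∞) = ∞ + 1 by rfl, contDiff_succ_iff_deriv]
    refine ⟨fun x => (hd x).differentiableAt, by simp, ?_⟩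
    rw [hderiv]; exact hχ
  · exact isCompact_Icc.of_isClosed_subset (isClosed_tsupport _) hts

theorem exists_test_function_integral_eq_one :
    ∃ θ : ℝ → ℝ, ContDiff ℝ ∞ θ ∧ HasCompactSupport θ ∧ tsupport θ ⊆ Ioo 0 1 ∧
      ∫ x in (0 : ℝ)..1, θ x = 1 := by
  let b : ContDiffBump (1 / 2 : ℝ) := ⟨1 / 8, 1 / 4, by norm_num, by norm_num⟩
  have hts : tsupport (b.normed volume) ⊆ Ioo 0 1 := by
    rw [b.tsupport_normed_eq, Real.closedBall_eq_Icc]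
    exact Icc_subset_Ioo (by norm_num [b]) (by norm_num [b])
  refine ⟨b.normed volume, b.contDiff_normed, b.hasCompactSupport_normed, hts, ?_⟩
  refine Eq.trans ?_ (b.integral_normed (μ := volume))
  rw [intervalIntegral.integral_of_le zero_le_one]
  refine setIntegral_eq_integral_of_forall_compl_eq_zero fun x hx => ?_
  by_contra h
  have := hts (subset_tsupport _ h)
  exact hx ⟨this.1, this.2.le⟩

/-- The du Bois-Reymond lemma. -/
theorem exists_eq_const_of_integral_eq_zero {f : ℝ → ℂ} (hf : ContinuousOn f (Icc 0 1))
    (h : ∀ χ : ℝ → ℝ, ContDiff ℝ ∞ χ → HasCompactSupport χ → tsupport χ ⊆ Ioo 0 1 →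
      ∫ x in (0 : ℝ)..1, χ x = 0 → ∫ x in (0 : ℝ)..1, (χ x : ℂ) * f x = 0) :
    ∃ K : ℂ, ∀ x ∈ Icc (0 : ℝ) 1, f x = K := by
  obtain ⟨θ, hθ, hθc, hθs, hθ1⟩ := exists_test_function_integral_eq_one
  set K : ℂ := ∫ x in (0 : ℝ)..1, (θ x : ℂ) * f x with hK
  have hf' : ContinuousOn f (uIcc 0 1) := by rwa [uIcc_of_le zero_le_one]
  have hii : ∀ ψ : ℝ → ℝ, Continuous ψ →
      IntervalIntegrable (fun x => (ψ x : ℂ) * f x) volume 0 1 := fun ψ hψ =>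
    (((Complex.continuous_ofReal.comp hψ).continuousOn).mul hf').intervalIntegrable
  have key : ∀ ψ : ℝ → ℝ, ContDiff ℝ ∞ ψ → HasCompactSupport ψ → tsupport ψ ⊆ Ioo 0 1 →
      ∫ x, ψ x • (f x - K) = 0 := by
    intro ψ hψ hψc hψs
    -- Subtracting `c θ` from `ψ` gives a test function of mean zero; the removed part pairs with
    -- `f` to `c K`.
    set c : ℝ := ∫ x in (0 : ℝ)..1, ψ x with hcdef
    have hsub : Function.support (fun x => ψ x - c * θ x) ⊆ tsupport ψ ∪ tsupport θ := by
      intro x hx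
      by_contra h1
      simp only [mem_union, not_or] at h1
      exact hx (by simp [image_eq_zero_of_notMem_tsupport h1.1,
        image_eq_zero_of_notMem_tsupport h1.2])
    have hsub' : tsupport (fun x => ψ x - c * θ x) ⊆ tsupport ψ ∪ tsupport θ :=
      closure_minimal hsub ((isClosed_tsupport _).union (isClosed_tsupport _))
    have h2 := h (fun x => ψ x - c * θ x) (hψ.sub (contDiff_const.mul hθ))
      ((IsCompact.union hψc hθc).of_isClosed_subset (isClosed_tsupport _) hsub')
      (hsub'.trans (union_subset hψs hθs))
      (by
        rw [intervalIntegral.integral_sub (hψ.continuous.intervalIntegrable _ _)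
          ((hθ.continuous.intervalIntegrable _ _).const_mul c),
          intervalIntegral.integral_const_mul, hθ1]; simp [hcdef])
    have h3 : ∫ x, ψ x • (f x - K) = ∫ x in (0 : ℝ)..1, ψ x • (f x - K) := by
      rw [intervalIntegral.integral_of_le zero_le_one]
      refine (setIntegral_eq_integral_of_forall_compl_eq_zero fun x hx => ?_).symm
      have : ψ x = 0 := by
        by_contra h
        have := hψs (subset_tsupport _ h)
        exact hx ⟨this.1, this.2.le⟩
      simp [this]
    have h4 : ∫ x in (0 : ℝ)..1, ((ψ x : ℂ) * f x - (c : ℂ) * ((θ x : ℂ) * f x)) = 0 := by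
      rw [← h2]
      refine intervalIntegral.integral_congr fun x _ => ?_
      push_cast; ring
    rw [intervalIntegral.integral_sub (hii ψ hψ.continuous)
      ((hii θ hθ.continuous).const_mul _), intervalIntegral.integral_const_mul, ← hK] at h4
    have h5 : ∫ x in (0 : ℝ)..1, ψ x • (f x - K)
        = ∫ x in (0 : ℝ)..1, ((ψ x : ℂ) * f x - (ψ x : ℂ) * K) := by
      refine intervalIntegral.integral_congr fun x _ => ?_
      simp [mul_sub]
    have h6 : IntervalIntegrable (fun x => (ψ x : ℂ)) volume 0 1 :=
      (Complex.continuous_ofReal.comp hψ.continuous).intervalIntegrable _ _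
    rw [h3, h5, intervalIntegral.integral_sub (hii ψ hψ.continuous) (h6.mul_const K),
      intervalIntegral.integral_mul_const, intervalIntegral.integral_ofReal, ← hcdef, h4]
  have hae := isOpen_Ioo.ae_eq_zero_of_integral_contDiff_smul_eq_zero (μ := volume)
    (f := fun x => f x - K) (U := Ioo (0 : ℝ) 1)
    (((hf.sub continuousOn_const).mono Ioo_subset_Icc_self).locallyIntegrableOn
      measurableSet_Ioo) key
  refine ⟨K, ?_⟩
  have hEq : (fun x => f x) =ᵐ[volume.restrict (Icc (0 : ℝ) 1)] fun _ => K := by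
    rw [← Measure.restrict_congr_set Ioo_ae_eq_Icc]
    filter_upwards [(ae_restrict_iff' measurableSet_Ioo).2 hae] with x hx
    exact sub_eq_zero.1 hx
  -- Continuity up to the endpoints upgrades equality almost everywhere to all of `[0,1]`.
  exact MeasureTheory.Measure.eqOn_Icc_of_ae_eq volume zero_ne_one hEq hf continuousOn_const

/-- Testing the weak derivative with the primitive of a mean-zero `χ`, and integrating by parts
against the primitive `W` of `w`, gives `∫ χ (u - W) = 0`. The du Bois-Reymond lemma then makes `u -
W` constant. -/
theorem IsSobolevFun.exists_isPrim {u : ℝ → ℂ} (hu : IsSobolevFun u) :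
    ∃ w : ℝ → ℂ, MemLp w 2 (volume.restrict (Icc (0 : ℝ) 1)) ∧ IsPrim u w := by
  obtain ⟨w, hw, hweak⟩ := hu.exists_weakDeriv
  refine ⟨w, hw, ?_⟩
  have hwi := intervalIntegrable_of_memLp hw
  set W : ℝ → ℂ := fun x => ∫ t in (0 : ℝ)..x, w t with hWdef
  have hW : IsPrim W w := ⟨hwi, fun x _ => by simp [hWdef]⟩
  obtain ⟨K, hK⟩ := exists_eq_const_of_integral_eq_zero (f := fun x => u x - W x)
    (hu.continuousOn.sub hW.continuousOn) (by
      intro χ hχ hχc hχs hχ0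
      obtain ⟨h1, h2, h3⟩ := isTestFunction_integral hχ hχc hχs hχ0
      have hd : ∀ x, HasDerivAt (fun x => ∫ t in (0 : ℝ)..x, χ t) (χ x) x := fun x =>
        intervalIntegral.integral_hasDerivAt_right (hχ.continuous.intervalIntegrable _ _)
          (hχ.continuous.stronglyMeasurableAtFilter _ _) hχ.continuous.continuousAt
      have h4 := hweak _ h1 h2 h3
      rw [← integral_Ioc_eq_integral_Ioo, ← integral_Ioc_eq_integral_Ioo,
        ← intervalIntegral.integral_of_le zero_le_one,
        ← intervalIntegral.integral_of_le zero_le_one] at h4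
      simp only [(hd _).deriv] at h4
      have hφ : IsPrim (fun x => ((∫ t in (0 : ℝ)..x, χ t : ℝ) : ℂ)) (fun x => (χ x : ℂ)) :=
        IsPrim.of_hasDerivAt (fun x => (hd x).ofReal_comp)
          (Complex.continuous_ofReal.comp hχ.continuous)
      have h5 := (hφ.mul hW).eq_add_integral 1 (by simp)
      simp only [hχ0, intervalIntegral.integral_same, Complex.ofReal_zero, zero_mul,
        zero_add] at h5
      have hcW : ContinuousOn W (uIcc 0 1) := by
        rw [uIcc_of_le zero_le_one]; exact hW.continuousOn
      have hcu : ContinuousOn u (uIcc 0 1) := by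
        rw [uIcc_of_le zero_le_one]; exact hu.continuousOn
      have hcχ : ContinuousOn (fun x => (χ x : ℂ)) (uIcc 0 1) :=
        (Complex.continuous_ofReal.comp hχ.continuous).continuousOn
      have hiW : IntervalIntegrable (fun x => (χ x : ℂ) * W x) volume 0 1 :=
        (hcχ.mul hcW).intervalIntegrable
      have hiu : IntervalIntegrable (fun x => (χ x : ℂ) * u x) volume 0 1 :=
        (hcχ.mul hcu).intervalIntegrable
      rw [intervalIntegral.integral_add hiW
        (hwi.continuousOn_mul (hφ.absolutelyContinuous.continuousOn))] at h5
      simp only [mul_sub]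
      rw [intervalIntegral.integral_sub hiu hiW, h4]
      linear_combination h5)
  refine ⟨hwi, fun x hx => ?_⟩
  have e0 := hK 0 (by simp)
  have ex := hK x hx
  simp only [hWdef, intervalIntegral.integral_same, sub_zero] at e0 ex
  rw [e0, ← ex]; ring

/-! ### The Cauchy-Schwarz inequality for integrals -/

/-- The quadratic polynomial `s ↦ ∫ (s f - g)²` is nonnegative, so its discriminant is not positive.
-/
theorem sq_integral_mul_le {α : Type*} [MeasurableSpace α] {μ : Measure α} {f g : α → ℝ}
    (hf : MemLp f 2 μ) (hg : MemLp g 2 μ) :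
    (∫ x, f x * g x ∂μ) ^ 2 ≤ (∫ x, f x ^ 2 ∂μ) * ∫ x, g x ^ 2 ∂μ := by
  have hfg : Integrable (fun x => f x * g x) μ := hf.integrable_mul hg
  have h := discrim_le_zero (a := ∫ x, f x ^ 2 ∂μ) (b := -2 * ∫ x, f x * g x ∂μ)
    (c := ∫ x, g x ^ 2 ∂μ) (fun s => by
      have h1 : 0 ≤ ∫ x, (s * f x - g x) ^ 2 ∂μ := integral_nonneg fun x => sq_nonneg _
      have h2 : ∀ x, (s * f x - g x) ^ 2
          = (s * s * f x ^ 2 - 2 * s * (f x * g x)) + g x ^ 2 := fun x => by ring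
      simp only [h2] at h1
      have i1 : Integrable (fun x => s * s * f x ^ 2) μ := hf.integrable_sq.const_mul _
      have i2 : Integrable (fun x => 2 * s * (f x * g x)) μ := hfg.const_mul _
      rw [integral_add (f := fun x => s * s * f x ^ 2 - 2 * s * (f x * g x)) (i1.sub i2)
        hg.integrable_sq, integral_sub i1 i2,
        integral_const_mul, integral_const_mul] at h1
      linarith)
  unfold discrim at h
  nlinarith

theorem restrict_Ioc_le_restrict_Icc {x : ℝ} (hx : x ∈ Icc (0 : ℝ) 1) :
    volume.restrict (Ioc (0 : ℝ) x) ≤ volume.restrict (Icc (0 : ℝ) 1) :=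
  by
  refine Measure.restrict_mono ?_ le_rfl
  intro t ht
  exact ⟨ht.1.le, ht.2.trans hx.2⟩

theorem memLp_of_continuousOn {E : Type*} [NormedAddCommGroup E] {f : ℝ → E}
    (hf : ContinuousOn f (Icc 0 1)) : MemLp f 2 (volume.restrict (Icc (0 : ℝ) 1)) := by
  obtain ⟨C, hC⟩ := isCompact_Icc.exists_bound_of_continuousOn hf
  refine MemLp.of_bound (hf.aestronglyMeasurable_of_isCompact isCompact_Icc measurableSet_Icc) C ?_
  exact (ae_restrict_iff' measurableSet_Icc).2 (Filter.Eventually.of_forall hC)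

theorem integral_mono_of_le_one {f : ℝ → ℝ} (hf : IntervalIntegrable f volume 0 1)
    (h0 : ∀ t, 0 ≤ f t) {x : ℝ} (hx : x ∈ Icc (0 : ℝ) 1) :
    ∫ t in (0 : ℝ)..x, f t ≤ ∫ t in (0 : ℝ)..1, f t :=
  intervalIntegral.integral_mono_interval le_rfl hx.1 hx.2
    (Filter.Eventually.of_forall h0) hf

/-- Only the integral of `g²` stops at `x`. The factor from `a` is a constant, which is what
iteration and Gronwall need. -/
theorem sq_intervalIntegral_mul_le {a g : ℝ → ℝ}
    (ha : MemLp a 2 (volume.restrict (Icc (0 : ℝ) 1))) (hg : ContinuousOn g (Icc 0 1))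
    {x : ℝ} (hx : x ∈ Icc (0 : ℝ) 1) :
    (∫ t in (0 : ℝ)..x, a t * g t) ^ 2
      ≤ (∫ t in (0 : ℝ)..1, a t ^ 2) * ∫ t in (0 : ℝ)..x, g t ^ 2 := by
  have hle := restrict_Ioc_le_restrict_Icc hx
  have h1 := sq_integral_mul_le (ha.mono_measure hle) ((memLp_of_continuousOn hg).mono_measure hle)
  have hi : IntervalIntegrable (fun t => a t ^ 2) volume 0 1 := by
    rw [intervalIntegrable_iff_integrableOn_Icc_of_le zero_le_one]
    exact ha.integrable_sq
  have h2 := integral_mono_of_le_one hi (fun t => sq_nonneg _) hx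
  rw [intervalIntegral.integral_of_le hx.1] at h2 ⊢
  rw [intervalIntegral.integral_of_le hx.1]
  exact h1.trans (mul_le_mul_of_nonneg_right h2 (integral_nonneg fun t => sq_nonneg _))

/-! ### Volterra operators -/

theorem isUnit_one_sub_of_isUnit_one_sub_pow {R : Type*} [Ring R] {T : R} {n : ℕ}
    (hu : IsUnit (1 - T ^ n)) : IsUnit (1 - T) := by
  have hcomm : Commute (1 - T) (∑ i ∈ Finset.range n, T ^ i) :=
    Commute.sum_right _ _ _ fun i _ =>
      (Commute.one_left (T ^ i)).sub_left ((Commute.refl T).pow_right i)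
  rw [← mul_neg_geom_sum] at hu
  exact (hcomm.isUnit_mul_iff.1 hu).1

section Volterra

variable {𝔸 : Type*} [NormedRing 𝔸]

theorem intervalIntegrable_mul_IccExtend {A : ℝ → 𝔸} (hA : IntervalIntegrable A volume 0 1)
    (f : C(Icc (0 : ℝ) 1, 𝔸)) {x : ℝ} (hx : x ∈ Icc (0 : ℝ) 1) :
    IntervalIntegrable (fun t => A t * IccExtend zero_le_one f t) volume 0 x :=
  (hA.mul_continuousOn (f.continuous.Icc_extend').continuousOn).mono_set
    (uIcc_subset_uIcc left_mem_uIcc (by rwa [uIcc_of_le zero_le_one]))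

variable [NormedAlgebra ℂ 𝔸]

/-- The function `x ↦ ∫₀ˣ A f`. -/
noncomputable def volterraFun (A : ℝ → 𝔸) (hA : IntervalIntegrable A volume 0 1)
    (f : C(Icc (0 : ℝ) 1, 𝔸)) : C(Icc (0 : ℝ) 1, 𝔸) where
  toFun x := ∫ t in (0 : ℝ)..x, A t * IccExtend zero_le_one f t
  continuous_toFun := by
    have h := (absolutelyContinuousOnInterval_integral
      (intervalIntegrable_mul_IccExtend hA f (x := 1) (by simp))).continuousOn
    rw [uIcc_of_le zero_le_one, continuousOn_iff_continuous_domRestrict] at h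
    exact h

theorem norm_volterraFun_apply_le (A : ℝ → 𝔸) (hA : IntervalIntegrable A volume 0 1)
    (f : C(Icc (0 : ℝ) 1, 𝔸)) (x : Icc (0 : ℝ) 1) :
    ‖volterraFun A hA f x‖ ≤ ∫ t in (0 : ℝ)..x, ‖A t‖ * ‖IccExtend zero_le_one f t‖ := by
  refine intervalIntegral.norm_integral_le_of_norm_le x.2.1
    (Filter.Eventually.of_forall fun t _ => norm_mul_le _ _) ?_
  exact (hA.norm.mul_continuousOn (f.continuous.Icc_extend').norm.continuousOn).mono_set
    (uIcc_subset_uIcc left_mem_uIcc (by rw [uIcc_of_le zero_le_one]; exact x.2))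

/-- The Volterra operator `f ↦ (x ↦ ∫₀ˣ A f)`. -/
noncomputable def volterra (A : ℝ → 𝔸) (hA : IntervalIntegrable A volume 0 1) :
    C(Icc (0 : ℝ) 1, 𝔸) →L[ℂ] C(Icc (0 : ℝ) 1, 𝔸) :=
  LinearMap.mkContinuous
    { toFun := volterraFun A hA
      map_add' := fun f g => by
        ext x
        change ∫ t in (0 : ℝ)..x, A t * (f _ + g _) = _
        simp only [mul_add]
        exact intervalIntegral.integral_add (intervalIntegrable_mul_IccExtend hA f x.2)
          (intervalIntegrable_mul_IccExtend hA g x.2)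
      map_smul' := fun c f => by
        ext x
        change ∫ t in (0 : ℝ)..x, A t * (c • f _) = _
        simp only [mul_smul_comm]
        exact intervalIntegral.integral_smul _ _ }
    (∫ t in (0 : ℝ)..1, ‖A t‖)
    (fun f => by
      have h0 : 0 ≤ ∫ t in (0 : ℝ)..1, ‖A t‖ :=
        intervalIntegral.integral_nonneg zero_le_one fun t _ => norm_nonneg _
      refine (ContinuousMap.norm_le _ (mul_nonneg h0 (norm_nonneg f))).2 fun x => ?_
      refine (norm_volterraFun_apply_le A hA f x).trans ?_
      have hsub : uIcc (0 : ℝ) x ⊆ uIcc 0 1 :=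
        uIcc_subset_uIcc left_mem_uIcc (by rw [uIcc_of_le zero_le_one]; exact x.2)
      calc ∫ t in (0 : ℝ)..x, ‖A t‖ * ‖IccExtend zero_le_one f t‖
          ≤ ∫ t in (0 : ℝ)..x, ‖A t‖ * ‖f‖ := by
            refine intervalIntegral.integral_mono_on x.2.1
              ((hA.norm.mul_continuousOn (f.continuous.Icc_extend').norm.continuousOn).mono_set hsub)
              ((hA.norm.mono_set hsub).mul_const _) fun t _ => ?_
            exact mul_le_mul_of_nonneg_left (f.norm_coe_le_norm _) (norm_nonneg _)
        _ = (∫ t in (0 : ℝ)..x, ‖A t‖) * ‖f‖ := intervalIntegral.integral_mul_const _ _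
        _ ≤ _ := mul_le_mul_of_nonneg_right
            (integral_mono_of_le_one hA.norm (fun t => norm_nonneg _) x.2) (norm_nonneg _))

/-- Working with squares lets Cauchy-Schwarz use `A` only through its `L²` norm. Each application
contributes that constant and integrates `xⁿ/n!` to the next such term, so some power of the
operator is a contraction however large `A` is. -/
theorem sq_norm_volterra_pow_apply_le {A : ℝ → 𝔸}
    (hA : MemLp A 2 (volume.restrict (Icc (0 : ℝ) 1))) (f : C(Icc (0 : ℝ) 1, 𝔸)) (n : ℕ)
    (x : Icc (0 : ℝ) 1) :
    ‖(volterra A (intervalIntegrable_of_memLp hA) ^ n) f x‖ ^ 2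
      ≤ (∫ t in (0 : ℝ)..1, ‖A t‖ ^ 2) ^ n * ((x : ℝ) ^ n / n.factorial) * ‖f‖ ^ 2 := by
  induction n generalizing x with
  | zero =>
    simp only [pow_zero, Nat.factorial_zero, Nat.cast_one, div_one, one_mul, mul_one]
    exact pow_le_pow_left₀ (norm_nonneg _) (f.norm_coe_le_norm x) 2
  | succ n ih =>
    set T := volterra A (intervalIntegrable_of_memLp hA) with hT
    set K := ∫ t in (0 : ℝ)..1, ‖A t‖ ^ 2 with hK
    have hK0 : 0 ≤ K := intervalIntegral.integral_nonneg zero_le_one fun t _ => sq_nonneg _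
    set g := (T ^ n) f with hg
    have h1 : (T ^ (n + 1)) f = T g := by rw [pow_succ']; rfl
    have hgc : Continuous (fun t => ‖IccExtend zero_le_one g t‖) :=
      (g.continuous.Icc_extend').norm
    have h2 : ‖T g x‖ ≤ ∫ t in (0 : ℝ)..x, ‖A t‖ * ‖IccExtend zero_le_one g t‖ :=
      norm_volterraFun_apply_le A (intervalIntegrable_of_memLp hA) g x
    have h3 := sq_intervalIntegral_mul_le hA.norm hgc.continuousOn x.2
    have h4 : ∫ t in (0 : ℝ)..x, ‖IccExtend zero_le_one g t‖ ^ 2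
        ≤ ∫ t in (0 : ℝ)..x, K ^ n * (t ^ n / n.factorial) * ‖f‖ ^ 2 := by
      refine intervalIntegral.integral_mono_on x.2.1 ((hgc.pow 2).intervalIntegrable _ _)
        (Continuous.intervalIntegrable (by fun_prop) _ _) fun t ht => ?_
      have ht' : t ∈ Icc (0 : ℝ) 1 := ⟨ht.1, ht.2.trans x.2.2⟩
      rw [IccExtend_of_mem _ _ ht']
      exact ih ⟨t, ht'⟩
    have h5 : ∫ t in (0 : ℝ)..x, K ^ n * (t ^ n / n.factorial) * ‖f‖ ^ 2
        = K ^ n * ((x : ℝ) ^ (n + 1) / (n + 1).factorial) * ‖f‖ ^ 2 := by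
      rw [intervalIntegral.integral_mul_const, intervalIntegral.integral_const_mul,
        intervalIntegral.integral_div, integral_pow, Nat.factorial_succ]
      push_cast
      have : (n.factorial : ℝ) ≠ 0 := by positivity
      field_simp
      simp
    rw [h1]
    calc ‖T g x‖ ^ 2 ≤ (∫ t in (0 : ℝ)..x, ‖A t‖ * ‖IccExtend zero_le_one g t‖) ^ 2 :=
          pow_le_pow_left₀ (norm_nonneg _) h2 2
      _ ≤ K * (K ^ n * ((x : ℝ) ^ (n + 1) / (n + 1).factorial) * ‖f‖ ^ 2) :=
          h3.trans (mul_le_mul_of_nonneg_left (h4.trans h5.le) hK0)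
      _ = _ := by ring

theorem one_sub_volterra_apply_eq_iff {A : ℝ → 𝔸} (hA : IntervalIntegrable A volume 0 1)
    (f : C(Icc (0 : ℝ) 1, 𝔸)) (c : 𝔸) :
    (1 - volterra A hA) f = ContinuousMap.const _ c ↔
      ∀ x ∈ Icc (0 : ℝ) 1, IccExtend zero_le_one f x
        = c + ∫ t in (0 : ℝ)..x, A t * IccExtend zero_le_one f t := by
  have key : ∀ x : Icc (0 : ℝ) 1, ((1 - volterra A hA) f) x
      = f x - ∫ t in (0 : ℝ)..x, A t * IccExtend zero_le_one f t := fun x => rfl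
  constructor
  · intro h x hx
    have := key ⟨x, hx⟩
    rw [h, ContinuousMap.const_apply] at this
    rw [IccExtend_of_mem _ _ hx, this, sub_add_cancel]
  · intro h
    ext x
    rw [key, ContinuousMap.const_apply, sub_eq_iff_eq_add, ← h x x.2, IccExtend_val]

theorem exists_continuousMap_of_volterra_solution {A : ℝ → 𝔸}
    (hA : IntervalIntegrable A volume 0 1) {F : ℝ → 𝔸} (hF : ContinuousOn F (Icc 0 1)) {c : 𝔸}
    (h : ∀ x ∈ Icc (0 : ℝ) 1, F x = c + ∫ t in (0 : ℝ)..x, A t * F t) :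
    ∃ f : C(Icc (0 : ℝ) 1, 𝔸), (1 - volterra A hA) f = ContinuousMap.const _ c ∧
      ∀ x : Icc (0 : ℝ) 1, f x = F x := by
  let f : C(Icc (0 : ℝ) 1, 𝔸) := ⟨_, continuousOn_iff_continuous_domRestrict.1 hF⟩
  have hf : ∀ x ∈ Icc (0 : ℝ) 1, IccExtend zero_le_one f x = F x := fun x hx => by
    rw [IccExtend_of_mem _ _ hx]; rfl
  refine ⟨f, (one_sub_volterra_apply_eq_iff hA f c).2 fun x hx => ?_, fun x => rfl⟩
  rw [hf x hx, h x hx]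
  congr 1
  refine intervalIntegral.integral_congr fun t ht => ?_
  rw [uIcc_of_le hx.1] at ht
  rw [hf t ⟨ht.1, ht.2.trans hx.2⟩]

variable [CompleteSpace 𝔸]

theorem isUnit_one_sub_volterra {A : ℝ → 𝔸} (hA : MemLp A 2 (volume.restrict (Icc (0 : ℝ) 1))) :
    IsUnit (1 - volterra A (intervalIntegrable_of_memLp hA)) := by
  set T := volterra A (intervalIntegrable_of_memLp hA) with hT
  set K := ∫ t in (0 : ℝ)..1, ‖A t‖ ^ 2 with hK
  have hK0 : 0 ≤ K := intervalIntegral.integral_nonneg zero_le_one fun t _ => sq_nonneg _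
  -- The preceding bound concerns squared norms, so `1/4` here gives `‖Tⁿ‖ ≤ 1/2`.
  obtain ⟨n, hn⟩ : ∃ n : ℕ, K ^ n / n.factorial < 1 / 4 :=
    ((FloorSemiring.tendsto_pow_div_factorial_atTop K).eventually
      (gt_mem_nhds (by norm_num))).exists
  have hTn : ‖T ^ n‖ ≤ 1 / 2 := by
    refine ContinuousLinearMap.opNorm_le_bound _ (by norm_num) fun f => ?_
    refine (ContinuousMap.norm_le _ (by positivity)).2 fun x => ?_
    refine abs_le_of_sq_le_sq' ?_ (by positivity) |>.2
    refine (sq_norm_volterra_pow_apply_le hA f n x).trans ?_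
    have hx : (x : ℝ) ^ n ≤ 1 := pow_le_one₀ x.2.1 x.2.2
    have : K ^ n * ((x : ℝ) ^ n / n.factorial) ≤ 1 / 4 := by
      calc K ^ n * ((x : ℝ) ^ n / n.factorial) ≤ K ^ n * (1 / n.factorial) := by gcongr
        _ = K ^ n / n.factorial := by ring
        _ ≤ 1 / 4 := hn.le
    calc _ ≤ 1 / 4 * ‖f‖ ^ 2 := by gcongr
      _ = _ := by ring
  have hlt : ‖T ^ n‖ < 1 := by linarith
  have hu : IsUnit (1 - T ^ n) := isUnit_one_sub_of_norm_lt_one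
    (R := C(Icc (0 : ℝ) 1, 𝔸) →L[ℂ] C(Icc (0 : ℝ) 1, 𝔸)) hlt
  exact isUnit_one_sub_of_isUnit_one_sub_pow (R := C(Icc (0 : ℝ) 1, 𝔸) →L[ℂ] C(Icc (0 : ℝ) 1, 𝔸)) hu

theorem exists_volterra_solution {A : ℝ → 𝔸} (hA : MemLp A 2 (volume.restrict (Icc (0 : ℝ) 1)))
    (c : 𝔸) :
    ∃ F : ℝ → 𝔸, Continuous F ∧ ∀ x ∈ Icc (0 : ℝ) 1, F x = c + ∫ t in (0 : ℝ)..x, A t * F t := by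
  obtain ⟨f, hf⟩ : ∃ f, (1 - volterra A (intervalIntegrable_of_memLp hA)) f
      = ContinuousMap.const _ c := by
    obtain ⟨v, hv⟩ := (isUnit_one_sub_volterra hA).exists_right_inv
    exact ⟨v (ContinuousMap.const _ c), congrArg (fun S => S (ContinuousMap.const _ c)) hv⟩
  exact ⟨IccExtend zero_le_one f, f.continuous.Icc_extend',
    (one_sub_volterra_apply_eq_iff _ f c).1 hf⟩

theorem one_sub_volterra_injective {A : ℝ → 𝔸}
    (hA : MemLp A 2 (volume.restrict (Icc (0 : ℝ) 1))) :
    Function.Injective fun f => (1 - volterra A (intervalIntegrable_of_memLp hA)) f := by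
  obtain ⟨v, hv⟩ := (isUnit_one_sub_volterra hA).exists_left_inv
  exact Function.LeftInverse.injective (g := v) fun f => congrArg (fun S => S f) hv

theorem volterra_solution_unique {A : ℝ → 𝔸} (hA : MemLp A 2 (volume.restrict (Icc (0 : ℝ) 1)))
    {F G : ℝ → 𝔸} (hF : ContinuousOn F (Icc 0 1)) (hG : ContinuousOn G (Icc 0 1)) {c : 𝔸}
    (hF' : ∀ x ∈ Icc (0 : ℝ) 1, F x = c + ∫ t in (0 : ℝ)..x, A t * F t)
    (hG' : ∀ x ∈ Icc (0 : ℝ) 1, G x = c + ∫ t in (0 : ℝ)..x, A t * G t) :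
    EqOn F G (Icc 0 1) := by
  obtain ⟨f, hf, hfF⟩ :=
    exists_continuousMap_of_volterra_solution (intervalIntegrable_of_memLp hA) hF hF'
  obtain ⟨g, hg, hgG⟩ :=
    exists_continuousMap_of_volterra_solution (intervalIntegrable_of_memLp hA) hG hG'
  intro x hx
  rw [← hfF ⟨x, hx⟩, ← hgG ⟨x, hx⟩, one_sub_volterra_injective hA (hf.trans hg.symm)]

theorem differentiableAt_ringInverse_laurent {X : Type*} [NormedAddCommGroup X] [NormedSpace ℂ X]
    [CompleteSpace X] (T₀ T₁ T₂ : X →L[ℂ] X) {z : ℂ} (hz : z ≠ 0)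
    (hu : IsUnit (1 - (T₀ + z • T₁ + z⁻¹ • T₂))) :
    DifferentiableAt ℂ (fun w : ℂ => Ring.inverse (1 - (T₀ + w • T₁ + w⁻¹ • T₂))) z := by
  obtain ⟨U, hU⟩ := hu
  have h1 : DifferentiableAt ℂ (fun w : ℂ => 1 - (T₀ + w • T₁ + w⁻¹ • T₂)) z := by
    have : DifferentiableAt ℂ (fun w : ℂ => w⁻¹) z := differentiableAt_inv hz
    fun_prop
  have h2 : DifferentiableAt ℂ (Ring.inverse : (X →L[ℂ] X) → _)
      (1 - (T₀ + z • T₁ + z⁻¹ • T₂)) := by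
    rw [← hU]; exact differentiableAt_inverse U.isUnit
  exact h2.comp z h1

/-- Solutions of linear Volterra equations depend holomorphically on the parameter. -/
theorem differentiableOn_volterra_solution {A₀ A₁ A₂ : ℝ → 𝔸}
    (h₀ : MemLp A₀ 2 (volume.restrict (Icc (0 : ℝ) 1)))
    (h₁ : MemLp A₁ 2 (volume.restrict (Icc (0 : ℝ) 1)))
    (h₂ : MemLp A₂ 2 (volume.restrict (Icc (0 : ℝ) 1))) {F : ℂ → ℝ → 𝔸} {c : 𝔸}
    (hc : ∀ z : ℂ, z ≠ 0 → ContinuousOn (F z) (Icc 0 1))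
    (hF : ∀ z : ℂ, z ≠ 0 → ∀ x ∈ Icc (0 : ℝ) 1,
      F z x = c + ∫ t in (0 : ℝ)..x, (A₀ t + z • A₁ t + z⁻¹ • A₂ t) * F z t) :
    DifferentiableOn ℂ (fun z => F z 1) {0}ᶜ := by
  have hA : ∀ z : ℂ, MemLp (fun t => A₀ t + z • A₁ t + z⁻¹ • A₂ t) 2
      (volume.restrict (Icc (0 : ℝ) 1)) := fun z => (h₀.add (h₁.const_smul z)).add
        (h₂.const_smul z⁻¹)
  set T₀ := volterra A₀ (intervalIntegrable_of_memLp h₀)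
  set T₁ := volterra A₁ (intervalIntegrable_of_memLp h₁)
  set T₂ := volterra A₂ (intervalIntegrable_of_memLp h₂)
  -- The operator is linear in its coefficient, hence a Laurent polynomial in `z` with fixed
  -- operator coefficients.
  have hT : ∀ z : ℂ, volterra (fun t => A₀ t + z • A₁ t + z⁻¹ • A₂ t)
      (intervalIntegrable_of_memLp (hA z)) = T₀ + z • T₁ + z⁻¹ • T₂ := by
    intro z
    ext f x
    have i0 := intervalIntegrable_mul_IccExtend (intervalIntegrable_of_memLp h₀) f x.2
    have i1 := intervalIntegrable_mul_IccExtend (intervalIntegrable_of_memLp h₁) f x.2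
    have i2 := intervalIntegrable_mul_IccExtend (intervalIntegrable_of_memLp h₂) f x.2
    change ∫ t in (0 : ℝ)..x, (A₀ t + z • A₁ t + z⁻¹ • A₂ t) * IccExtend zero_le_one f t
      = (∫ t in (0 : ℝ)..x, A₀ t * IccExtend zero_le_one f t)
        + z • (∫ t in (0 : ℝ)..x, A₁ t * IccExtend zero_le_one f t)
        + z⁻¹ • (∫ t in (0 : ℝ)..x, A₂ t * IccExtend zero_le_one f t)
    simp only [add_mul, smul_mul_assoc]
    have i1' : IntervalIntegrable (fun t => z • (A₁ t * IccExtend zero_le_one f t)) volume 0 x :=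
      i1.smul z
    have i2' : IntervalIntegrable (fun t => z⁻¹ • (A₂ t * IccExtend zero_le_one f t)) volume 0 x :=
      i2.smul z⁻¹
    rw [← intervalIntegral.integral_smul, ← intervalIntegral.integral_smul,
      ← intervalIntegral.integral_add i0 i1', ← intervalIntegral.integral_add (i0.add i1') i2']
  have hu : ∀ z : ℂ, IsUnit (1 - (T₀ + z • T₁ + z⁻¹ • T₂)) := fun z => by
    rw [← hT z]; exact isUnit_one_sub_volterra (hA z)
  -- By uniqueness `F z 1` is the resolvent applied to a constant and evaluated at `1`, so no
  -- regularity of `z ↦ F z` has to be assumed.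
  have hval : ∀ z : ℂ, z ≠ 0 → F z 1 = (Ring.inverse (1 - (T₀ + z • T₁ + z⁻¹ • T₂))
      (ContinuousMap.const _ c)) ⟨1, by simp⟩ := by
    intro z hz
    obtain ⟨f, hf, hfF⟩ := exists_continuousMap_of_volterra_solution
      (intervalIntegrable_of_memLp (hA z)) (hc z hz) (hF z hz)
    rw [hT z] at hf
    rw [← hfF ⟨1, by simp⟩, ← hf]
    exact congrArg (fun S : C(Icc (0 : ℝ) 1, 𝔸) →L[ℂ] C(Icc (0 : ℝ) 1, 𝔸) => S f ⟨1, by simp⟩)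
      (Ring.inverse_mul_cancel _ (hu z)).symm
  intro z hz
  have hz0 : z ≠ 0 := hz
  have hd := differentiableAt_ringInverse_laurent T₀ T₁ T₂ hz0 (hu z)
  have hd2 : DifferentiableAt ℂ (fun w : ℂ => (Ring.inverse (1 - (T₀ + w • T₁ + w⁻¹ • T₂))
      (ContinuousMap.const (Icc (0 : ℝ) 1) c))) z :=
    hd.clm_apply (differentiableAt_const _)
  have hd3 : DifferentiableAt ℂ (fun w : ℂ => (Ring.inverse (1 - (T₀ + w • T₁ + w⁻¹ • T₂))
      (ContinuousMap.const _ c)) ⟨1, by simp⟩) z :=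
    (((ContinuousMap.evalCLM ℂ (⟨1, by simp⟩ : Icc (0 : ℝ) 1) :
      C(Icc (0 : ℝ) 1, 𝔸) →L[ℂ] 𝔸).differentiableAt).comp z hd2 :)
  exact (hd3.differentiableWithinAt (s := {0}ᶜ)).congr (fun w hw => hval w hw) (hval z hz0)

end Volterra

/-! ### A maximal inequality for exponential sums -/

section Maximal

open ComplexConjugate

/-- The Poisson kernel (up to a constant factor). -/
noncomputable def poisson (a d : ℝ) : ℝ := a / (a ^ 2 + d ^ 2)

theorem poisson_nonneg {a : ℝ} (ha : 0 ≤ a) (d : ℝ) : 0 ≤ poisson a d := by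
  unfold poisson; positivity

/-- Since `(a + m)² ≤ 2 (a² + m²)`, the terms with `m ≥ 1` are dominated by differences of `2a/(a +
m)` and telescope; the term `m = 0` is `1/a ≤ 1`. -/
theorem sum_range_poisson_le {a : ℝ} (ha : 1 ≤ a) (M : ℕ) :
    ∑ m ∈ Finset.range M, poisson a m ≤ 3 := by
  have key : ∀ N : ℕ, ∑ m ∈ Finset.range (N + 1), poisson a m ≤ 3 - 2 * a / (a + N) := by
    intro N
    induction N with
    | zero =>
      have h1 : a⁻¹ ≤ 1 := inv_le_one_of_one_le₀ ha
      have h2 : 2 * a / a = 2 := by field_simp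
      have h3 : a / a ^ 2 = a⁻¹ := by field_simp
      simp only [zero_add, Finset.sum_range_one, poisson, Nat.cast_zero, add_zero, h2,
        ne_eq, OfNat.ofNat_ne_zero, not_false_eq_true, zero_pow, h3]
      linarith
    | succ N ih =>
      rw [Finset.sum_range_succ]
      have hN : (0 : ℝ) ≤ N := N.cast_nonneg
      have h1 : poisson a ((N + 1 : ℕ) : ℝ) ≤ 2 * a / (a + N) - 2 * a / (a + (N + 1 : ℕ)) := by
        unfold poisson
        push_cast
        rw [div_sub_div _ _ (by positivity) (by positivity), div_le_div_iff₀ (by positivity)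
          (by positivity)]
        nlinarith [mul_nonneg (by linarith : 0 ≤ a) (sq_nonneg (a - (N + 1))),
          mul_nonneg (by linarith : (0 : ℝ) ≤ a) hN, mul_nonneg (sq_nonneg a) hN]
      linarith
  rcases M with _ | N
  · simp
  · have : 0 ≤ 2 * a / (a + N) := by positivity
    linarith [key N]

theorem sum_poisson_sub_le {a : ℝ} (ha : 1 ≤ a) (s : Finset ℕ) (j : ℕ) :
    ∑ n ∈ s, poisson a ((j : ℝ) - n) ≤ 6 := by
  have h0 : ∀ d, 0 ≤ poisson a d := poisson_nonneg (by linarith)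
  have main : ∀ (t : Finset ℕ) (e : ℕ → ℕ), InjOn e t →
      (∀ n ∈ t, poisson a ((j : ℝ) - n) = poisson a (e n)) →
      ∑ n ∈ t, poisson a ((j : ℝ) - n) ≤ 3 := by
    intro t e he hp
    rw [Finset.sum_congr rfl hp, ← Finset.sum_image (f := fun m : ℕ => poisson a m) he]
    obtain ⟨M, hM⟩ := (t.image e).exists_nat_subset_range
    exact (Finset.sum_le_sum_of_subset_of_nonneg hM fun _ _ _ => h0 _).trans
      (sum_range_poisson_le ha M)
  rw [← Finset.sum_filter_add_sum_filter_not s (fun n => n ≤ j)]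
  have h1 := main (s.filter fun n => n ≤ j) (fun n => j - n)
    (fun n hn m hm h => by
      simp only [Finset.coe_filter, mem_ofPred_eq] at hn hm h
      omega)
    (fun n hn => by rw [Nat.cast_sub (Finset.mem_filter.1 hn).2])
  have h2 := main (s.filter fun n => ¬ n ≤ j) (fun n => n - j)
    (fun n hn m hm h => by
      simp only [Finset.coe_filter, mem_ofPred_eq] at hn hm h
      omega)
    (fun n hn => by
      rw [Nat.cast_sub (not_le.1 (Finset.mem_filter.1 hn).2).le]
      unfold poisson
      ring_nf)
  linarith

/-- As `|p - q|` is at most `2|p|` or `2|q|`, one of the two factors is at most `8 * poisson a (p -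
q)`. When only `q` is comparable and `|p - q| ≤ a`, the first factor still works because its width
is `a`. Summed over translates this replaces the semigroup law of the Poisson kernel. -/
theorem poisson_mul_poisson_le {a b : ℝ} (hb : 1 ≤ b) (hab : b ≤ a) (p q : ℝ) :
    poisson a p * poisson b q ≤ 8 * poisson a (p - q) * (poisson a p + poisson b q) := by
  have hb0 : 0 < b := by linarith
  have ha0 : 0 < a := by linarith
  have hp := poisson_nonneg ha0.le p
  have hq := poisson_nonneg hb0.le q
  have hd := poisson_nonneg ha0.le (p - q)
  have key : poisson a p ≤ 8 * poisson a (p - q) ∨ poisson b q ≤ 8 * poisson a (p - q) := by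
    set d := p - q with hddef
    by_cases h1 : d ^ 2 ≤ 4 * p ^ 2
    · left
      unfold poisson
      rw [mul_div_assoc', div_le_div_iff₀ (by positivity) (by positivity)]
      nlinarith [mul_nonneg ha0.le (sq_nonneg a), mul_nonneg ha0.le (sq_nonneg p),
        mul_le_mul_of_nonneg_left h1 ha0.le]
    · push Not at h1
      have h2 : d ^ 2 ≤ 4 * q ^ 2 := by nlinarith [sq_nonneg (p + q), sq_nonneg (2 * p + d)]
      by_cases h3 : d ^ 2 ≤ a ^ 2
      · left
        unfold poisson
        rw [mul_div_assoc', div_le_div_iff₀ (by positivity) (by positivity)]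
        nlinarith [mul_nonneg ha0.le (sq_nonneg a), mul_nonneg ha0.le (sq_nonneg p),
          mul_le_mul_of_nonneg_left h3 ha0.le]
      · push Not at h3
        right
        unfold poisson
        rw [mul_div_assoc', div_le_div_iff₀ (by positivity) (by positivity)]
        have h4 : a ^ 2 + d ^ 2 ≤ 8 * q ^ 2 := by linarith
        calc b * (a ^ 2 + d ^ 2) ≤ a * (8 * q ^ 2) := by gcongr
          _ ≤ 8 * a * (b ^ 2 + q ^ 2) := by nlinarith [mul_nonneg ha0.le (sq_nonneg b)]
  rcases key with h | h
  · nlinarith [mul_le_mul_of_nonneg_right h hq, mul_nonneg hd hp]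
  · nlinarith [mul_le_mul_of_nonneg_right h hp, mul_nonneg hd hq]

variable {y : ℕ → ℝ}

/-- The part of the kernel `poisson (y j) (j - k)` below the level `y j`. -/
noncomputable def lowerPoisson (y : ℕ → ℝ) (j k : ℕ) : ℝ :=
  if y k ≤ y j then poisson (y j) ((j : ℝ) - k) else 0

theorem lowerPoisson_nonneg (hy : ∀ k, 1 ≤ y k) (j k : ℕ) : 0 ≤ lowerPoisson y j k := by
  unfold lowerPoisson
  split_ifs
  · exact poisson_nonneg (by linarith [hy j]) _
  · exact le_rfl

theorem lowerPoisson_le (hy : ∀ k, 1 ≤ y k) (j k : ℕ) :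
    lowerPoisson y j k ≤ poisson (y j) ((j : ℝ) - k) := by
  unfold lowerPoisson
  split_ifs
  · exact le_rfl
  · exact poisson_nonneg (by linarith [hy j]) _

/-- The truncated kernel composed with its transpose reproduces itself: `A Aᵀ ≤ 96 (A + Aᵀ)`
entrywise. The larger of the two levels decides which of the two entries on the right is used, and
`96 = 8 (6 + 6)`. -/
theorem sum_lowerPoisson_mul_le (hy : ∀ k, 1 ≤ y k) (s : Finset ℕ) (j k : ℕ) :
    ∑ n ∈ s, lowerPoisson y j n * lowerPoisson y k n
      ≤ 96 * (lowerPoisson y j k + lowerPoisson y k j) := by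
  wlog h : y k ≤ y j generalizing j k
  · simpa [mul_comm, add_comm] using this k j (not_le.1 h).le
  have h1 : ∀ n ∈ s, lowerPoisson y j n * lowerPoisson y k n ≤
      8 * poisson (y j) ((j : ℝ) - k) *
        (poisson (y j) ((j : ℝ) - n) + poisson (y k) ((k : ℝ) - n)) := by
    intro n _
    refine (mul_le_mul (lowerPoisson_le hy j n) (lowerPoisson_le hy k n)
      (lowerPoisson_nonneg hy k n) (poisson_nonneg (by linarith [hy j]) _)).trans ?_
    have := poisson_mul_poisson_le (hy k) h ((j : ℝ) - n) ((k : ℝ) - n)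
    rwa [sub_sub_sub_cancel_right] at this
  refine (Finset.sum_le_sum h1).trans ?_
  rw [← Finset.mul_sum, Finset.sum_add_distrib]
  have h2 := sum_poisson_sub_le (hy j) s j
  have h3 := sum_poisson_sub_le (hy k) s k
  have h4 : lowerPoisson y j k = poisson (y j) ((j : ℝ) - k) := if_pos h
  have h5 := poisson_nonneg (by linarith [hy j] : 0 ≤ y j) ((j : ℝ) - k)
  have h6 := lowerPoisson_nonneg hy k j
  rw [h4]
  nlinarith

/-- Put `w = Aᵀ c` and `Q = ⟨c, w⟩`. The composition estimate gives `‖w‖² ≤ 192 Q`, and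
Cauchy-Schwarz gives `Q² ≤ ‖c‖² ‖w‖²`; dividing by `Q` yields the bound. No Schur test with uniform
row and column sums is needed. -/
theorem sum_sum_lowerPoisson_le (hy : ∀ k, 1 ≤ y k) (s : Finset ℕ) {c : ℕ → ℝ}
    (hc : ∀ k, 0 ≤ c k) :
    ∑ j ∈ s, ∑ k ∈ s, c j * c k * lowerPoisson y j k ≤ 192 * ∑ k ∈ s, c k ^ 2 := by
  set w : ℕ → ℝ := fun n => ∑ j ∈ s, c j * lowerPoisson y j n with hw
  set Q := ∑ j ∈ s, ∑ k ∈ s, c j * c k * lowerPoisson y j k with hQ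
  have hQ' : Q = ∑ k ∈ s, c k * w k := by
    rw [hQ, Finset.sum_comm]
    refine Finset.sum_congr rfl fun k _ => ?_
    rw [hw, Finset.mul_sum]
    exact Finset.sum_congr rfl fun j _ => by ring
  have h1 : ∑ n ∈ s, w n ^ 2
      = ∑ j ∈ s, ∑ k ∈ s, c j * c k * ∑ n ∈ s, lowerPoisson y j n * lowerPoisson y k n := by
    have h0 : ∀ n, w n ^ 2
        = ∑ j ∈ s, ∑ k ∈ s, c j * c k * (lowerPoisson y j n * lowerPoisson y k n) := fun n => by
      rw [hw, sq, Finset.sum_mul_sum]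
      exact Finset.sum_congr rfl fun j _ => Finset.sum_congr rfl fun k _ => by ring
    simp only [h0, Finset.mul_sum]
    rw [Finset.sum_comm]
    exact Finset.sum_congr rfl fun j _ => Finset.sum_comm
  have h2 : ∑ n ∈ s, w n ^ 2 ≤ 192 * Q := by
    have h3 : ∑ n ∈ s, w n ^ 2
        ≤ ∑ j ∈ s, ∑ k ∈ s, c j * c k * (96 * (lowerPoisson y j k + lowerPoisson y k j)) := by
      rw [h1]
      exact Finset.sum_le_sum fun j _ => Finset.sum_le_sum fun k _ =>
        mul_le_mul_of_nonneg_left (sum_lowerPoisson_mul_le hy s j k) (mul_nonneg (hc j) (hc k))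
    have h4 : ∑ j ∈ s, ∑ k ∈ s, c j * c k * (96 * (lowerPoisson y j k + lowerPoisson y k j))
        = 96 * Q + 96 * ∑ j ∈ s, ∑ k ∈ s, c j * c k * lowerPoisson y k j := by
      rw [hQ, Finset.mul_sum, Finset.mul_sum, ← Finset.sum_add_distrib]
      refine Finset.sum_congr rfl fun j _ => ?_
      rw [Finset.mul_sum, Finset.mul_sum, ← Finset.sum_add_distrib]
      exact Finset.sum_congr rfl fun k _ => by ring
    have h5 : ∑ j ∈ s, ∑ k ∈ s, c j * c k * lowerPoisson y k j = Q := by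
      rw [hQ, Finset.sum_comm]
      exact Finset.sum_congr rfl fun j _ => Finset.sum_congr rfl fun k _ => by ring
    rw [h4, h5] at h3
    linarith
  have h6 : Q ^ 2 ≤ (∑ k ∈ s, c k ^ 2) * ∑ k ∈ s, w k ^ 2 := by
    rw [hQ']; exact Finset.sum_mul_sq_le_sq_mul_sq _ _ _
  have hS : 0 ≤ ∑ k ∈ s, c k ^ 2 := Finset.sum_nonneg fun _ _ => sq_nonneg _
  have hQ0 : 0 ≤ Q := Finset.sum_nonneg fun j _ => Finset.sum_nonneg fun k _ =>
    mul_nonneg (mul_nonneg (hc j) (hc k)) (lowerPoisson_nonneg hy j k)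
  by_contra hlt
  push Not at hlt
  have hQpos : 0 < Q := lt_of_le_of_lt (by positivity) hlt
  nlinarith [mul_le_mul_of_nonneg_left h2 hS, mul_lt_mul_of_pos_right hlt hQpos]

/-- The separation hypothesis gives `(j - k)² ≤ 2 (x_j - x_k)² + 2 y²` with `y` the larger level, so
distances of points may be replaced by distances of indices. The constant is `2 · 3`: `y_j + y_k ≤
2y` and `y² + (j - k)² ≤ 3 (y² + (x_j - x_k)²)`. -/
theorem poisson_add_le {x : ℕ → ℝ} (hy : ∀ k, 1 ≤ y k)
    (hsep : ∀ j k : ℕ, |(j : ℝ) - k| ≤ |x j - x k| + max (y j) (y k)) (j k : ℕ) :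
    poisson (y j + y k) (x j - x k) ≤ 6 * (lowerPoisson y j k + lowerPoisson y k j) := by
  wlog h : y k ≤ y j generalizing j k
  · have h2 := this k j (not_le.1 h).le
    rw [add_comm (y j), add_comm (lowerPoisson y j k)]
    have h3 : poisson (y k + y j) (x j - x k) = poisson (y k + y j) (x k - x j) := by
      unfold poisson; ring_nf
    rwa [h3]
  have h4 : lowerPoisson y j k = poisson (y j) ((j : ℝ) - k) := if_pos h
  have h6 := lowerPoisson_nonneg hy k j
  have h1 := hsep j k
  rw [max_eq_left h] at h1
  have hj := hy j
  have hk := hy k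
  have h7 : ((j : ℝ) - k) ^ 2 ≤ 2 * (x j - x k) ^ 2 + 2 * y j ^ 2 := by
    have h8 := sq_nonneg (|x j - x k| - y j)
    have h9 := pow_le_pow_left₀ (abs_nonneg _) h1 2
    rw [sq_abs] at h9
    nlinarith [sq_abs (x j - x k)]
  rw [h4]
  have h10 : poisson (y j + y k) (x j - x k) ≤ 6 * poisson (y j) ((j : ℝ) - k) := by
    unfold poisson
    generalize (j : ℝ) - k = d at *
    generalize x j - x k = X at *
    rw [mul_div_assoc', div_le_div_iff₀ (by positivity) (by positivity)]
    calc (y j + y k) * (y j ^ 2 + d ^ 2) ≤ (2 * y j) * (3 * (y j ^ 2 + X ^ 2)) := by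
          gcongr
          · linarith
          · nlinarith [sq_nonneg X]
      _ ≤ 6 * y j * ((y j + y k) ^ 2 + X ^ 2) := by
          have : y j ^ 2 ≤ (y j + y k) ^ 2 := pow_le_pow_left₀ (by linarith) (by linarith) 2
          nlinarith
  linarith

/-! ### Exponential sums in `L²` and the dual inequality -/

theorem sq_norm_sum_exp (s : Finset ℕ) (c a : ℕ → ℂ) (t : ℝ) :
    ((‖∑ k ∈ s, c k * Complex.exp (a k * t)‖ ^ 2 : ℝ) : ℂ)
      = ∑ j ∈ s, ∑ k ∈ s, c j * conj (c k) * Complex.exp ((a j + conj (a k)) * t) := by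
  rw [← Complex.normSq_eq_norm_sq, ← Complex.mul_conj, map_sum, Finset.sum_mul_sum]
  refine Finset.sum_congr rfl fun j _ => Finset.sum_congr rfl fun k _ => ?_
  rw [map_mul, ← Complex.exp_conj, map_mul, Complex.conj_ofReal, add_mul, Complex.exp_add]
  ring

theorem integrableOn_sum_exp (s : Finset ℕ) (c a : ℕ → ℂ) (ha : ∀ k, (a k).re < 0) :
    IntegrableOn (fun t : ℝ => ∑ j ∈ s, ∑ k ∈ s,
      c j * conj (c k) * Complex.exp ((a j + conj (a k)) * t)) (Ioi 0) := by
  refine integrable_finsetSum _ fun j _ => integrable_finsetSum _ fun k _ => ?_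
  exact (integrableOn_exp_mul_complex_Ioi (by simpa using add_neg (ha j) (ha k)) 0).const_mul _

theorem integral_sq_norm_sum_exp (s : Finset ℕ) (c a : ℕ → ℂ) (ha : ∀ k, (a k).re < 0) :
    ((∫ t in Ioi (0 : ℝ), ‖∑ k ∈ s, c k * Complex.exp (a k * t)‖ ^ 2 : ℝ) : ℂ)
      = ∑ j ∈ s, ∑ k ∈ s, c j * conj (c k) * (-(a j + conj (a k))⁻¹) := by
  have hre : ∀ j k, (a j + conj (a k)).re < 0 := fun j k => by simpa using add_neg (ha j) (ha k)
  have hi : ∀ j k, IntegrableOn (fun t : ℝ =>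
      c j * conj (c k) * Complex.exp ((a j + conj (a k)) * t)) (Ioi 0) := fun j k =>
    (integrableOn_exp_mul_complex_Ioi (hre j k) 0).const_mul _
  rw [← integral_complex_ofReal]
  simp only [sq_norm_sum_exp]
  rw [integral_finsetSum _ fun j _ => integrable_finsetSum _ fun k _ => hi j k]
  refine Finset.sum_congr rfl fun j _ => ?_
  rw [integral_finsetSum _ fun k _ => hi j k]
  refine Finset.sum_congr rfl fun k _ => ?_
  rw [integral_const_mul, integral_exp_mul_complex_Ioi (hre j k)]
  simp [neg_div]

/-- On the half-line the Gram entries are `-1/(a_j + conj a_k)`, which decay too slowly in the real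
separation. Adding the sum with conjugate frequencies, which is also nonnegative, replaces each
entry by twice its real part, a Poisson kernel with quadratic decay. The constant is `2304 = 6 · 2 ·
192`. -/
theorem integral_sq_norm_exp_sum_le {z : ℕ → ℂ} (hz : ∀ k, 1 ≤ (z k).im)
    (hsep : ∀ j k : ℕ, |(j : ℝ) - k| ≤ |(z j).re - (z k).re| + max (z j).im (z k).im)
    (s : Finset ℕ) (c : ℕ → ℂ) :
    ∫ t in (0 : ℝ)..1, ‖∑ k ∈ s, c k * Complex.exp (2 * Complex.I * z k * t)‖ ^ 2
      ≤ 2304 * ∑ k ∈ s, ‖c k‖ ^ 2 := by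
  set a : ℕ → ℂ := fun k => 2 * Complex.I * z k with ha_def
  have ha : ∀ k, (a k).re < 0 := fun k => by
    have : (a k).re = -2 * (z k).im := by simp [ha_def]
    rw [this]; linarith [hz k]
  have hac : ∀ k, (conj (a k)).re < 0 := fun k => by simpa using ha k
  have h1 := integral_sq_norm_sum_exp s c a ha
  have h2 := integral_sq_norm_sum_exp s c (fun k => conj (a k)) hac
  set I₁ := ∫ t in Ioi (0 : ℝ), ‖∑ k ∈ s, c k * Complex.exp (a k * t)‖ ^ 2 with hI₁
  set I₂ := ∫ t in Ioi (0 : ℝ), ‖∑ k ∈ s, c k * Complex.exp (conj (a k) * t)‖ ^ 2 with hI₂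
  have hI₂0 : 0 ≤ I₂ := integral_nonneg fun t => sq_nonneg _
  have hint : IntegrableOn (fun t : ℝ => ‖∑ k ∈ s, c k * Complex.exp (a k * t)‖ ^ 2) (Ioi 0) := by
    have := integrableOn_sum_exp s c a ha
    simp only [← sq_norm_sum_exp] at this
    exact this.re
  have hle : ∫ t in (0 : ℝ)..1, ‖∑ k ∈ s, c k * Complex.exp (a k * t)‖ ^ 2 ≤ I₁ := by
    rw [intervalIntegral.integral_of_le zero_le_one]
    exact setIntegral_mono_set hint (Filter.Eventually.of_forall fun t => sq_nonneg _)
      (Filter.Eventually.of_forall fun t (ht : t ∈ Ioc (0 : ℝ) 1) => ht.1)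
  have hsum : ((I₁ + I₂ : ℝ) : ℂ) = ∑ j ∈ s, ∑ k ∈ s, c j * conj (c k) *
      (poisson ((z j).im + (z k).im) ((z j).re - (z k).re) : ℂ) := by
    push_cast
    rw [h1, h2, ← Finset.sum_add_distrib]
    refine Finset.sum_congr rfl fun j _ => ?_
    rw [← Finset.sum_add_distrib]
    refine Finset.sum_congr rfl fun k _ => ?_
    rw [← mul_add]
    congr 1
    have hY : 0 < (z j).im + (z k).im := by linarith [hz j, hz k]
    set X := (z j).re - (z k).re with hX
    set Y := (z j).im + (z k).im with hYd
    have e1 : a j + conj (a k) = ((-2 * Y : ℝ) : ℂ) + ((2 * X : ℝ) : ℂ) * Complex.I := by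
      apply Complex.ext <;> simp [ha_def, hX, hYd] <;> ring
    have e2 : conj (a j) + conj (conj (a k))
        = ((-2 * Y : ℝ) : ℂ) - ((2 * X : ℝ) : ℂ) * Complex.I := by
      apply Complex.ext <;> simp [ha_def, hX, hYd] <;> ring
    have n1 : a j + conj (a k) ≠ 0 := fun h => by
      have := congrArg Complex.re h
      rw [e1] at this
      simp at this
      linarith
    have n2 : conj (a j) + conj (conj (a k)) ≠ 0 := fun h => by
      have := congrArg Complex.re h
      rw [e2] at this
      simp at this
      linarith
    have n3 : ((Y : ℂ) ^ 2 + (X : ℂ) ^ 2) ≠ 0 := by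
      norm_cast
      positivity
    have hpq : (a j + conj (a k)) * (conj (a j) + conj (conj (a k)))
        = 4 * ((Y : ℂ) ^ 2 + (X : ℂ) ^ 2) := by
      rw [e1, e2]
      push_cast
      linear_combination (-4 * (X : ℂ) ^ 2) * Complex.I_sq
    have hadd : (a j + conj (a k)) + (conj (a j) + conj (conj (a k))) = -4 * (Y : ℂ) := by
      rw [e1, e2]
      push_cast
      ring
    have hinv : -(a j + conj (a k))⁻¹ + -(conj (a j) + conj (conj (a k)))⁻¹
        = -((a j + conj (a k)) + (conj (a j) + conj (conj (a k)))) /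
          ((a j + conj (a k)) * (conj (a j) + conj (conj (a k)))) := by
      rw [← neg_add, inv_add_inv n1 n2, neg_div]
    rw [hinv, hpq, hadd]
    unfold poisson
    push_cast
    field_simp
  have hnorm : I₁ + I₂ ≤ ∑ j ∈ s, ∑ k ∈ s, ‖c j‖ * ‖c k‖ *
      (6 * (lowerPoisson (fun k => (z k).im) j k + lowerPoisson (fun k => (z k).im) k j)) := by
    have h3 : I₁ + I₂ ≤ ‖((I₁ + I₂ : ℝ) : ℂ)‖ := by
      rw [Complex.norm_real]; exact le_abs_self _
    refine h3.trans ?_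
    rw [hsum]
    refine (norm_sum_le _ _).trans (Finset.sum_le_sum fun j _ => ?_)
    refine (norm_sum_le _ _).trans (Finset.sum_le_sum fun k _ => ?_)
    rw [norm_mul, norm_mul, RCLike.norm_conj, Complex.norm_real, Real.norm_eq_abs,
      abs_of_nonneg (poisson_nonneg (by linarith [hz j, hz k]) _)]
    gcongr
    exact poisson_add_le (y := fun k => (z k).im) (x := fun k => (z k).re) hz hsep j k
  have hQ := sum_sum_lowerPoisson_le (y := fun k => (z k).im) hz s
    (c := fun k => ‖c k‖) fun k => norm_nonneg _
  have hQ' : ∑ j ∈ s, ∑ k ∈ s, ‖c j‖ * ‖c k‖ *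
      (6 * (lowerPoisson (fun k => (z k).im) j k + lowerPoisson (fun k => (z k).im) k j))
      = 12 * ∑ j ∈ s, ∑ k ∈ s, ‖c j‖ * ‖c k‖ * lowerPoisson (fun k => (z k).im) j k := by
    have h5 : ∑ j ∈ s, ∑ k ∈ s, ‖c j‖ * ‖c k‖ * lowerPoisson (fun k => (z k).im) k j
        = ∑ j ∈ s, ∑ k ∈ s, ‖c j‖ * ‖c k‖ * lowerPoisson (fun k => (z k).im) j k := by
      rw [Finset.sum_comm]
      exact Finset.sum_congr rfl fun j _ => Finset.sum_congr rfl fun k _ => by ring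
    have h6 : ∀ j k, ‖c j‖ * ‖c k‖ *
      (6 * (lowerPoisson (fun k => (z k).im) j k + lowerPoisson (fun k => (z k).im) k j))
      = 6 * (‖c j‖ * ‖c k‖ * lowerPoisson (fun k => (z k).im) j k)
        + 6 * (‖c j‖ * ‖c k‖ * lowerPoisson (fun k => (z k).im) k j) := fun j k => by ring
    simp only [h6, Finset.sum_add_distrib, ← Finset.mul_sum, h5]
    ring
  linarith

/-- A discrete maximal inequality for Fourier-Laplace transforms of square integrable functions. -/
theorem sum_sq_norm_integral_exp_le {z : ℕ → ℂ} (hz : ∀ k, 1 ≤ (z k).im)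
    (hsep : ∀ j k : ℕ, |(j : ℝ) - k| ≤ |(z j).re - (z k).re| + max (z j).im (z k).im)
    {g : ℝ → ℂ} (hg : MemLp g 2 (volume.restrict (Icc (0 : ℝ) 1))) (s : Finset ℕ) :
    ∑ k ∈ s, ‖∫ t in (0 : ℝ)..1, g t * Complex.exp (2 * Complex.I * z k * t)‖ ^ 2
      ≤ 2304 * ∫ t in (0 : ℝ)..1, ‖g t‖ ^ 2 := by
  set H : ℕ → ℂ := fun k => ∫ t in (0 : ℝ)..1, g t * Complex.exp (2 * Complex.I * z k * t)
    with hH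
  -- Duality: with the coefficients `conj (H k)` the sum `S` of squares equals `∫ g E`.
  -- Cauchy-Schwarz and the exponential sum bound give `S² ≤ ‖g‖² · 2304 S`.
  set E : ℝ → ℂ := fun t => ∑ k ∈ s, conj (H k) * Complex.exp (2 * Complex.I * z k * t) with hE
  have hEc : Continuous E := by fun_prop
  have hgi := intervalIntegrable_of_memLp hg
  have h1 : ((∑ k ∈ s, ‖H k‖ ^ 2 : ℝ) : ℂ) = ∫ t in (0 : ℝ)..1, g t * E t := by
    have h2 : ∀ t, g t * E t
        = ∑ k ∈ s, conj (H k) * (g t * Complex.exp (2 * Complex.I * z k * t)) := fun t => by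
      rw [hE, Finset.mul_sum]
      exact Finset.sum_congr rfl fun k _ => by ring
    simp only [h2]
    rw [intervalIntegral.integral_finsetSum fun k _ =>
      (hgi.mul_continuousOn (Continuous.continuousOn (by fun_prop))).const_mul _]
    push_cast
    refine Finset.sum_congr rfl fun k _ => ?_
    rw [intervalIntegral.integral_const_mul, mul_comm, Complex.mul_conj, Complex.normSq_eq_norm_sq]
    push_cast
    rfl
  set S := ∑ k ∈ s, ‖H k‖ ^ 2 with hS
  have hS0 : 0 ≤ S := Finset.sum_nonneg fun _ _ => sq_nonneg _
  have h3 : S ≤ ∫ t in (0 : ℝ)..1, ‖g t‖ * ‖E t‖ := by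
    have h4 : S = ‖(S : ℂ)‖ := by rw [Complex.norm_real, Real.norm_eq_abs, abs_of_nonneg hS0]
    rw [h4, h1]
    refine intervalIntegral.norm_integral_le_of_norm_le zero_le_one
      (Filter.Eventually.of_forall fun t _ => (norm_mul _ _).le) ?_
    exact hgi.norm.mul_continuousOn hEc.norm.continuousOn
  have h5 : S ^ 2 ≤ (∫ t in (0 : ℝ)..1, ‖g t‖ ^ 2) * ∫ t in (0 : ℝ)..1, ‖E t‖ ^ 2 :=
    (pow_le_pow_left₀ hS0 h3 2).trans
      (sq_intervalIntegral_mul_le hg.norm hEc.norm.continuousOn (by simp))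
  have h6 := integral_sq_norm_exp_sum_le hz hsep s (fun k => conj (H k))
  simp only [RCLike.norm_conj] at h6
  change ∫ t in (0 : ℝ)..1, ‖E t‖ ^ 2 ≤ 2304 * S at h6
  have hG0 : 0 ≤ ∫ t in (0 : ℝ)..1, ‖g t‖ ^ 2 :=
    intervalIntegral.integral_nonneg zero_le_one fun _ _ => sq_nonneg _
  by_contra hlt
  push Not at hlt
  have hSpos : 0 < S := lt_of_le_of_lt (by positivity) hlt
  nlinarith [mul_le_mul_of_nonneg_left h6 hG0, mul_lt_mul_of_pos_right hlt hSpos]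

/-- The maximal inequality for points on concentric annuli in the closed first quadrant. -/
theorem exists_sum_sq_norm_integral_exp_le :
    ∃ C : ℝ, 0 ≤ C ∧ ∀ (z : ℕ → ℂ) (s : Finset ℕ),
      (∀ k ∈ s, 0 ≤ (z k).re ∧ 0 ≤ (z k).im ∧ (k + 1 - 1 / 2) * Real.pi ≤ ‖z k‖ ∧
        ‖z k‖ ≤ (k + 1 + 1 / 2) * Real.pi) →
      ∀ g : ℝ → ℂ, MemLp g 2 (volume.restrict (Icc (0 : ℝ) 1)) →
        ∑ k ∈ s, ‖∫ t in (0 : ℝ)..1, g t * Complex.exp (2 * Complex.I * z k * t)‖ ^ 2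
          ≤ C * ∫ t in (0 : ℝ)..1, ‖g t‖ ^ 2 := by
  refine ⟨2304 * Real.exp 2 ^ 2, by positivity, fun z s hz g hg => ?_⟩
  classical
  have hpi := Real.pi_gt_three
  -- The shift by `i` secures imaginary parts at least `1`. It is undone by the factor `e^{2t}` on
  -- `g`, which costs `e²` in norm. Indices outside `s` receive dummy points so that separation
  -- holds for all indices.
  set z' : ℕ → ℂ := fun k => (if k ∈ s then z k else ((k + 1) * Real.pi : ℝ)) + Complex.I with hz'
  have hprop : ∀ k, 0 ≤ (z' k).re ∧ 1 ≤ (z' k).im ∧ (k + 1 / 2) * Real.pi ≤ (z' k).re + ((z' k).im - 1) ∧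
      (z' k).re ≤ (k + 3 / 2) * Real.pi := by
    intro k
    by_cases hk : k ∈ s
    · obtain ⟨h1, h2, h3, h4⟩ := hz k hk
      have e1 : (z' k).re = (z k).re := by simp [hz', hk]
      have e2 : (z' k).im = (z k).im + 1 := by simp [hz', hk]
      rw [e1, e2]
      have h5 := Complex.norm_le_abs_re_add_abs_im (z k)
      rw [abs_of_nonneg h1, abs_of_nonneg h2] at h5
      have h6 := (le_abs_self _).trans (Complex.abs_re_le_norm (z k))
      refine ⟨h1, by linarith, ?_, ?_⟩
      · have : ((k : ℝ) + 1 / 2) * Real.pi = (k + 1 - 1 / 2) * Real.pi := by ring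
        linarith
      · have : ((k : ℝ) + 3 / 2) * Real.pi = (k + 1 + 1 / 2) * Real.pi := by ring
        linarith
    · have e1 : (z' k).re = (k + 1) * Real.pi := by simp [hz', hk]
      have e2 : (z' k).im = 1 := by simp [hz', hk]
      rw [e1, e2]
      refine ⟨by positivity, le_rfl, ?_, ?_⟩ <;> nlinarith
  have hsep : ∀ j k : ℕ, |(j : ℝ) - k| ≤ |(z' j).re - (z' k).re| + max (z' j).im (z' k).im := by
    intro j k
    wlog h : k ≤ j generalizing j k
    · have := this k j (not_le.1 h).le
      rwa [abs_sub_comm, max_comm, abs_sub_comm (z' k).re] at this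
    obtain ⟨a1, a2, a3, a4⟩ := hprop j
    obtain ⟨b1, b2, b3, b4⟩ := hprop k
    rcases h.eq_or_lt with rfl | h
    · simp; linarith
    have hjk : (k : ℝ) + 1 ≤ j := by exact_mod_cast h
    rw [abs_of_nonneg (by linarith)]
    -- In the first quadrant `|z_j| ≤ Re z_j + Im z_j`, while `Re z_k ≤ |z_k|`. Adjacent annuli
    -- touch, so one index step is lost here; the shift by `i` restores it.
    have h1 : ((j : ℝ) - k - 1) * Real.pi ≤ |(z' j).re - (z' k).re| + ((z' j).im - 1) := by
      have := le_abs_self ((z' j).re - (z' k).re)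
      nlinarith
    have h2 := le_max_left (z' j).im (z' k).im
    nlinarith
  have hcont : Continuous fun t : ℝ => Complex.exp (2 * t) := by fun_prop
  have hnorm : ∀ t ∈ Icc (0 : ℝ) 1, ‖g t * Complex.exp (2 * t)‖ ≤ Real.exp 2 * ‖g t‖ := by
    intro t ht
    rw [norm_mul, Complex.norm_exp, mul_comm]
    gcongr
    simpa using ht.2
  have hG : MemLp (fun t => g t * Complex.exp (2 * t)) 2 (volume.restrict (Icc (0 : ℝ) 1)) := by
    refine (hg.norm.const_mul (Real.exp 2)).mono
      (hg.1.mul hcont.aestronglyMeasurable) ?_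
    refine (ae_restrict_iff' measurableSet_Icc).2 (Filter.Eventually.of_forall fun t ht => ?_)
    refine (hnorm t ht).trans (le_abs_self _)
  have h := sum_sq_norm_integral_exp_le (fun k => (hprop k).2.1) hsep hG s
  have h2 : ∫ t in (0 : ℝ)..1, ‖g t * Complex.exp (2 * t)‖ ^ 2
      ≤ Real.exp 2 ^ 2 * ∫ t in (0 : ℝ)..1, ‖g t‖ ^ 2 := by
    rw [← intervalIntegral.integral_const_mul]
    have hsq : ∀ {f : ℝ → ℂ}, MemLp f 2 (volume.restrict (Icc (0 : ℝ) 1)) →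
        IntervalIntegrable (fun t => ‖f t‖ ^ 2) volume 0 1 := fun hf => by
      rw [intervalIntegrable_iff_integrableOn_Icc_of_le zero_le_one]
      exact hf.norm.integrable_sq
    refine intervalIntegral.integral_mono_on zero_le_one (hsq hG) ((hsq hg).const_mul _)
      fun t ht => ?_
    rw [← mul_pow]
    exact pow_le_pow_left₀ (norm_nonneg _) (hnorm t ht) 2
  calc _ = ∑ k ∈ s, ‖∫ t in (0 : ℝ)..1, g t * Complex.exp (2 * t) *
        Complex.exp (2 * Complex.I * z' k * t)‖ ^ 2 := by
        refine Finset.sum_congr rfl fun k hk => ?_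
        congr 2
        refine intervalIntegral.integral_congr fun t _ => ?_
        simp only [hz', hk, if_true]
        rw [mul_assoc (g t), ← Complex.exp_add]
        congr 2
        linear_combination (-2 * (t : ℂ)) * Complex.I_sq
    _ ≤ _ := h
    _ ≤ 2304 * (Real.exp 2 ^ 2 * ∫ t in (0 : ℝ)..1, ‖g t‖ ^ 2) := by gcongr
    _ = _ := by ring

end Maximal

/-! ### Gronwall's inequality in integral form -/

/-- The function `e^{-Lx} ∫₀ˣ φ - ∫₀ˣ e^{-Lt} H` is nonincreasing and vanishes at `0`. The bound
stays linear in `H`, so that it can later be summed over a family. -/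
theorem le_of_le_add_mul_integral {φ H : ℝ → ℝ} {L : ℝ} (hφ : ContinuousOn φ (Icc 0 1))
    (hH : ContinuousOn H (Icc 0 1)) (hH0 : ∀ x ∈ Icc (0 : ℝ) 1, 0 ≤ H x) (hL : 0 ≤ L)
    (h : ∀ x ∈ Icc (0 : ℝ) 1, φ x ≤ H x + L * ∫ t in (0 : ℝ)..x, φ t) :
    φ 1 ≤ H 1 + L * Real.exp L * ∫ t in (0 : ℝ)..1, H t := by
  have hu : uIcc (0 : ℝ) 1 = Icc 0 1 := uIcc_of_le zero_le_one
  have hexp : ContinuousOn (fun t : ℝ => Real.exp (-(L * t)) * H t) (Icc 0 1) :=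
    ContinuousOn.mul (Continuous.continuousOn (by fun_prop)) hH
  have hprim : ∀ {ψ : ℝ → ℝ}, ContinuousOn ψ (Icc 0 1) →
      ContinuousOn (fun x => ∫ t in (0 : ℝ)..x, ψ t) (Icc 0 1) := fun {ψ} hψ => by
    rw [← hu]
    refine intervalIntegral.continuousOn_primitive_interval' ?_ left_mem_uIcc
    exact ContinuousOn.intervalIntegrable (by rwa [hu])
  have hder : ∀ {ψ : ℝ → ℝ}, ContinuousOn ψ (Icc 0 1) → ∀ x ∈ Ioo (0 : ℝ) 1,
      HasDerivAt (fun x => ∫ t in (0 : ℝ)..x, ψ t) (ψ x) x := fun {ψ} hψ x hx => by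
    refine intervalIntegral.integral_hasDerivAt_right ?_ ?_ ?_
    · refine ContinuousOn.intervalIntegrable (hψ.mono ?_)
      rw [uIcc_of_le hx.1.le]
      exact Icc_subset_Icc_right hx.2.le
    · exact (hψ.mono Ioo_subset_Icc_self).stronglyMeasurableAtFilter isOpen_Ioo x hx
    · exact hψ.continuousAt (Icc_mem_nhds hx.1 hx.2)
  set D : ℝ → ℝ := fun x => Real.exp (-(L * x)) * (∫ t in (0 : ℝ)..x, φ t)
    - ∫ t in (0 : ℝ)..x, Real.exp (-(L * t)) * H t with hD
  have hDc : ContinuousOn D (Icc 0 1) :=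
    (ContinuousOn.mul (Continuous.continuousOn (by fun_prop)) (hprim hφ)).sub (hprim hexp)
  have hDd : ∀ x ∈ Ioo (0 : ℝ) 1, HasDerivAt D
      ((-L * Real.exp (-(L * x))) * (∫ t in (0 : ℝ)..x, φ t) + Real.exp (-(L * x)) * φ x
        - Real.exp (-(L * x)) * H x) x := by
    intro x hx
    have h1 : HasDerivAt (fun x : ℝ => Real.exp (-(L * x))) (-L * Real.exp (-(L * x))) x := by
      have := ((hasDerivAt_id x).const_mul L).neg.exp
      simp only [id, mul_one] at this
      rw [mul_comm]
      exact this
    exact (h1.mul (hder hφ x hx)).sub (hder hexp x hx)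
  have hanti : AntitoneOn D (Icc 0 1) := by
    refine antitoneOn_of_deriv_nonpos (convex_Icc 0 1) hDc ?_ ?_
    · rw [interior_Icc]
      exact fun x hx => (hDd x hx).differentiableAt.differentiableWithinAt
    · rw [interior_Icc]
      intro x hx
      rw [(hDd x hx).deriv]
      have := h x (Ioo_subset_Icc_self hx)
      nlinarith [Real.exp_pos (-(L * x))]
  have h1 : D 1 ≤ D 0 := hanti (by simp) (by simp) zero_le_one
  have h2 : D 0 = 0 := by simp [hD]
  have hHi : IntervalIntegrable H volume 0 1 := ContinuousOn.intervalIntegrable (by rwa [hu])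
  have h3 : ∫ t in (0 : ℝ)..1, Real.exp (-(L * t)) * H t ≤ ∫ t in (0 : ℝ)..1, H t := by
    refine intervalIntegral.integral_mono_on zero_le_one
      (ContinuousOn.intervalIntegrable (by rwa [hu])) hHi fun t ht => ?_
    have : Real.exp (-(L * t)) ≤ 1 := Real.exp_le_one_iff.2 (by nlinarith [ht.1])
    nlinarith [hH0 t ht]
  have h4 : ∫ t in (0 : ℝ)..1, φ t ≤ Real.exp L * ∫ t in (0 : ℝ)..1, H t := by
    have h5 : Real.exp (-L) * (∫ t in (0 : ℝ)..1, φ t) ≤ ∫ t in (0 : ℝ)..1, H t := by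
      simp only [hD, mul_one] at h1 h2
      simp only [mul_zero, intervalIntegral.integral_same, sub_self] at h1
      linarith
    calc ∫ t in (0 : ℝ)..1, φ t
        = Real.exp L * (Real.exp (-L) * ∫ t in (0 : ℝ)..1, φ t) := by
          rw [← mul_assoc, ← Real.exp_add]; simp
      _ ≤ _ := by gcongr
  have h6 := h 1 (by simp)
  nlinarith [mul_le_mul_of_nonneg_left h4 hL]

/-! ### Perturbations of the free system -/

/-- The size of the first-order Born term of the perturbation `q` of the free system. -/
noncomputable def bornTerm (q : ℝ → ℂ) (ζ : ℂ) (x : ℝ) : ℝ :=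
  Real.exp (-(|ζ.im| * x)) * ‖Complex.exp (Complex.I * ζ * x) *
    ∫ t in (0 : ℝ)..x, q t * Complex.exp (-(2 * Complex.I * ζ * t))‖

theorem continuousOn_bornTerm {q : ℝ → ℂ} (hq : IntervalIntegrable q volume 0 1) (ζ : ℂ) :
    ContinuousOn (bornTerm q ζ) (Icc 0 1) := by
  have h1 : ContinuousOn (fun x : ℝ => ∫ t in (0 : ℝ)..x,
      q t * Complex.exp (-(2 * Complex.I * ζ * t))) (Icc 0 1) := by
    rw [← uIcc_of_le zero_le_one]
    exact intervalIntegral.continuousOn_primitive_interval'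
      (hq.mul_continuousOn (Continuous.continuousOn (by fun_prop))) left_mem_uIcc
  unfold bornTerm
  exact ContinuousOn.mul (Continuous.continuousOn (by fun_prop))
    (ContinuousOn.norm (ContinuousOn.mul (Continuous.continuousOn (by fun_prop)) h1))

theorem norm_exp_I_mul (ζ : ℂ) (x : ℝ) :
    ‖Complex.exp (Complex.I * ζ * x)‖ = Real.exp (-(ζ.im * x)) := by
  rw [Complex.norm_exp]
  simp

theorem norm_exp_I_mul_le (ζ : ℂ) {x : ℝ} (hx : 0 ≤ x) :
    ‖Complex.exp (Complex.I * ζ * x)‖ ≤ Real.exp (|ζ.im| * x) := by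
  rw [norm_exp_I_mul]
  exact Real.exp_le_exp.2 (by nlinarith [neg_abs_le ζ.im])

/-- The normalized distance of a component of a solution from the free solution. -/
noncomputable def freeDeviation (f : ℝ → ℂ) (ζ : ℂ) (x : ℝ) : ℝ :=
  Real.exp (-(|ζ.im| * x)) * ‖f x - Complex.exp (Complex.I * ζ * x) * f 0‖

theorem freeDeviation_nonneg (f : ℝ → ℂ) (ζ : ℂ) (x : ℝ) : 0 ≤ freeDeviation f ζ x := by
  unfold freeDeviation; positivity

theorem continuousOn_freeDeviation {f : ℝ → ℂ} (hf : ContinuousOn f (Icc 0 1)) (ζ : ℂ) :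
    ContinuousOn (freeDeviation f ζ) (Icc 0 1) := by
  unfold freeDeviation
  exact ContinuousOn.mul (Continuous.continuousOn (by fun_prop))
    (ContinuousOn.norm (hf.sub (Continuous.continuousOn (by fun_prop))))

/-- Variation of constants with integrating factor `e^{-iζx}`. Split `g` into its free part and a
remainder: `q` times the free part is the Born term, and `q` times the remainder goes under the
integral. The terms with `ρ, σ` see the free growth and contribute `2δ`. -/
theorem freeDeviation_le {q ρ σ f g : ℝ → ℂ} {ζ : ℂ} {δ : ℝ}
    (hq : IntervalIntegrable q volume 0 1) (hρc : ContinuousOn ρ (Icc 0 1))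
    (hσc : ContinuousOn σ (Icc 0 1)) (hg : ContinuousOn g (Icc 0 1))
    (hρ : ∀ t ∈ Icc (0 : ℝ) 1, ‖ρ t‖ ≤ δ) (hσ : ∀ t ∈ Icc (0 : ℝ) 1, ‖σ t‖ ≤ δ)
    (hf0 : ‖f 0‖ ≤ 1) (hg0 : ‖g 0‖ ≤ 1)
    (hf : IsPrim f fun t => Complex.I * ζ * f t + q t * g t + (ρ t * f t + σ t * g t))
    {x : ℝ} (hx : x ∈ Icc (0 : ℝ) 1) :
    freeDeviation f ζ x ≤ bornTerm q ζ x + 2 * δ + ∫ t in (0 : ℝ)..x,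
      (‖q t‖ * freeDeviation g (-ζ) t
        + δ * (freeDeviation f ζ t + freeDeviation g (-ζ) t)) := by
  have hu : uIcc (0 : ℝ) 1 = Icc 0 1 := uIcc_of_le zero_le_one
  have hδ : 0 ≤ δ := (norm_nonneg _).trans (hρ 0 (by simp))
  have hfc := hf.continuousOn
  have hsub : uIcc (0 : ℝ) x ⊆ Icc 0 1 := by
    rw [uIcc_of_le hx.1]; exact Icc_subset_Icc_right hx.2
  have hsub' : uIcc (0 : ℝ) x ⊆ uIcc 0 1 := by rwa [hu]
  set φ : ℝ → ℂ := fun t => f t - Complex.exp (Complex.I * ζ * t) * f 0 with hφ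
  set ψ : ℝ → ℂ := fun t => g t - Complex.exp (Complex.I * (-ζ) * t) * g 0 with hψ
  have hφc : ContinuousOn φ (Icc 0 1) := hfc.sub (Continuous.continuousOn (by fun_prop))
  have hψc : ContinuousOn ψ (Icc 0 1) := hg.sub (Continuous.continuousOn (by fun_prop))
  set b : ℝ → ℂ := fun t => Complex.exp (Complex.I * (-ζ) * t) *
    (q t * ψ t + (ρ t * f t + σ t * g t)) with hb
  have he : IsPrim (fun t : ℝ => Complex.exp (Complex.I * (-ζ) * t))
      (fun t : ℝ => Complex.I * (-ζ) * Complex.exp (Complex.I * (-ζ) * t)) := by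
    refine IsPrim.of_hasDerivAt (fun t => ?_) (by fun_prop)
    have := ((hasDerivAt_id (t : ℂ)).const_mul (Complex.I * (-ζ))).cexp.comp_ofReal
    simp only [id, mul_one] at this
    exact this.congr_deriv (mul_comm _ _)
  have hprod := (he.mul hf).eq_add_integral x hx
  have hbi : IntervalIntegrable b volume 0 x := by
    refine IntervalIntegrable.continuousOn_mul ?_ (Continuous.continuousOn (by fun_prop))
    refine ((hq.mono_set hsub').mul_continuousOn (hψc.mono hsub)).add ?_
    exact ContinuousOn.intervalIntegrable (((hρc.mul hfc).add (hσc.mul hg)).mono hsub)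
  have hqi : IntervalIntegrable (fun t : ℝ => q t * Complex.exp (-(2 * Complex.I * ζ * t)))
      volume 0 x :=
    (hq.mono_set hsub').mul_continuousOn (Continuous.continuousOn (by fun_prop))
  have hint : Complex.exp (Complex.I * (-ζ) * x) * f x = f 0
      + (g 0 * (∫ t in (0 : ℝ)..x, q t * Complex.exp (-(2 * Complex.I * ζ * t)))
        + ∫ t in (0 : ℝ)..x, b t) := by
    rw [hprod, ← intervalIntegral.integral_const_mul,
      ← intervalIntegral.integral_add (hqi.const_mul _) hbi]
    simp only [Complex.ofReal_zero, mul_zero, Complex.exp_zero, one_mul]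
    congr 1
    refine intervalIntegral.integral_congr fun t _ => ?_
    have h2 : Complex.exp (-(2 * Complex.I * ζ * t))
        = Complex.exp (Complex.I * (-ζ) * t) * Complex.exp (Complex.I * (-ζ) * t) := by
      rw [← Complex.exp_add]; congr 1; ring
    simp only [hb, hψ]
    rw [h2]
    ring
  have hφx : φ x = g 0 * (Complex.exp (Complex.I * ζ * x) *
        ∫ t in (0 : ℝ)..x, q t * Complex.exp (-(2 * Complex.I * ζ * t)))
      + Complex.exp (Complex.I * ζ * x) * ∫ t in (0 : ℝ)..x, b t := by
    have h1 : Complex.exp (Complex.I * ζ * x) * Complex.exp (Complex.I * (-ζ) * x) = 1 := by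
      rw [← Complex.exp_add]; simp
    have h2 : f x = Complex.exp (Complex.I * ζ * x) *
        (Complex.exp (Complex.I * (-ζ) * x) * f x) := by
      rw [← mul_assoc, h1, one_mul]
    simp only [hφ]
    rw [h2, hint]
    ring
  have hyx : |ζ.im| * x = |ζ.im| * x := rfl
  set y := |ζ.im| with hy
  have hy' : |(-ζ).im| = y := by simp [hy]
  have hdevf : ∀ t, freeDeviation f ζ t = Real.exp (-(y * t)) * ‖φ t‖ := fun t => rfl
  have hdevg : ∀ t, freeDeviation g (-ζ) t = Real.exp (-(y * t)) * ‖ψ t‖ := fun t => by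
    unfold freeDeviation; rw [hy']
  have hfg : ∀ t ∈ Icc (0 : ℝ) 1, ‖ρ t * f t + σ t * g t‖
      ≤ δ * (‖φ t‖ + ‖ψ t‖) + 2 * δ * Real.exp (y * t) := by
    intro t ht
    have h1 : ‖f t‖ ≤ ‖φ t‖ + Real.exp (y * t) := by
      have : f t = φ t + Complex.exp (Complex.I * ζ * t) * f 0 := by simp [hφ]
      rw [this]
      refine (norm_add_le _ _).trans (add_le_add le_rfl ?_)
      rw [norm_mul]
      calc _ ≤ Real.exp (y * t) * 1 := mul_le_mul (norm_exp_I_mul_le ζ ht.1) hf0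
            (norm_nonneg _) (Real.exp_pos _).le
        _ = _ := mul_one _
    have h2 : ‖g t‖ ≤ ‖ψ t‖ + Real.exp (y * t) := by
      have : g t = ψ t + Complex.exp (Complex.I * (-ζ) * t) * g 0 := by simp [hψ]
      rw [this]
      refine (norm_add_le _ _).trans (add_le_add le_rfl ?_)
      rw [norm_mul]
      have h3 := norm_exp_I_mul_le (-ζ) ht.1
      rw [hy'] at h3
      calc _ ≤ Real.exp (y * t) * 1 := mul_le_mul h3 hg0 (norm_nonneg _) (Real.exp_pos _).le
        _ = _ := mul_one _
    calc ‖ρ t * f t + σ t * g t‖ ≤ ‖ρ t‖ * ‖f t‖ + ‖σ t‖ * ‖g t‖ := by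
          rw [← norm_mul, ← norm_mul]; exact norm_add_le _ _
      _ ≤ δ * (‖φ t‖ + Real.exp (y * t)) + δ * (‖ψ t‖ + Real.exp (y * t)) :=
          add_le_add (mul_le_mul (hρ t ht) h1 (norm_nonneg _) hδ)
            (mul_le_mul (hσ t ht) h2 (norm_nonneg _) hδ)
      _ = _ := by ring
  have hcf := continuousOn_freeDeviation hfc ζ
  have hcg := continuousOn_freeDeviation hg (-ζ)
  have hGi : IntervalIntegrable (fun t => ‖q t‖ * freeDeviation g (-ζ) t
        + δ * (freeDeviation f ζ t + freeDeviation g (-ζ) t)) volume 0 x :=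
    ((hq.norm.mono_set hsub').mul_continuousOn (hcg.mono hsub)).add
      (ContinuousOn.intervalIntegrable
        ((continuousOn_const.mul (hcf.add hcg)).mono hsub))
  have hbb : Real.exp (-(y * x)) * ‖Complex.exp (Complex.I * ζ * x) * ∫ t in (0 : ℝ)..x, b t‖
      ≤ ∫ t in (0 : ℝ)..x, ((‖q t‖ * freeDeviation g (-ζ) t
        + δ * (freeDeviation f ζ t + freeDeviation g (-ζ) t)) + 2 * δ) := by
    rw [← intervalIntegral.integral_const_mul, ← Real.norm_of_nonneg (Real.exp_pos (-(y * x))).le,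
      ← Complex.norm_real, ← norm_mul, ← intervalIntegral.integral_const_mul]
    refine intervalIntegral.norm_integral_le_of_norm_le hx.1
      (Filter.Eventually.of_forall fun t ht => ?_) (hGi.add intervalIntegrable_const)
    have ht1 : t ∈ Icc (0 : ℝ) 1 := ⟨ht.1.le, ht.2.trans hx.2⟩
    rw [norm_mul, norm_mul, Complex.norm_real, Real.norm_of_nonneg (Real.exp_pos _).le]
    have h1 : ‖Complex.exp (Complex.I * ζ * x)‖ * ‖b t‖
        = ‖Complex.exp (Complex.I * ζ * ((x - t : ℝ) : ℂ))‖ *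
          ‖q t * ψ t + (ρ t * f t + σ t * g t)‖ := by
      rw [hb, norm_mul, ← mul_assoc, ← norm_mul, ← Complex.exp_add]
      congr 3
      push_cast
      ring
    rw [h1]
    have h2 : ‖q t * ψ t + (ρ t * f t + σ t * g t)‖ ≤ ‖q t‖ * ‖ψ t‖
        + (δ * (‖φ t‖ + ‖ψ t‖) + 2 * δ * Real.exp (y * t)) := by
      rw [← norm_mul]
      exact (norm_add_le _ _).trans (add_le_add le_rfl (hfg t ht1))
    -- Propagation from `t` to `x` costs at most `e^{y(x-t)}`, which turns the weight at `x` into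
    -- the weight at `t`; no exponential growth survives.
    calc _ ≤ Real.exp (-(y * x)) * (Real.exp (y * (x - t)) * (‖q t‖ * ‖ψ t‖
        + (δ * (‖φ t‖ + ‖ψ t‖) + 2 * δ * Real.exp (y * t)))) := by
          refine mul_le_mul_of_nonneg_left ?_ (Real.exp_pos _).le
          exact mul_le_mul (norm_exp_I_mul_le ζ (by linarith [ht.2])) h2 (norm_nonneg _)
            (Real.exp_pos _).le
      _ = Real.exp (-(y * t)) * (‖q t‖ * ‖ψ t‖
        + (δ * (‖φ t‖ + ‖ψ t‖) + 2 * δ * Real.exp (y * t))) := by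
          rw [← mul_assoc, ← Real.exp_add]
          congr 2
          ring
      _ = _ := by
          rw [hdevf, hdevg]
          have h3 : Real.exp (-(y * t)) * Real.exp (y * t) = 1 := by
            rw [← Real.exp_add]; simp
          linear_combination 2 * δ * h3
  rw [intervalIntegral.integral_add hGi intervalIntegrable_const,
    intervalIntegral.integral_const] at hbb
  have hlast : (x - 0) • (2 * δ) ≤ 2 * δ := by
    rw [smul_eq_mul]; nlinarith [hx.2]
  have hmain : freeDeviation f ζ x ≤ bornTerm q ζ x + Real.exp (-(y * x)) *
      ‖Complex.exp (Complex.I * ζ * x) * ∫ t in (0 : ℝ)..x, b t‖ := by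
    rw [hdevf, hφx]
    unfold bornTerm
    rw [← hy, ← mul_add]
    refine mul_le_mul_of_nonneg_left ((norm_add_le _ _).trans (add_le_add ?_ le_rfl))
      (Real.exp_pos _).le
    rw [norm_mul]
    exact mul_le_of_le_one_left (norm_nonneg _) hg0
  linarith

theorem intervalIntegrable_sq {q : ℝ → ℝ} (hq : MemLp q 2 (volume.restrict (Icc (0 : ℝ) 1))) :
    IntervalIntegrable (fun t => q t ^ 2) volume 0 1 := by
  rw [intervalIntegrable_iff_integrableOn_Icc_of_le zero_le_one]
  exact hq.integrable_sq

/-- The normalized deviation of a solution of the perturbed system from the free solution is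
controlled by the Born terms. -/
theorem sq_freeDeviation_add_le {q ρ₁ σ₁ ρ₂ σ₂ f g : ℝ → ℂ} {ζ : ℂ} {δ : ℝ}
    (hq : MemLp q 2 (volume.restrict (Icc (0 : ℝ) 1)))
    (hρ₁c : ContinuousOn ρ₁ (Icc 0 1)) (hσ₁c : ContinuousOn σ₁ (Icc 0 1))
    (hρ₂c : ContinuousOn ρ₂ (Icc 0 1)) (hσ₂c : ContinuousOn σ₂ (Icc 0 1))
    (hρ₁ : ∀ t ∈ Icc (0 : ℝ) 1, ‖ρ₁ t‖ ≤ δ) (hσ₁ : ∀ t ∈ Icc (0 : ℝ) 1, ‖σ₁ t‖ ≤ δ)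
    (hρ₂ : ∀ t ∈ Icc (0 : ℝ) 1, ‖ρ₂ t‖ ≤ δ) (hσ₂ : ∀ t ∈ Icc (0 : ℝ) 1, ‖σ₂ t‖ ≤ δ)
    (hf0 : ‖f 0‖ ≤ 1) (hg0 : ‖g 0‖ ≤ 1)
    (hf : IsPrim f fun t => Complex.I * ζ * f t + q t * g t + (ρ₁ t * f t + σ₁ t * g t))
    (hg : IsPrim g fun t => Complex.I * (-ζ) * g t + q t * f t + (ρ₂ t * g t + σ₂ t * f t)) :
    (freeDeviation f ζ 1 + freeDeviation g (-ζ) 1) ^ 2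
      ≤ 2 * (bornTerm q ζ 1 + bornTerm q (-ζ) 1 + 4 * δ) ^ 2
        + (2 * ∫ t in (0 : ℝ)..1, (‖q t‖ + 2 * δ) ^ 2)
          * Real.exp (2 * ∫ t in (0 : ℝ)..1, (‖q t‖ + 2 * δ) ^ 2)
          * ∫ t in (0 : ℝ)..1, 2 * (bornTerm q ζ t + bornTerm q (-ζ) t + 4 * δ) ^ 2 := by
  have hqi := intervalIntegrable_of_memLp hq
  have hδ : 0 ≤ δ := (norm_nonneg _).trans (hρ₁ 0 (by simp))
  have hcf := continuousOn_freeDeviation hf.continuousOn ζ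
  have hcg := continuousOn_freeDeviation hg.continuousOn (-ζ)
  have hbc := (continuousOn_bornTerm hqi ζ).add (continuousOn_bornTerm hqi (-ζ))
  have hLp : MemLp (fun t => ‖q t‖ + 2 * δ) 2 (volume.restrict (Icc (0 : ℝ) 1)) :=
    hq.norm.add (memLp_of_continuousOn continuousOn_const)
  set N : ℝ → ℝ := fun x => freeDeviation f ζ x + freeDeviation g (-ζ) x with hN
  set h : ℝ → ℝ := fun x => bornTerm q ζ x + bornTerm q (-ζ) x + 4 * δ with hh
  have hNc : ContinuousOn N (Icc 0 1) := hcf.add hcg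
  have hhc : ContinuousOn h (Icc 0 1) := hbc.add continuousOn_const
  have hN0 : ∀ x, 0 ≤ N x := fun x =>
    add_nonneg (freeDeviation_nonneg _ _ _) (freeDeviation_nonneg _ _ _)
  have key : ∀ x ∈ Icc (0 : ℝ) 1, N x ≤ h x + ∫ t in (0 : ℝ)..x, (‖q t‖ + 2 * δ) * N t := by
    intro x hx
    have hsub : uIcc (0 : ℝ) x ⊆ Icc 0 1 := by
      rw [uIcc_of_le hx.1]; exact Icc_subset_Icc_right hx.2
    have hsub' : uIcc (0 : ℝ) x ⊆ uIcc 0 1 := by rwa [uIcc_of_le (zero_le_one' ℝ)]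
    have h1 := freeDeviation_le hqi hρ₁c hσ₁c hg.continuousOn hρ₁ hσ₁ hf0 hg0 hf hx
    have h2 := freeDeviation_le hqi hρ₂c hσ₂c hf.continuousOn hρ₂ hσ₂ hg0 hf0 hg hx
    rw [neg_neg] at h2
    have hqx := hqi.norm.mono_set hsub'
    have i1 : IntervalIntegrable (fun t => ‖q t‖ * freeDeviation g (-ζ) t
        + δ * (freeDeviation f ζ t + freeDeviation g (-ζ) t)) volume 0 x :=
      (hqx.mul_continuousOn (hcg.mono hsub)).add
        (ContinuousOn.intervalIntegrable ((continuousOn_const.mul (hcf.add hcg)).mono hsub))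
    have i2 : IntervalIntegrable (fun t => ‖q t‖ * freeDeviation f ζ t
        + δ * (freeDeviation g (-ζ) t + freeDeviation f ζ t)) volume 0 x :=
      (hqx.mul_continuousOn (hcf.mono hsub)).add
        (ContinuousOn.intervalIntegrable ((continuousOn_const.mul (hcg.add hcf)).mono hsub))
    have h3 : ∫ t in (0 : ℝ)..x, (‖q t‖ + 2 * δ) * N t
        = (∫ t in (0 : ℝ)..x, (‖q t‖ * freeDeviation g (-ζ) t
          + δ * (freeDeviation f ζ t + freeDeviation g (-ζ) t)))
        + ∫ t in (0 : ℝ)..x, (‖q t‖ * freeDeviation f ζ t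
          + δ * (freeDeviation g (-ζ) t + freeDeviation f ζ t)) := by
      rw [← intervalIntegral.integral_add i1 i2]
      refine intervalIntegral.integral_congr fun t _ => ?_
      simp only [hN]
      ring
    rw [h3]
    simp only [hN, hh]
    linarith
  -- After squaring, Cauchy-Schwarz moves the `L²` kernel `‖q‖ + 2δ` into a constant, so Gronwall
  -- applies with constant coefficient and the result is linear in `h²`.
  have key2 : ∀ x ∈ Icc (0 : ℝ) 1, N x ^ 2 ≤ 2 * h x ^ 2
      + (2 * ∫ t in (0 : ℝ)..1, (‖q t‖ + 2 * δ) ^ 2) * ∫ t in (0 : ℝ)..x, N t ^ 2 := by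
    intro x hx
    have h1 := sq_intervalIntegral_mul_le hLp hNc hx
    have h2 := pow_le_pow_left₀ (hN0 x) (key x hx) 2
    nlinarith [sq_nonneg (h x - ∫ t in (0 : ℝ)..x, (‖q t‖ + 2 * δ) * N t)]
  refine le_of_le_add_mul_integral (hNc.pow 2) (continuousOn_const.mul (hhc.pow 2))
    (fun x _ => mul_nonneg zero_le_two (sq_nonneg _)) ?_ key2
  exact mul_nonneg zero_le_two
    (intervalIntegral.integral_nonneg zero_le_one fun _ _ => sq_nonneg _)

/-! ### Square summability of the Born terms -/

/-- Conjugating the integral reflects `ζ` in the imaginary axis and conjugates `q`. This reduces `Im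
ζ < 0` to the upper half-plane. -/
theorem bornTerm_conj (q : ℝ → ℂ) (ζ : ℂ) (x : ℝ) :
    bornTerm q ζ x
      = bornTerm (fun t => (starRingEnd ℂ) (q t)) (-(starRingEnd ℂ) ζ) x := by
  unfold bornTerm
  have h1 : |(-(starRingEnd ℂ) ζ).im| = |ζ.im| := by simp
  rw [h1, ← RCLike.norm_conj (Complex.exp (Complex.I * ζ * x) * _), map_mul,
    ← Complex.exp_conj]
  congr 2
  rw [← intervalIntegral.intervalIntegral_conj]
  congr 1
  · congr 1
    simp
  · refine intervalIntegral.integral_congr fun t _ => ?_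
    simp only [map_mul, ← Complex.exp_conj, map_neg, Complex.conj_I, Complex.conj_ofReal,
      Complex.conj_ofNat]
    congr 2
    ring

/-- For this sign the modulus of the prefactor `e^{-izx}` cancels the weight `e^{-|Im z|x}` exactly,
leaving a transform with a decaying kernel of `q` cut off at `x`. -/
theorem bornTerm_eq_of_im_nonneg {q : ℝ → ℂ} {z : ℂ} (hz : 0 ≤ z.im) {x : ℝ}
    (hx : x ∈ Icc (0 : ℝ) 1) :
    bornTerm q (-z) x = ‖∫ t in (0 : ℝ)..1, (Iic x).indicator q t *
      Complex.exp (2 * Complex.I * z * t)‖ := by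
  have h2 : ∫ t in (0 : ℝ)..1, (Iic x).indicator q t * Complex.exp (2 * Complex.I * z * t)
      = ∫ t in (0 : ℝ)..x, q t * Complex.exp (2 * Complex.I * z * t) := by
    rw [← intervalIntegral.integral_indicator hx]
    refine intervalIntegral.integral_congr fun t _ => ?_
    simp only [indicator, mem_Iic, mem_ofPred_eq]
    split_ifs <;> simp
  rw [h2]
  unfold bornTerm
  rw [norm_mul, norm_exp_I_mul, ← mul_assoc, ← Real.exp_add]
  have h3 : -(|(-z).im| * x) + -((-z).im * x) = 0 := by
    rw [Complex.neg_im, abs_neg, abs_of_nonneg hz]; ring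
  rw [h3, Real.exp_zero, one_mul]
  simp

/-- Here the kernel grows with `t`; the reflection `t ↦ x - t` makes it decay, at the price of
reflecting `q`. -/
theorem bornTerm_eq_of_im_nonneg' {q : ℝ → ℂ} {z : ℂ} (hz : 0 ≤ z.im) {x : ℝ}
    (hx : x ∈ Icc (0 : ℝ) 1) :
    bornTerm q z x = ‖∫ t in (0 : ℝ)..1, (Iic x).indicator (fun t => q (x - t)) t *
      Complex.exp (2 * Complex.I * z * t)‖ := by
  rw [← bornTerm_eq_of_im_nonneg hz hx]
  unfold bornTerm
  have h1 : ∫ t in (0 : ℝ)..x, q t * Complex.exp (-(2 * Complex.I * z * t))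
      = Complex.exp (-(2 * Complex.I * z * x)) *
        ∫ t in (0 : ℝ)..x, q (x - t) * Complex.exp (-(2 * Complex.I * (-z) * t)) := by
    have h2 := intervalIntegral.integral_comp_sub_left
      (fun t : ℝ => q t * Complex.exp (-(2 * Complex.I * z * t))) (a := 0) (b := x) x
    simp only [sub_self, sub_zero] at h2
    rw [← h2, ← intervalIntegral.integral_const_mul]
    refine intervalIntegral.integral_congr fun t _ => ?_
    have h3 : Complex.exp (-(2 * Complex.I * z * ((x - t : ℝ) : ℂ)))
        = Complex.exp (-(2 * Complex.I * z * x)) * Complex.exp (-(2 * Complex.I * (-z) * t)) := by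
      rw [← Complex.exp_add]; congr 1; push_cast; ring
    simp only [h3]
    ring
  rw [h1, ← mul_assoc, ← Complex.exp_add, Complex.neg_im, abs_neg]
  congr 4
  ring

theorem memLp_indicator_Iic {q : ℝ → ℂ} (hq : MemLp q 2 (volume.restrict (Icc (0 : ℝ) 1)))
    (x : ℝ) : MemLp ((Iic x).indicator q) 2 (volume.restrict (Icc (0 : ℝ) 1)) :=
  hq.indicator measurableSet_Iic

theorem memLp_indicator_Iic_comp_sub {q : ℝ → ℂ}
    (hq : MemLp q 2 (volume.restrict (Icc (0 : ℝ) 1))) {x : ℝ} (hx : x ∈ Icc (0 : ℝ) 1) :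
    MemLp ((Iic x).indicator fun t => q (x - t)) 2 (volume.restrict (Icc (0 : ℝ) 1)) := by
  have h1 : MemLp ((Icc (0 : ℝ) 1).indicator q) 2 volume :=
    (memLp_indicator_iff_restrict measurableSet_Icc).2 hq
  have h2 := h1.comp_measurePreserving (Measure.measurePreserving_sub_left volume x)
  have h3 := (h2.restrict (Icc (0 : ℝ) 1)).indicator (measurableSet_Iic (a := x))
  refine (memLp_congr_ae ?_).1 h3
  refine (ae_restrict_iff' measurableSet_Icc).2 (Filter.Eventually.of_forall fun t ht => ?_)
  by_cases htx : t ≤ x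
  · have : x - t ∈ Icc (0 : ℝ) 1 := ⟨by linarith, by linarith [ht.1, hx.2]⟩
    simp only [indicator, mem_Iic, htx, if_true, Function.comp, this]
  · simp [indicator, htx]

theorem integral_sq_norm_indicator_Iic (q : ℝ → ℂ) {x : ℝ} (hx : x ∈ Icc (0 : ℝ) 1) :
    ∫ t in (0 : ℝ)..1, ‖(Iic x).indicator q t‖ ^ 2 = ∫ t in (0 : ℝ)..x, ‖q t‖ ^ 2 := by
  rw [← intervalIntegral.integral_indicator hx]
  refine intervalIntegral.integral_congr fun t _ => ?_
  simp only [indicator, mem_Iic, mem_ofPred_eq]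
  split_ifs <;> simp

theorem integral_sq_norm_indicator_Iic_le {q : ℝ → ℂ}
    (hq : MemLp q 2 (volume.restrict (Icc (0 : ℝ) 1))) {x : ℝ} (hx : x ∈ Icc (0 : ℝ) 1) :
    ∫ t in (0 : ℝ)..1, ‖(Iic x).indicator q t‖ ^ 2 ≤ ∫ t in (0 : ℝ)..1, ‖q t‖ ^ 2 := by
  rw [integral_sq_norm_indicator_Iic q hx]
  exact integral_mono_of_le_one (intervalIntegrable_sq hq.norm) (fun t => sq_nonneg _) hx

theorem integral_sq_norm_indicator_Iic_comp_sub_le {q : ℝ → ℂ}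
    (hq : MemLp q 2 (volume.restrict (Icc (0 : ℝ) 1))) {x : ℝ} (hx : x ∈ Icc (0 : ℝ) 1) :
    ∫ t in (0 : ℝ)..1, ‖(Iic x).indicator (fun t => q (x - t)) t‖ ^ 2
      ≤ ∫ t in (0 : ℝ)..1, ‖q t‖ ^ 2 := by
  rw [integral_sq_norm_indicator_Iic (fun t => q (x - t)) hx,
    intervalIntegral.integral_comp_sub_left (fun t => ‖q t‖ ^ 2) x, sub_self, sub_zero]
  exact integral_mono_of_le_one (intervalIntegrable_sq hq.norm) (fun t => sq_nonneg _) hx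

theorem memLp_conj {q : ℝ → ℂ} {μ : Measure ℝ} (hq : MemLp q 2 μ) :
    MemLp (fun t => (starRingEnd ℂ) (q t)) 2 μ := by
  refine hq.mono (Complex.continuous_conj.comp_aestronglyMeasurable hq.1) ?_
  exact Filter.Eventually.of_forall fun t => by simp

/-- The Born terms at points of concentric annuli are square summable. -/
theorem exists_sum_sq_bornTerm_le :
    ∃ C : ℝ, 0 ≤ C ∧ ∀ (ζ : ℕ → ℂ) (s : Finset ℕ),
      (∀ k ∈ s, 0 ≤ (ζ k).re ∧ (k + 1 - 1 / 2) * Real.pi ≤ ‖ζ k‖ ∧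
        ‖ζ k‖ ≤ (k + 1 + 1 / 2) * Real.pi) →
      ∀ q : ℝ → ℂ, MemLp q 2 (volume.restrict (Icc (0 : ℝ) 1)) → ∀ x ∈ Icc (0 : ℝ) 1,
        ∑ k ∈ s, (bornTerm q (ζ k) x + bornTerm q (-ζ k) x) ^ 2
          ≤ C * ∫ t in (0 : ℝ)..1, ‖q t‖ ^ 2 := by
  obtain ⟨C, hC0, hC⟩ := exists_sum_sq_norm_integral_exp_le
  refine ⟨8 * C, by positivity, fun ζ s hζ q hq x hx => ?_⟩
  set z : ℕ → ℂ := fun k => ⟨(ζ k).re, |(ζ k).im|⟩ with hz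
  have hnorm : ∀ k, ‖z k‖ = ‖ζ k‖ := fun k => by
    rw [← sq_eq_sq₀ (norm_nonneg _) (norm_nonneg _), ← Complex.normSq_eq_norm_sq,
      ← Complex.normSq_eq_norm_sq, Complex.normSq_apply, Complex.normSq_apply]
    simp [hz]
  have hz' : ∀ k ∈ s, 0 ≤ (z k).re ∧ 0 ≤ (z k).im ∧ (k + 1 - 1 / 2) * Real.pi ≤ ‖z k‖ ∧
        ‖z k‖ ≤ (k + 1 + 1 / 2) * Real.pi := fun k hk => by
    rw [hnorm]
    exact ⟨(hζ k hk).1, abs_nonneg _, (hζ k hk).2⟩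
  have hzim : ∀ k, 0 ≤ (z k).im := fun k => abs_nonneg _
  set p : ℝ → ℂ := fun t => (starRingEnd ℂ) (q t) with hp
  have hpL : MemLp p 2 (volume.restrict (Icc (0 : ℝ) 1)) := memLp_conj hq
  have hpq : ∫ t in (0 : ℝ)..1, ‖p t‖ ^ 2 = ∫ t in (0 : ℝ)..1, ‖q t‖ ^ 2 := by simp [hp]
  have main : ∀ r : ℝ → ℂ, MemLp r 2 (volume.restrict (Icc (0 : ℝ) 1)) →
      ∑ k ∈ s, (bornTerm r (z k) x + bornTerm r (-z k) x) ^ 2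
        ≤ 4 * C * ∫ t in (0 : ℝ)..1, ‖r t‖ ^ 2 := by
    intro r hr
    have h1 := (hC z s hz' _ (memLp_indicator_Iic hr x)).trans
      (mul_le_mul_of_nonneg_left (integral_sq_norm_indicator_Iic_le hr hx) hC0)
    have h2 := (hC z s hz' _ (memLp_indicator_Iic_comp_sub hr hx)).trans
      (mul_le_mul_of_nonneg_left (integral_sq_norm_indicator_Iic_comp_sub_le hr hx) hC0)
    have h3 : ∑ k ∈ s, (bornTerm r (z k) x + bornTerm r (-z k) x) ^ 2
        ≤ ∑ k ∈ s, (2 * bornTerm r (z k) x ^ 2 + 2 * bornTerm r (-z k) x ^ 2) :=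
      Finset.sum_le_sum fun k _ => by
        nlinarith [sq_nonneg (bornTerm r (z k) x - bornTerm r (-z k) x)]
    rw [Finset.sum_add_distrib, ← Finset.mul_sum, ← Finset.mul_sum] at h3
    simp only [← bornTerm_eq_of_im_nonneg (hzim _) hx] at h1
    simp only [← bornTerm_eq_of_im_nonneg' (hzim _) hx] at h2
    linarith
  -- The sign of `Im ζ_k` decides between `q` and its conjugate. Adding both contributions avoids
  -- splitting the sum.
  have hterm : ∀ k ∈ s, (bornTerm q (ζ k) x + bornTerm q (-ζ k) x) ^ 2
      ≤ (bornTerm q (z k) x + bornTerm q (-z k) x) ^ 2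
        + (bornTerm p (z k) x + bornTerm p (-z k) x) ^ 2 := by
    intro k _
    rcases le_total 0 (ζ k).im with h | h
    · have : z k = ζ k := Complex.ext rfl (abs_of_nonneg h)
      rw [this]
      exact le_add_of_nonneg_right (sq_nonneg _)
    · have : z k = (starRingEnd ℂ) (ζ k) := Complex.ext rfl (abs_of_nonpos h)
      rw [bornTerm_conj q (ζ k), bornTerm_conj q (-ζ k), map_neg, neg_neg, ← this,
        add_comm (bornTerm _ (-z k) x)]
      exact le_add_of_nonneg_left (sq_nonneg _)
  have h1 := main q hq
  have h2 := main p hpL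
  rw [hpq] at h2
  refine (Finset.sum_le_sum hterm).trans ?_
  rw [Finset.sum_add_distrib]
  linarith

theorem sum_one_div_add_one_sq_le (s : Finset ℕ) :
    ∑ k ∈ s, (1 / ((k : ℝ) + 1)) ^ 2 ≤ ∑' k : ℕ, (1 / ((k : ℝ) + 1)) ^ 2 := by
  have h := (summable_nat_add_iff 1).2 (Real.summable_one_div_nat_pow.2 one_lt_two)
  refine Summable.sum_le_tsum s (fun k _ => by positivity) ?_
  refine h.congr fun k => ?_
  push_cast
  rw [div_pow, one_pow]

/-- Square summability of the deviations from the free solutions. -/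
theorem exists_sum_sq_freeDeviation_le {q : ℝ → ℂ}
    (hq : MemLp q 2 (volume.restrict (Icc (0 : ℝ) 1))) {R : ℝ} (hR : 0 ≤ R) :
    ∃ C : ℝ, 0 ≤ C ∧ ∀ (ζ : ℕ → ℂ) (s : Finset ℕ) (f g ρ₁ σ₁ ρ₂ σ₂ : ℕ → ℝ → ℂ),
      (∀ k ∈ s, 0 ≤ (ζ k).re ∧ (k + 1 - 1 / 2) * Real.pi ≤ ‖ζ k‖ ∧
        ‖ζ k‖ ≤ (k + 1 + 1 / 2) * Real.pi) →
      (∀ k ∈ s, ContinuousOn (ρ₁ k) (Icc 0 1) ∧ ContinuousOn (σ₁ k) (Icc 0 1) ∧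
        ContinuousOn (ρ₂ k) (Icc 0 1) ∧ ContinuousOn (σ₂ k) (Icc 0 1)) →
      (∀ k ∈ s, ∀ t ∈ Icc (0 : ℝ) 1, ‖ρ₁ k t‖ ≤ R * (1 / (k + 1)) ∧
        ‖σ₁ k t‖ ≤ R * (1 / (k + 1)) ∧ ‖ρ₂ k t‖ ≤ R * (1 / (k + 1)) ∧
        ‖σ₂ k t‖ ≤ R * (1 / (k + 1))) →
      (∀ k ∈ s, ‖f k 0‖ ≤ 1 ∧ ‖g k 0‖ ≤ 1) →
      (∀ k ∈ s, IsPrim (f k) fun t => Complex.I * ζ k * f k t + q t * g k t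
        + (ρ₁ k t * f k t + σ₁ k t * g k t)) →
      (∀ k ∈ s, IsPrim (g k) fun t => Complex.I * (-ζ k) * g k t + q t * f k t
        + (ρ₂ k t * g k t + σ₂ k t * f k t)) →
      ∑ k ∈ s, (freeDeviation (f k) (ζ k) 1 + freeDeviation (g k) (-ζ k) 1) ^ 2 ≤ C := by
  obtain ⟨C₁, hC₁0, hC₁⟩ := exists_sum_sq_bornTerm_le
  have hqi := intervalIntegrable_of_memLp hq
  set Q := ∫ t in (0 : ℝ)..1, ‖q t‖ ^ 2 with hQ
  have hQ0 : 0 ≤ Q := intervalIntegral.integral_nonneg zero_le_one fun _ _ => sq_nonneg _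
  set Z := ∑' k : ℕ, (1 / ((k : ℝ) + 1)) ^ 2 with hZ
  have hZ0 : 0 ≤ Z := tsum_nonneg fun _ => by positivity
  set B := 2 * (C₁ * Q) + 32 * R ^ 2 * Z with hB
  set K := ∫ t in (0 : ℝ)..1, (‖q t‖ + 2 * R) ^ 2 with hK
  have hK0 : 0 ≤ K := intervalIntegral.integral_nonneg zero_le_one fun _ _ => sq_nonneg _
  have hB0 : 0 ≤ B := by positivity
  refine ⟨2 * B + 2 * K * Real.exp (2 * K) * (2 * B), by positivity, ?_⟩
  intro ζ s f g ρ₁ σ₁ ρ₂ σ₂ hζ hcont hbound hinit hf hg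
  set h : ℕ → ℝ → ℝ := fun k x => bornTerm q (ζ k) x + bornTerm q (-ζ k) x
    + 4 * (R * (1 / (k + 1))) with hh
  have hhc : ∀ k, ContinuousOn (h k) (Icc 0 1) := fun k =>
    ((continuousOn_bornTerm hqi _).add (continuousOn_bornTerm hqi _)).add continuousOn_const
  -- The bound is uniform in `x`, so it serves both at `x = 1` and under the integral left by
  -- Gronwall.
  have hsum : ∀ x ∈ Icc (0 : ℝ) 1, ∑ k ∈ s, h k x ^ 2 ≤ B := by
    intro x hx
    have h1 := hC₁ ζ s hζ q hq x hx
    have h2 := mul_le_mul_of_nonneg_left (sum_one_div_add_one_sq_le s)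
      (by positivity : 0 ≤ 32 * R ^ 2)
    have h3 : ∑ k ∈ s, h k x ^ 2 ≤ ∑ k ∈ s, (2 * (bornTerm q (ζ k) x + bornTerm q (-ζ k) x) ^ 2
        + 32 * R ^ 2 * (1 / ((k : ℝ) + 1)) ^ 2) := Finset.sum_le_sum fun k _ => by
      simp only [hh]
      nlinarith [sq_nonneg (bornTerm q (ζ k) x + bornTerm q (-ζ k) x
        - 4 * (R * (1 / ((k : ℝ) + 1))))]
    rw [Finset.sum_add_distrib, ← Finset.mul_sum, ← Finset.mul_sum] at h3
    linarith
  have hterm : ∀ k ∈ s, (freeDeviation (f k) (ζ k) 1 + freeDeviation (g k) (-ζ k) 1) ^ 2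
      ≤ 2 * h k 1 ^ 2 + 2 * K * Real.exp (2 * K) * ∫ t in (0 : ℝ)..1, 2 * h k t ^ 2 := by
    intro k hk
    obtain ⟨c1, c2, c3, c4⟩ := hcont k hk
    have h1 := sq_freeDeviation_add_le hq c1 c2 c3 c4 (fun t ht => (hbound k hk t ht).1)
      (fun t ht => (hbound k hk t ht).2.1) (fun t ht => (hbound k hk t ht).2.2.1)
      (fun t ht => (hbound k hk t ht).2.2.2) (hinit k hk).1 (hinit k hk).2 (hf k hk) (hg k hk)
    set δ := R * (1 / ((k : ℝ) + 1)) with hδ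
    have hδ0 : 0 ≤ δ := by positivity
    have hδR : δ ≤ R := by
      refine mul_le_of_le_one_right hR ?_
      rw [div_le_one (by positivity)]
      linarith [(Nat.cast_nonneg k : (0 : ℝ) ≤ k)]
    have hLp : ∀ c : ℝ, MemLp (fun t => ‖q t‖ + 2 * c) 2 (volume.restrict (Icc (0 : ℝ) 1)) :=
      fun c => hq.norm.add (memLp_of_continuousOn continuousOn_const)
    have hKk : ∫ t in (0 : ℝ)..1, (‖q t‖ + 2 * δ) ^ 2 ≤ K := by
      refine intervalIntegral.integral_mono_on zero_le_one (intervalIntegrable_sq (hLp δ))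
        (intervalIntegrable_sq (hLp R)) fun t _ => ?_
      gcongr
    have hKk0 : 0 ≤ ∫ t in (0 : ℝ)..1, (‖q t‖ + 2 * δ) ^ 2 :=
      intervalIntegral.integral_nonneg zero_le_one fun _ _ => sq_nonneg _
    have hI0 : 0 ≤ ∫ t in (0 : ℝ)..1, 2 * h k t ^ 2 :=
      intervalIntegral.integral_nonneg zero_le_one fun _ _ => by positivity
    refine h1.trans (add_le_add le_rfl ?_)
    refine mul_le_mul_of_nonneg_right ?_ hI0
    gcongr
  refine (Finset.sum_le_sum hterm).trans ?_
  rw [Finset.sum_add_distrib, ← Finset.mul_sum, ← Finset.mul_sum]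
  have hint : ∑ k ∈ s, ∫ t in (0 : ℝ)..1, 2 * h k t ^ 2 ≤ 2 * B := by
    have hi : ∀ k ∈ s, IntervalIntegrable (fun t => 2 * h k t ^ 2) volume 0 1 := fun k _ =>
      ContinuousOn.intervalIntegrable (by
        rw [uIcc_of_le zero_le_one]; exact continuousOn_const.mul ((hhc k).pow 2))
    rw [← intervalIntegral.integral_finsetSum hi]
    have h1 : ∫ t in (0 : ℝ)..1, ∑ k ∈ s, 2 * h k t ^ 2 ≤ ∫ _ in (0 : ℝ)..1, 2 * B := by
      refine intervalIntegral.integral_mono_on zero_le_one ?_ intervalIntegrable_const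
        fun t ht => ?_
      · refine ContinuousOn.intervalIntegrable ?_
        rw [uIcc_of_le zero_le_one]
        exact continuousOn_finsetSum s fun k _ => continuousOn_const.mul ((hhc k).pow 2)
      · rw [← Finset.mul_sum]
        linarith [hsum t ht]
    simpa using h1
  have h1 := hsum 1 (by simp)
  refine add_le_add (by linarith) (mul_le_mul_of_nonneg_left hint (by positivity))

/-! ### Fundamental solutions and the monodromy -/

section Monodromy

/-- The algebra of complex `2 × 2` matrices with the topology of an operator norm. -/
def Mat : Type := Matrix (Fin 2) (Fin 2) ℂ

noncomputable instance : NormedRing Mat :=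
  (Matrix.linftyOpNormedRing : NormedRing (Matrix (Fin 2) (Fin 2) ℂ))

noncomputable instance : NormedAlgebra ℂ Mat :=
  letI : NormedRing (Matrix (Fin 2) (Fin 2) ℂ) := Matrix.linftyOpNormedRing
  (Matrix.linftyOpNormedAlgebra : NormedAlgebra ℂ (Matrix (Fin 2) (Fin 2) ℂ))

/-- The identification of matrices with elements of the normed algebra `Mat`. -/
def toMat : Matrix (Fin 2) (Fin 2) ℂ ≃ₐ[ℂ] Mat :=
  (AlgEquiv.refl : Matrix (Fin 2) (Fin 2) ℂ ≃ₐ[ℂ] Matrix (Fin 2) (Fin 2) ℂ)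

instance : FiniteDimensional ℂ Mat := Module.Finite.equiv toMat.toLinearEquiv

instance : CompleteSpace Mat := FiniteDimensional.complete ℂ Mat

/-- The entry of a matrix as a continuous linear map. -/
noncomputable def entryCLM (i j : Fin 2) : Mat →L[ℂ] ℂ :=
  LinearMap.toContinuousLinearMap
    ((Matrix.entryLinearMap ℂ ℂ i j).comp toMat.symm.toLinearEquiv.toLinearMap)

theorem entryCLM_toMat (i j : Fin 2) (A : Matrix (Fin 2) (Fin 2) ℂ) :
    entryCLM i j (toMat A) = A i j := rfl

theorem toMat_eq_sum (A : Matrix (Fin 2) (Fin 2) ℂ) :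
    toMat A = ∑ i, ∑ j, A i j • toMat (Matrix.single i j (1 : ℂ)) := by
  conv_lhs => rw [Matrix.matrix_eq_sum_single A]
  simp only [map_sum, ← map_smul, Matrix.smul_single, smul_eq_mul, mul_one]

theorem memLp_toMat {A : ℝ → Matrix (Fin 2) (Fin 2) ℂ} {μ : Measure ℝ}
    (h : ∀ i j, MemLp (fun t => A t i j) 2 μ) : MemLp (fun t => toMat (A t)) 2 μ := by
  have h1 : (fun t => toMat (A t))
      = fun t => ∑ i, ∑ j, A t i j • toMat (Matrix.single i j (1 : ℂ)) :=
    funext fun t => toMat_eq_sum (A t)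
  rw [h1]
  refine memLp_finsetSum _ fun i _ => memLp_finsetSum _ fun j _ => ?_
  exact (ContinuousLinearMap.toSpanSingleton ℂ (toMat (Matrix.single i j (1 : ℂ)))).comp_memLp'
    (h i j)

theorem continuousOn_toMat_iff {F : ℝ → Matrix (Fin 2) (Fin 2) ℂ} {s : Set ℝ} :
    ContinuousOn (fun x => toMat (F x)) s ↔ ContinuousOn F s := by
  constructor
  · intro h
    exact continuousOn_pi.2 fun i => continuousOn_pi.2 fun j =>
      (entryCLM i j).continuous.comp_continuousOn h
  · intro h
    simp only [toMat_eq_sum (F _)]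
    refine continuousOn_finsetSum _ fun i _ => continuousOn_finsetSum _ fun j _ => ?_
    exact (continuousOn_pi.1 (continuousOn_pi.1 h i) j).smul continuousOn_const

theorem entryCLM_intervalIntegral {A : ℝ → Mat} {a b : ℝ}
    (hA : IntervalIntegrable A volume a b) (i j : Fin 2) :
    entryCLM i j (∫ t in a..b, A t) = ∫ t in a..b, entryCLM i j (A t) :=
  ((entryCLM i j).intervalIntegral_comp_comm hA).symm

theorem mat_ext {A B : Mat} (h : ∀ i j, entryCLM i j A = entryCLM i j B) : A = B :=
  toMat.symm.injective (Matrix.ext h)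

/-- `u` is absolutely continuous with square integrable derivative `w`, `u_y` is square integrable,
and `u` is periodic. -/
structure IsACPotential (u w uy : ℝ → ℂ) : Prop where
  isPrim : IsPrim u w
  memLp_deriv : MemLp w 2 (volume.restrict (Icc (0 : ℝ) 1))
  memLp_uy : MemLp uy 2 (volume.restrict (Icc (0 : ℝ) 1))
  periodic : u 0 = u 1

theorem IsPotential.exists_isACPotential {u uy : ℝ → ℂ} (h : IsPotential u uy) :
    ∃ w, IsACPotential u w uy := by
  obtain ⟨w, hw, hp⟩ := h.sobolev.exists_isPrim
  exact ⟨w, hp, hw, h.memLp_uy, h.periodic⟩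

theorem IsACPotential.neg {u w uy : ℝ → ℂ} (h : IsACPotential u w uy) :
    IsACPotential (fun x => -u x) (fun x => -w x) uy := by
  refine ⟨?_, h.memLp_deriv.neg, h.memLp_uy, by simp [h.periodic]⟩
  have := h.isPrim.const_mul (-1)
  simpa using this

theorem isACPotential_zero : IsACPotential (fun _ => 0) (fun _ => 0) (fun _ => 0) :=
  ⟨IsPrim.const 0, MemLp.zero, MemLp.zero, rfl⟩

/-- The part of the connection that does not depend on the spectral parameter. -/
noncomputable def connectionConst (u uy : ℝ → ℂ) (x : ℝ) : Matrix (Fin 2) (Fin 2) ℂ :=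
  !![1 / 4 * (Complex.I * uy x), 1 / 4 * -Complex.exp (u x / 2);
    1 / 4 * Complex.exp (u x / 2), 1 / 4 * -(Complex.I * uy x)]

/-- The coefficient of `λ` in the connection. -/
noncomputable def connectionLam (u : ℝ → ℂ) (x : ℝ) : Matrix (Fin 2) (Fin 2) ℂ :=
  !![0, 0; 1 / 4 * Complex.exp (-(u x / 2)), 0]

/-- The coefficient of `λ⁻¹` in the connection. -/
noncomputable def connectionInv (u : ℝ → ℂ) (x : ℝ) : Matrix (Fin 2) (Fin 2) ℂ :=
  !![0, -(1 / 4 * Complex.exp (-(u x / 2))); 0, 0]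

theorem connection_eq (u uy : ℝ → ℂ) (lam : ℂ) (x : ℝ) :
    connection u uy lam x
      = connectionConst u uy x + lam • connectionLam u x + lam⁻¹ • connectionInv u x := by
  ext i j
  fin_cases i <;> fin_cases j <;>
    simp [connection, connectionConst, connectionLam, connectionInv] <;> ring

section

variable {u w uy : ℝ → ℂ}

theorem IsACPotential.memLp_exp (h : IsACPotential u w uy) (c : ℂ) :
    MemLp (fun x => Complex.exp (c * u x)) 2 (volume.restrict (Icc (0 : ℝ) 1)) :=
  memLp_of_continuousOn (continuousOn_const.mul h.isPrim.continuousOn).cexp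

theorem IsACPotential.memLp_exp_half (h : IsACPotential u w uy) :
    MemLp (fun x => Complex.exp (u x / 2)) 2 (volume.restrict (Icc (0 : ℝ) 1)) := by
  have := h.memLp_exp (1 / 2)
  simpa [div_eq_inv_mul] using this

theorem IsACPotential.memLp_exp_neg_half (h : IsACPotential u w uy) :
    MemLp (fun x => Complex.exp (-(u x / 2))) 2 (volume.restrict (Icc (0 : ℝ) 1)) := by
  have := h.memLp_exp (-(1 / 2))
  simpa [div_eq_inv_mul] using this

theorem IsACPotential.memLp_connectionConst (h : IsACPotential u w uy) :
    MemLp (fun t => toMat (connectionConst u uy t)) 2 (volume.restrict (Icc (0 : ℝ) 1)) := by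
  refine memLp_toMat fun i j => ?_
  fin_cases i <;> fin_cases j
  · exact (h.memLp_uy.const_mul Complex.I).const_mul (1 / 4)
  · exact h.memLp_exp_half.neg.const_mul (1 / 4)
  · exact h.memLp_exp_half.const_mul (1 / 4)
  · exact (h.memLp_uy.const_mul Complex.I).neg.const_mul (1 / 4)

theorem IsACPotential.memLp_connectionLam (h : IsACPotential u w uy) :
    MemLp (fun t => toMat (connectionLam u t)) 2 (volume.restrict (Icc (0 : ℝ) 1)) := by
  refine memLp_toMat fun i j => ?_
  fin_cases i <;> fin_cases j
  · exact MemLp.zero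
  · exact MemLp.zero
  · exact h.memLp_exp_neg_half.const_mul (1 / 4)
  · exact MemLp.zero

theorem IsACPotential.memLp_connectionInv (h : IsACPotential u w uy) :
    MemLp (fun t => toMat (connectionInv u t)) 2 (volume.restrict (Icc (0 : ℝ) 1)) := by
  refine memLp_toMat fun i j => ?_
  fin_cases i <;> fin_cases j
  · exact MemLp.zero
  · exact (h.memLp_exp_neg_half.const_mul (1 / 4)).neg
  · exact MemLp.zero
  · exact MemLp.zero

theorem toMat_connection (u uy : ℝ → ℂ) (lam : ℂ) (x : ℝ) :
    toMat (connection u uy lam x) = toMat (connectionConst u uy x)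
      + lam • toMat (connectionLam u x) + lam⁻¹ • toMat (connectionInv u x) := by
  rw [connection_eq, map_add, map_add, map_smul, map_smul]

theorem IsACPotential.memLp_connection (h : IsACPotential u w uy) (lam : ℂ) :
    MemLp (fun t => toMat (connection u uy lam t)) 2 (volume.restrict (Icc (0 : ℝ) 1)) := by
  simp only [toMat_connection]
  exact (h.memLp_connectionConst.add (h.memLp_connectionLam.const_smul lam)).add
    (h.memLp_connectionInv.const_smul lam⁻¹)

theorem IsACPotential.intervalIntegrable_mul (h : IsACPotential u w uy) (lam : ℂ)
    {F : ℝ → Matrix (Fin 2) (Fin 2) ℂ} (hF : ContinuousOn F (Icc 0 1)) {x : ℝ}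
    (hx : x ∈ Icc (0 : ℝ) 1) :
    IntervalIntegrable (fun t => toMat (connection u uy lam t) * toMat (F t)) volume 0 x := by
  have hsub : uIcc (0 : ℝ) x ⊆ Icc 0 1 := by
    rw [uIcc_of_le hx.1]; exact Icc_subset_Icc_right hx.2
  exact ((intervalIntegrable_of_memLp (h.memLp_connection lam)).mono_set
    (by rwa [uIcc_of_le (zero_le_one' ℝ)])).mul_continuousOn
      ((continuousOn_toMat_iff.2 hF).mono hsub)

theorem IsACPotential.isFundamentalSolution_iff (h : IsACPotential u w uy) {lam : ℂ}
    {F : ℝ → Matrix (Fin 2) (Fin 2) ℂ} :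
    IsFundamentalSolution u uy lam F ↔ ContinuousOn (fun x => toMat (F x)) (Icc 0 1) ∧
      (∀ x ∈ Icc (0 : ℝ) 1, toMat (F x) = toMat (F 0)
        + ∫ t in (0 : ℝ)..x, toMat (connection u uy lam t) * toMat (F t)) ∧
      IsUnit (F 0) := by
  have key : ContinuousOn F (Icc 0 1) → ∀ x ∈ Icc (0 : ℝ) 1, ∀ i j,
      entryCLM i j (∫ t in (0 : ℝ)..x, toMat (connection u uy lam t) * toMat (F t))
        = ∫ t in (0 : ℝ)..x, (connection u uy lam t * F t) i j := fun hc x hx i j => by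
    rw [entryCLM_intervalIntegral (h.intervalIntegrable_mul lam hc hx)]
    simp only [← map_mul, entryCLM_toMat]
  constructor
  · intro hF
    refine ⟨continuousOn_toMat_iff.2 hF.continuousOn, fun x hx => mat_ext fun i j => ?_,
      hF.invertible⟩
    rw [map_add, key hF.continuousOn x hx]
    exact hF.integral_eq x hx i j
  · rintro ⟨hc, hF, hu⟩
    rw [continuousOn_toMat_iff] at hc
    refine ⟨hc, fun x hx i j => ?_, hu⟩
    rw [← key hc x hx, ← entryCLM_toMat i j (F x), hF x hx, map_add]
    rfl

/-- Right multiplication by `(F 0)⁻¹` preserves the equation, so every solution can be normalized to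
`1` at `0`. -/
theorem IsACPotential.isMonodromy_iff (h : IsACPotential u w uy) {lam : ℂ}
    {N : Matrix (Fin 2) (Fin 2) ℂ} :
    IsMonodromy u uy lam N ↔ ∃ F, IsFundamentalSolution u uy lam F ∧ F 0 = 1 ∧ F 1 = N := by
  constructor
  · rintro ⟨F, hF, rfl⟩
    obtain ⟨hc, hint, hunit⟩ := h.isFundamentalSolution_iff.1 hF
    have hdet : IsUnit (F 0).det := (Matrix.isUnit_iff_isUnit_det _).1 hunit
    have h0 : F 0 * (F 0)⁻¹ = 1 := Matrix.mul_nonsing_inv _ hdet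
    refine ⟨fun x => F x * (F 0)⁻¹, h.isFundamentalSolution_iff.2
      ⟨?_, fun x hx => ?_, by simp [h0]⟩, h0, rfl⟩
    · simp only [map_mul]
      exact hc.mul continuousOn_const
    · have h1 : ∫ t in (0 : ℝ)..x, toMat (connection u uy lam t) * toMat (F t * (F 0)⁻¹)
          = (∫ t in (0 : ℝ)..x, toMat (connection u uy lam t) * toMat (F t))
            * toMat (F 0)⁻¹ := by
        simp only [map_mul, ← mul_assoc]
        exact ((ContinuousLinearMap.mul ℂ Mat).flip (toMat (F 0)⁻¹)).intervalIntegral_comp_comm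
          (h.intervalIntegrable_mul lam hF.continuousOn hx)
      rw [h1, map_mul, map_mul, ← add_mul, ← hint x hx]
  · rintro ⟨F, hF, h0, rfl⟩
    exact ⟨F, hF, by simp [h0]⟩

theorem IsACPotential.existsUnique_isMonodromy (h : IsACPotential u w uy) (lam : ℂ) :
    ∃! N, IsMonodromy u uy lam N := by
  have hL := h.memLp_connection lam
  obtain ⟨F', hFc, hF⟩ := exists_volterra_solution hL 1
  obtain ⟨F, rfl⟩ : ∃ F : ℝ → Matrix (Fin 2) (Fin 2) ℂ, F' = fun x => toMat (F x) :=
    ⟨fun x => toMat.symm (F' x), funext fun x => (toMat.apply_symm_apply _).symm⟩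
  have hF0' : toMat (F 0) = 1 := by simpa using hF 0 (by simp)
  have hF0 : F 0 = 1 := toMat.injective (by rw [hF0', map_one])
  have hFs : IsFundamentalSolution u uy lam F := by
    refine h.isFundamentalSolution_iff.2 ⟨hFc.continuousOn, ?_, by simp [hF0]⟩
    rw [hF0']; exact hF
  refine ⟨F 1, h.isMonodromy_iff.2 ⟨F, hFs, hF0, rfl⟩, ?_⟩
  rintro N hN
  obtain ⟨G, hG, hG0, rfl⟩ := h.isMonodromy_iff.1 hN
  obtain ⟨hGc, hGint, -⟩ := h.isFundamentalSolution_iff.1 hG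
  rw [hG0, map_one] at hGint
  exact toMat.injective
    (volterra_solution_unique hL hGc hFc.continuousOn hGint hF (by simp : (1 : ℝ) ∈ Icc (0 : ℝ) 1))

theorem IsACPotential.differentiableOn_monodromy (h : IsACPotential u w uy)
    {M : ℂ → Matrix (Fin 2) (Fin 2) ℂ} (hM : ∀ lam, lam ≠ 0 → IsMonodromy u uy lam (M lam))
    (i j : Fin 2) : DifferentiableOn ℂ (fun lam => M lam i j) {0}ᶜ := by
  have hex : ∀ lam, lam ≠ 0 → ∃ F, IsFundamentalSolution u uy lam F ∧ F 0 = 1 ∧ F 1 = M lam :=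
    fun lam hl => h.isMonodromy_iff.1 (hM lam hl)
  choose! F hF hF0 hF1 using hex
  have hd := differentiableOn_volterra_solution h.memLp_connectionConst h.memLp_connectionLam
    h.memLp_connectionInv (F := fun lam x => toMat (F lam x)) (c := 1)
    (fun lam hl => (h.isFundamentalSolution_iff.1 (hF lam hl)).1)
    (fun lam hl x hx => by
      have := (h.isFundamentalSolution_iff.1 (hF lam hl)).2.1 x hx
      rw [hF0 lam hl, map_one] at this
      simpa only [← toMat_connection] using this)
  intro lam hl
  exact (((entryCLM i j).differentiableAt.comp_differentiableWithinAt lam (hd lam hl))).congr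
    (fun z hz => by rw [← hF1 z hz]; rfl) (by rw [← hF1 lam hl]; rfl)

theorem IsACPotential.isPrim_column (h : IsACPotential u w uy) {lam : ℂ}
    {F : ℝ → Matrix (Fin 2) (Fin 2) ℂ} (hF : IsFundamentalSolution u uy lam F) (j : Fin 2) :
    IsPrim (fun x => F x 0 j) (fun x => 1 / 4 * (Complex.I * uy x * F x 0 j
      + (-Complex.exp (u x / 2) - lam⁻¹ * Complex.exp (-(u x / 2))) * F x 1 j)) ∧
    IsPrim (fun x => F x 1 j) (fun x => 1 / 4 * ((Complex.exp (u x / 2)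
      + lam * Complex.exp (-(u x / 2))) * F x 0 j - Complex.I * uy x * F x 1 j)) := by
  have key : ∀ i, IsPrim (fun x => F x i j) (fun x => (connection u uy lam x * F x) i j) :=
    fun i => by
      refine ⟨?_, fun x hx => hF.integral_eq x hx i j⟩
      have := h.intervalIntegrable_mul lam hF.continuousOn (x := 1) (by simp)
      exact ⟨(entryCLM i j).integrable_comp this.1, (entryCLM i j).integrable_comp this.2⟩
  refine ⟨(key 0).congr_deriv fun x _ => ?_, (key 1).congr_deriv fun x _ => ?_⟩
  · simp [connection, Matrix.mul_apply, Fin.sum_univ_two]; ring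
  · simp [connection, Matrix.mul_apply, Fin.sum_univ_two]; ring

/-! ### The symmetry `λ ↦ λ⁻¹` -/

/-- The monodromy for `(-u, u_y)` at `λ⁻¹`, expressed by the one for `(u, u_y)` at `λ`. -/
noncomputable def swapMonodromy (lam : ℂ) (N : Matrix (Fin 2) (Fin 2) ℂ) :
    Matrix (Fin 2) (Fin 2) ℂ :=
  !![N 0 0, lam * N 0 1; lam⁻¹ * N 1 0, N 1 1]

/-- Conjugation by the constant matrix `diag(1, λ⁻¹)` carries the connection of `u` at `λ` to that
of `-u` at `λ⁻¹`, with `u_y` unchanged. -/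
theorem IsACPotential.isMonodromy_swap (h : IsACPotential u w uy) {lam : ℂ} (hl : lam ≠ 0)
    {N : Matrix (Fin 2) (Fin 2) ℂ} (hN : IsMonodromy u uy lam N) :
    IsMonodromy (fun x => -u x) uy lam⁻¹ (swapMonodromy lam N) := by
  obtain ⟨F, hF, hF0, rfl⟩ := h.isMonodromy_iff.1 hN
  have hF0' : swapMonodromy lam (F 0) = 1 := by
    rw [hF0]; ext i j; fin_cases i <;> fin_cases j <;> simp [swapMonodromy]
  refine h.neg.isMonodromy_iff.2 ⟨fun x => swapMonodromy lam (F x), ⟨?_, ?_, by simp [hF0']⟩,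
    hF0', rfl⟩
  · have hc : ∀ i j, ContinuousOn (fun x => F x i j) (Icc 0 1) := fun i j =>
      continuousOn_pi.1 (continuousOn_pi.1 hF.continuousOn i) j
    refine continuousOn_pi.2 fun i => continuousOn_pi.2 fun j => ?_
    fin_cases i <;> fin_cases j
    · exact hc 0 0
    · exact continuousOn_const.mul (hc 0 1)
    · exact continuousOn_const.mul (hc 1 0)
    · exact hc 1 1
  · intro x hx i j
    -- Conjugation by a diagonal matrix multiplies each entry by a constant, which passes through
    -- the integral.
    set d : Matrix (Fin 2) (Fin 2) ℂ := !![1, lam; lam⁻¹, 1] with hd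
    have e1 : ∀ t, swapMonodromy lam (F t) i j = d i j * F t i j := fun t => by
      fin_cases i <;> fin_cases j <;> simp [swapMonodromy, hd]
    have e2 : ∀ t, (connection (fun x => -u x) uy lam⁻¹ t * swapMonodromy lam (F t)) i j
        = d i j * (connection u uy lam t * F t) i j := fun t => by
      have e3 : Complex.exp (-u t / 2) = Complex.exp (-(u t / 2)) := by rw [neg_div]
      have e4 : Complex.exp (-(-u t / 2)) = Complex.exp (u t / 2) := by rw [neg_div, neg_neg]
      fin_cases i <;> fin_cases j <;>
        simp [swapMonodromy, connection, Matrix.mul_apply, Fin.sum_univ_two, hd, e3, e4] <;>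
        field_simp <;> ring
    simp only [e1, e2]
    rw [intervalIntegral.integral_const_mul, ← mul_add, ← hF.integral_eq x hx i j]

end

/-! ### The vacuum -/

theorem sqrtLam_sq (lam : ℂ) : sqrtLam lam ^ 2 = lam := by
  unfold sqrtLam
  have := Complex.cpow_nat_inv_pow lam two_ne_zero
  rw [one_div]
  exact_mod_cast this

theorem sqrtLam_ne_zero {lam : ℂ} (hl : lam ≠ 0) : sqrtLam lam ≠ 0 := fun h => by
  have := sqrtLam_sq lam
  rw [h] at this
  exact hl (by simpa using this.symm)

/-- The monodromy of the vacuum. -/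
noncomputable def vacuumMonodromy (lam : ℂ) : Matrix (Fin 2) (Fin 2) ℂ :=
  !![a₀ lam, b₀ lam; c₀ lam, d₀ lam]

/-- The vacuum connection is a constant matrix with eigenvalues `±iζ`, so its exponential is
explicit. -/
theorem isMonodromy_vacuum {lam : ℂ} (hl : lam ≠ 0) :
    IsMonodromy (fun _ => 0) (fun _ => 0) lam (vacuumMonodromy lam) := by
  have hμ := sqrtLam_ne_zero hl
  have hsq := sqrtLam_sq lam
  set μ := sqrtLam lam with hμd
  set ζ := zeta lam with hζd
  have hζ : ζ = 1 / 4 * (μ + μ⁻¹) := rfl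
  have hcos : IsPrim (fun x : ℝ => Complex.cos (ζ * x)) (fun x : ℝ => -ζ * Complex.sin (ζ * x)) := by
    refine IsPrim.of_hasDerivAt (fun x => ?_) (by fun_prop)
    have := ((hasDerivAt_id (x : ℂ)).const_mul ζ).ccos.comp_ofReal
    simp only [id, mul_one] at this
    exact this.congr_deriv (by ring)
  have hsin : IsPrim (fun x : ℝ => Complex.sin (ζ * x)) (fun x : ℝ => ζ * Complex.cos (ζ * x)) := by
    refine IsPrim.of_hasDerivAt (fun x => ?_) (by fun_prop)
    have := ((hasDerivAt_id (x : ℂ)).const_mul ζ).csin.comp_ofReal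
    simp only [id, mul_one] at this
    exact this.congr_deriv (by ring)
  set F : ℝ → Matrix (Fin 2) (Fin 2) ℂ := fun x =>
    !![Complex.cos (ζ * x), -μ⁻¹ * Complex.sin (ζ * x);
      μ * Complex.sin (ζ * x), Complex.cos (ζ * x)] with hF
  have hF0 : F 0 = 1 := by
    ext i j; fin_cases i <;> fin_cases j <;> simp [hF]
  refine isACPotential_zero.isMonodromy_iff.2 ⟨F, ⟨?_, ?_, by simp [hF0]⟩, hF0, ?_⟩
  · refine Continuous.continuousOn (continuous_pi fun i => continuous_pi fun j => ?_)
    fin_cases i <;> fin_cases j <;> simp [hF] <;> fun_prop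
  · intro x hx i j
    have key : ∀ f f' : ℝ → ℂ, IsPrim f f' → (∀ t, F t i j = f t) →
        (∀ t, (connection (fun _ => 0) (fun _ => 0) lam t * F t) i j = f' t) →
        F x i j = F 0 i j
          + ∫ t in (0 : ℝ)..x, (connection (fun _ => 0) (fun _ => 0) lam t * F t) i j := by
      intro f f' hp h1 h2
      simp only [h1, h2]
      exact hp.eq_add_integral x hx
    fin_cases i <;> fin_cases j
    · refine key _ _ hcos (fun t => rfl) fun t => ?_
      simp [connection, Matrix.mul_apply, Fin.sum_univ_two, hF, ← hsq, hζ]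
      field_simp
      ring
    · refine key _ _ (hsin.const_mul (-μ⁻¹)) (fun t => rfl) fun t => ?_
      simp [connection, Matrix.mul_apply, Fin.sum_univ_two, hF, ← hsq, hζ]
      field_simp
      ring
    · refine key _ _ (hsin.const_mul μ) (fun t => rfl) fun t => ?_
      simp [connection, Matrix.mul_apply, Fin.sum_univ_two, hF, ← hsq, hζ]
      field_simp
      ring_nf
    · refine key _ _ hcos (fun t => rfl) fun t => ?_
      simp [connection, Matrix.mul_apply, Fin.sum_univ_two, hF, ← hsq, hζ]
      field_simp
      ring
  · ext i j
    fin_cases i <;> fin_cases j <;> simp [hF, vacuumMonodromy, a₀, b₀, c₀, d₀, hμd, hζd]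

/-- Uniqueness of the monodromy replaces any discussion of the branch of the square root at `λ⁻¹`.
-/
theorem vacuumMonodromy_inv {lam : ℂ} (hl : lam ≠ 0) :
    vacuumMonodromy lam⁻¹ = swapMonodromy lam (vacuumMonodromy lam) := by
  have h1 := isACPotential_zero.isMonodromy_swap hl (isMonodromy_vacuum hl)
  simp only [neg_zero] at h1
  exact (isACPotential_zero.existsUnique_isMonodromy lam⁻¹).unique
    (isMonodromy_vacuum (inv_ne_zero hl)) h1

end Monodromy

/-! ### Diagonalization of the regauged system -/

/-- The regauged potential `(i u_y - u') / 4`. -/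
noncomputable def gaugedPotential (w uy : ℝ → ℂ) (x : ℝ) : ℂ := 1 / 4 * (Complex.I * uy x - w x)

/-- The components of a solution in the eigenbasis of the vacuum, after the gauge transformation
by `diag(e^{-u/4}, μ⁻¹ e^{u/4})`; the two components are distinguished by `ε = ±1`. -/
noncomputable def gaugedComponent (u : ℝ → ℂ) (μ κ ε : ℂ) (φ₁ φ₂ : ℝ → ℂ) (x : ℝ) : ℂ :=
  κ / 2 * (Complex.exp (-(1 / 4) * u x) * φ₁ x
    + ε * Complex.I * (μ⁻¹ * (Complex.exp (1 / 4 * u x) * φ₂ x)))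

/-- The diagonal part of the remainder of the regauged system. -/
noncomputable def diagRemainder (u : ℝ → ℂ) (μ ε : ℂ) (x : ℝ) : ℂ :=
  ε * (Complex.I / 8 * μ⁻¹ * (Complex.exp (-u x) + Complex.exp (u x) - 2))

/-- The off-diagonal part of the remainder of the regauged system. -/
noncomputable def offDiagRemainder (u : ℝ → ℂ) (μ ε : ℂ) (x : ℝ) : ℂ :=
  ε * (Complex.I / 8 * μ⁻¹ * (Complex.exp (u x) - Complex.exp (-u x)))

variable {u w uy φ₁ φ₂ : ℝ → ℂ}

/-- The gauge removes `u` from the terms of order `μ`, and its derivative joins `i u_y` to give the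
diagonal `±q`. In the eigenbasis of the vacuum this diagonal becomes off-diagonal. What differs from
the vacuum beyond `q` has order `μ⁻¹` and involves only `e^{±u}`. -/
theorem isPrim_gaugedComponent (hu : IsPrim u w) {μ ε : ℂ} (hμ : μ ≠ 0) (hε : ε ^ 2 = 1) (κ : ℂ)
    (h₁ : IsPrim φ₁ fun x => 1 / 4 * (Complex.I * uy x * φ₁ x
      + (-Complex.exp (u x / 2) - (μ ^ 2)⁻¹ * Complex.exp (-(u x / 2))) * φ₂ x))
    (h₂ : IsPrim φ₂ fun x => 1 / 4 * ((Complex.exp (u x / 2)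
      + μ ^ 2 * Complex.exp (-(u x / 2))) * φ₁ x - Complex.I * uy x * φ₂ x)) :
    IsPrim (gaugedComponent u μ κ ε φ₁ φ₂) fun x =>
      Complex.I * (ε * (1 / 4 * (μ + μ⁻¹))) * gaugedComponent u μ κ ε φ₁ φ₂ x
        + gaugedPotential w uy x * gaugedComponent u μ κ (-ε) φ₁ φ₂ x
        + (diagRemainder u μ ε x * gaugedComponent u μ κ ε φ₁ φ₂ x
          + offDiagRemainder u μ ε x * gaugedComponent u μ κ (-ε) φ₁ φ₂ x) := by
  have hp := (((hu.const_mul (-(1 / 4))).cexp.mul h₁).add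
    ((((hu.const_mul (1 / 4)).cexp.mul h₂).const_mul μ⁻¹).const_mul (ε * Complex.I))).const_mul (κ / 2)
  refine hp.congr_deriv fun x _ => ?_
  unfold gaugedComponent gaugedPotential diagRemainder offDiagRemainder
  have e1 : Complex.exp (u x / 2) = Complex.exp (1 / 4 * u x) ^ 2 := by
    rw [← Complex.exp_nat_mul]; congr 1; push_cast; ring
  have e2 : Complex.exp (-(u x / 2)) = Complex.exp (-(1 / 4) * u x) ^ 2 := by
    rw [← Complex.exp_nat_mul]; congr 1; push_cast; ring
  have e3 : Complex.exp (u x) = Complex.exp (1 / 4 * u x) ^ 4 := by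
    rw [← Complex.exp_nat_mul]; congr 1; push_cast; ring
  have e4 : Complex.exp (-u x) = Complex.exp (-(1 / 4) * u x) ^ 4 := by
    rw [← Complex.exp_nat_mul]; congr 1; push_cast; ring
  have hGG : Complex.exp (-(1 / 4) * u x) * Complex.exp (1 / 4 * u x) = 1 := by
    rw [← Complex.exp_add, ← add_mul]; simp
  have hm : μ * μ⁻¹ = 1 := mul_inv_cancel₀ hμ
  rw [e1, e2, e3, e4, ← inv_pow]
  generalize Complex.exp (-(1 / 4) * u x) = G at *
  generalize Complex.exp (1 / 4 * u x) = H at *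
  generalize μ⁻¹ = m at *
  generalize φ₁ x = a at *
  generalize φ₂ x = b at *
  have hI := Complex.I_sq
  generalize Complex.I = i at *
  generalize w x = W at *
  generalize uy x = V at *
  -- What remains is a polynomial identity modulo `G H = 1`, `μ m = 1`, `i² = -1` and `ε² = 1`.
  grind

/-! ### The deviation of the monodromy from the vacuum -/

/-- Sum and difference of the two components recover the two entries of a column, up to gauge
factors; this lemma serves the first entry, `norm_sub_sub_free_le` the second. -/
theorem norm_add_sub_free_le (f g : ℝ → ℂ) (ζ : ℂ) :
    Real.exp (-|ζ.im|) * ‖f 1 + g 1 - (Complex.exp (Complex.I * ζ) * f 0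
      + Complex.exp (-(Complex.I * ζ)) * g 0)‖ ≤ freeDeviation f ζ 1 + freeDeviation g (-ζ) 1 := by
  unfold freeDeviation
  rw [Complex.neg_im, abs_neg, mul_one, ← mul_add]
  refine mul_le_mul_of_nonneg_left ?_ (Real.exp_pos _).le
  refine le_trans (le_of_eq ?_) (norm_add_le _ _)
  congr 1
  simp only [Complex.ofReal_one, mul_one, mul_neg]
  ring

theorem norm_sub_sub_free_le (f g : ℝ → ℂ) (ζ : ℂ) :
    Real.exp (-|ζ.im|) * ‖-Complex.I * (f 1 - g 1) - -Complex.I * (Complex.exp (Complex.I * ζ) * f 0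
      - Complex.exp (-(Complex.I * ζ)) * g 0)‖ ≤ freeDeviation f ζ 1 + freeDeviation g (-ζ) 1 := by
  unfold freeDeviation
  rw [Complex.neg_im, abs_neg, mul_one, ← mul_add, ← mul_sub, norm_mul, norm_neg, Complex.norm_I,
    one_mul]
  refine mul_le_mul_of_nonneg_left ?_ (Real.exp_pos _).le
  refine le_trans (le_of_eq ?_) (norm_sub_le _ _)
  congr 1
  simp only [Complex.ofReal_one, mul_one, mul_neg]
  ring

/-- The normalized deviation of the monodromy `N` at `λ` from the vacuum, for `λ` near `∞`. -/
noncomputable def monodromyDeviation (τ lam : ℂ) (N : Matrix (Fin 2) (Fin 2) ℂ) : ℝ :=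
  Real.exp (-|(zeta lam).im|) * (‖N 0 0 - a₀ lam‖
    + ‖sqrtLam lam * τ * N 0 1 + Complex.sin (zeta lam)‖
    + ‖(sqrtLam lam)⁻¹ * τ⁻¹ * N 1 0 - Complex.sin (zeta lam)‖ + ‖N 1 1 - d₀ lam‖)

theorem monodromyDeviation_nonneg (τ lam : ℂ) (N : Matrix (Fin 2) (Fin 2) ℂ) :
    0 ≤ monodromyDeviation τ lam N := by
  unfold monodromyDeviation; positivity

theorem exp_I_mul_add (z : ℂ) :
    Complex.exp (Complex.I * z) * (1 / 2) + Complex.exp (-(Complex.I * z)) * (1 / 2)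
      = Complex.cos z := by
  rw [Complex.cos, mul_comm Complex.I, neg_mul]; ring

theorem exp_I_mul_sub (z : ℂ) :
    -Complex.I * (Complex.exp (Complex.I * z) * (1 / 2)
      - Complex.exp (-(Complex.I * z)) * (1 / 2)) = Complex.sin z := by
  rw [Complex.sin, mul_comm Complex.I z, neg_mul]; ring_nf

/-- The components of the columns of a fundamental solution, normalized at `0`. -/
noncomputable def columnComponent (u : ℝ → ℂ) (μ : ℂ) (F : ℝ → Matrix (Fin 2) (Fin 2) ℂ)
    (j : Fin 2) (ε : ℂ) : ℝ → ℂ :=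
  gaugedComponent u μ (if j = 0 then Complex.exp (1 / 4 * u 0) else μ * Complex.exp (-(1 / 4) * u 0))
    ε (fun x => F x 0 j) (fun x => F x 1 j)

theorem exp_neg_quarter_mul (z : ℂ) :
    Complex.exp (-(1 / 4) * z) * Complex.exp (1 / 4 * z) = 1 := by
  rw [← Complex.exp_add, ← add_mul]; simp

/-- The normalizing factor makes the initial values free of `u` and `μ`. Their norm is `1/2`, which
meets the condition `‖f 0‖ ≤ 1` of the perturbation estimates. -/
theorem columnComponent_zero {μ : ℂ} (hμ : μ ≠ 0) {F : ℝ → Matrix (Fin 2) (Fin 2) ℂ}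
    (hF0 : F 0 = 1) (j : Fin 2) (ε : ℂ) :
    columnComponent u μ F j ε 0 = if j = 0 then 1 / 2 else ε * Complex.I / 2 := by
  have h := exp_neg_quarter_mul (u 0)
  have hm : μ * μ⁻¹ = 1 := mul_inv_cancel₀ hμ
  unfold columnComponent gaugedComponent
  fin_cases j
  · simp only [hF0, Fin.zero_eta, if_true, Matrix.one_apply_eq, Fin.isValue, ne_eq, one_ne_zero,
      not_false_eq_true, Matrix.one_apply_ne, mul_zero, mul_one, add_zero]
    linear_combination (1 / 2) * h
  · simp only [hF0, Fin.mk_one, Fin.isValue, one_ne_zero, if_false, ne_eq, zero_ne_one,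
      not_false_eq_true, Matrix.one_apply_ne, mul_zero, Matrix.one_apply_eq, mul_one, zero_add]
    linear_combination (ε * Complex.I / 2) * (μ * μ⁻¹ * h + hm)

/-- By periodicity the gauge at `1` cancels against the normalization at `0` on the diagonal, and
leaves `μτ` and `(μτ)⁻¹` off it. Each pair of deviations controls two entries, whence the factors
`2`. -/
theorem monodromyDeviation_le (hper : u 0 = u 1) {lam : ℂ} (hl : lam ≠ 0)
    {F : ℝ → Matrix (Fin 2) (Fin 2) ℂ} (hF0 : F 0 = 1) :
    monodromyDeviation (Complex.exp (-(u 0 / 2))) lam (F 1) ≤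
      2 * (freeDeviation (columnComponent u (sqrtLam lam) F 0 1) (zeta lam) 1
          + freeDeviation (columnComponent u (sqrtLam lam) F 0 (-1)) (-zeta lam) 1)
      + 2 * (freeDeviation (columnComponent u (sqrtLam lam) F 1 1) (zeta lam) 1
          + freeDeviation (columnComponent u (sqrtLam lam) F 1 (-1)) (-zeta lam) 1) := by
  have hμ := sqrtLam_ne_zero hl
  set μ := sqrtLam lam with hμd
  set ζ := zeta lam with hζd
  have hm : μ * μ⁻¹ = 1 := mul_inv_cancel₀ hμ
  have hGH := exp_neg_quarter_mul (u 0)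
  have hτ : Complex.exp (-(u 0 / 2)) = Complex.exp (-(1 / 4) * u 0) ^ 2 := by
    rw [← Complex.exp_nat_mul]; congr 1; push_cast; ring
  have hτ' : (Complex.exp (-(u 0 / 2)))⁻¹ = Complex.exp (1 / 4 * u 0) ^ 2 := by
    rw [← Complex.exp_neg, ← Complex.exp_nat_mul]; congr 1; push_cast; ring
  have p1 := norm_add_sub_free_le (columnComponent u μ F 0 1) (columnComponent u μ F 0 (-1)) ζ
  have p2 := norm_sub_sub_free_le (columnComponent u μ F 0 1) (columnComponent u μ F 0 (-1)) ζ
  have p3 := norm_add_sub_free_le (columnComponent u μ F 1 1) (columnComponent u μ F 1 (-1)) ζ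
  have p4 := norm_sub_sub_free_le (columnComponent u μ F 1 1) (columnComponent u μ F 1 (-1)) ζ
  have q1 : columnComponent u μ F 0 1 1 + columnComponent u μ F 0 (-1) 1 = F 1 0 0 := by
    simp only [columnComponent, gaugedComponent, if_true, ← hper]
    linear_combination F 1 0 0 * hGH
  have q2 : -Complex.I * (columnComponent u μ F 0 1 1 - columnComponent u μ F 0 (-1) 1)
      = μ⁻¹ * (Complex.exp (-(u 0 / 2)))⁻¹ * F 1 1 0 := by
    simp only [columnComponent, gaugedComponent, if_true, ← hper, hτ']
    linear_combination (-(μ⁻¹ * Complex.exp (1 / 4 * u 0) ^ 2 * F 1 1 0)) * Complex.I_sq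
  have q3 : columnComponent u μ F 1 1 1 + columnComponent u μ F 1 (-1) 1
      = μ * Complex.exp (-(u 0 / 2)) * F 1 0 1 := by
    simp only [columnComponent, gaugedComponent, one_ne_zero, if_false, ← hper, hτ]
    ring
  have q4 : -Complex.I * (columnComponent u μ F 1 1 1 - columnComponent u μ F 1 (-1) 1)
      = F 1 1 1 := by
    simp only [columnComponent, gaugedComponent, one_ne_zero, if_false, ← hper]
    linear_combination (-(μ * μ⁻¹ * Complex.exp (-(1 / 4) * u 0) * Complex.exp (1 / 4 * u 0)
      * F 1 1 1)) * Complex.I_sq + F 1 1 1 * (μ * μ⁻¹ * hGH + hm)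
  have r3 : Complex.exp (Complex.I * ζ) * (1 * Complex.I / 2)
      + Complex.exp (-(Complex.I * ζ)) * (-1 * Complex.I / 2) = -Complex.sin ζ := by
    rw [← exp_I_mul_sub]; ring
  have r4 : -Complex.I * (Complex.exp (Complex.I * ζ) * (1 * Complex.I / 2)
      - Complex.exp (-(Complex.I * ζ)) * (-1 * Complex.I / 2)) = Complex.cos ζ := by
    rw [← exp_I_mul_add]
    linear_combination (-(Complex.exp (Complex.I * ζ) * (1 / 2)
      + Complex.exp (-(Complex.I * ζ)) * (1 / 2))) * Complex.I_sq
  rw [q1, columnComponent_zero hμ hF0, columnComponent_zero hμ hF0, if_pos rfl,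
    if_pos rfl, exp_I_mul_add] at p1
  rw [q2, columnComponent_zero hμ hF0, columnComponent_zero hμ hF0, if_pos rfl,
    if_pos rfl, exp_I_mul_sub] at p2
  rw [q3, columnComponent_zero hμ hF0, columnComponent_zero hμ hF0, if_neg one_ne_zero,
    if_neg one_ne_zero, r3, sub_neg_eq_add] at p3
  rw [q4, columnComponent_zero hμ hF0, columnComponent_zero hμ hF0, if_neg one_ne_zero,
    if_neg one_ne_zero, r4] at p4
  unfold monodromyDeviation a₀ d₀
  rw [← hμd, ← hζd]
  linarith

/-! ### The branch of `λ^{1/2}` and the size of `μ` on the sets `S k` -/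

theorem sqrtLam_re_nonneg {lam : ℂ} (hl : lam ≠ 0) : 0 ≤ (sqrtLam lam).re := by
  unfold sqrtLam
  rw [Complex.cpow_def_of_ne_zero hl, Complex.exp_re]
  refine mul_nonneg (Real.exp_pos _).le (Real.cos_nonneg_of_mem_Icc ?_)
  have h : (Complex.log lam * (1 / 2)).im = lam.arg / 2 := by
    have : (1 / 2 : ℂ) = ((1 / 2 : ℝ) : ℂ) := by push_cast; rfl
    rw [this, mul_comm, Complex.im_ofReal_mul, Complex.log_im]
    ring
  rw [h]
  constructor <;> linarith [Complex.neg_pi_lt_arg lam, Complex.arg_le_pi lam]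

/-- Inversion preserves the closed right half-plane. Up to conjugation this places `ζ` in the first
quadrant, where the maximal inequality applies. -/
theorem zeta_re_nonneg {lam : ℂ} (hl : lam ≠ 0) : 0 ≤ (zeta lam).re := by
  have h := sqrtLam_re_nonneg hl
  have h4 : (zeta lam).re = 1 / 4 * ((sqrtLam lam).re + ((sqrtLam lam)⁻¹).re) := by
    unfold zeta
    have : (1 / 4 : ℂ) = ((1 / 4 : ℝ) : ℂ) := by push_cast; rfl
    rw [this, Complex.re_ofReal_mul, Complex.add_re]
  rw [h4, Complex.inv_re]
  have := div_nonneg h (Complex.normSq_nonneg (sqrtLam lam))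
  positivity

theorem norm_sqrtLam_sq (lam : ℂ) : ‖sqrtLam lam‖ ^ 2 = ‖lam‖ := by
  rw [← norm_pow, sqrtLam_sq]

theorem mem_S_succ {k : ℕ} {lam : ℂ} : lam ∈ S ((k : ℤ) + 1) ↔
    lam ≠ 0 ∧ ((k : ℝ) + 1 - 1 / 2) * Real.pi ≤ ‖zeta lam‖ ∧
      ‖zeta lam‖ ≤ ((k : ℝ) + 1 + 1 / 2) * Real.pi ∧ 1 < ‖lam‖ := by
  have h : (0 : ℤ) < (k : ℤ) + 1 := by positivity
  unfold S
  rw [if_pos h]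
  simp

theorem mem_S_neg_succ {k : ℕ} {lam : ℂ} : lam ∈ S (-((k : ℤ) + 1)) ↔
    lam ≠ 0 ∧ ((k : ℝ) + 1 - 1 / 2) * Real.pi ≤ ‖zeta lam‖ ∧
      ‖zeta lam‖ ≤ ((k : ℝ) + 1 + 1 / 2) * Real.pi ∧ ‖lam‖ < 1 := by
  have h : ¬ (0 : ℤ) < -((k : ℤ) + 1) := by omega
  have h' : ¬ -((k : ℤ) + 1) = 0 := by omega
  unfold S
  rw [if_neg h, if_neg h']
  simp [add_comm]

theorem four_mul_norm_zeta (lam : ℂ) : 4 * ‖zeta lam‖ = ‖sqrtLam lam + (sqrtLam lam)⁻¹‖ := by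
  unfold zeta
  rw [norm_mul]
  norm_num
  ring

theorem norm_zeta_le {lam : ℂ} (hl : 1 < ‖lam‖) :
    2 * ‖zeta lam‖ ≤ ‖sqrtLam lam‖ ∧ ‖sqrtLam lam‖ ≤ 4 * ‖zeta lam‖ + 1 := by
  have hsq := norm_sqrtLam_sq lam
  have h1 : 1 < ‖sqrtLam lam‖ := by
    by_contra h
    push Not at h
    nlinarith [norm_nonneg (sqrtLam lam)]
  have hinv : ‖(sqrtLam lam)⁻¹‖ ≤ 1 := by
    rw [norm_inv]; exact inv_le_one_of_one_le₀ h1.le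
  have h4 := four_mul_norm_zeta lam
  have h5 := norm_add_le (sqrtLam lam) (sqrtLam lam)⁻¹
  have h6 := norm_sub_le (sqrtLam lam + (sqrtLam lam)⁻¹) (sqrtLam lam)⁻¹
  rw [add_sub_cancel_right] at h6
  constructor <;> linarith

/-- This converts powers of `|μ|` into powers of the index. With `π < 4`, the bound `4|ζ| + 1` is at
most `16 (k + 3/2) + 1 ≤ 25 (k + 1)`. -/
theorem norm_sqrtLam_bounds {k : ℕ} {lam : ℂ} (hl : lam ∈ S ((k : ℤ) + 1)) :
    (k : ℝ) + 1 ≤ ‖sqrtLam lam‖ ∧ ‖sqrtLam lam‖ ≤ 25 * ((k : ℝ) + 1) := by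
  obtain ⟨-, h2, h3, h4⟩ := mem_S_succ.1 hl
  obtain ⟨h5, h6⟩ := norm_zeta_le h4
  have hpi := Real.pi_gt_three
  have hpi' := Real.pi_lt_four
  have hk : (0 : ℝ) ≤ k := k.cast_nonneg
  constructor <;> nlinarith

/-- A quantity that is square summable along all selections from a sequence of sets is bounded on
these sets by a square summable sequence. -/
theorem exists_summable_sq_bound {α : Type*} {φ : α → ℝ} {T : ℕ → Set α} {C : ℝ}
    (h0 : ∀ x, 0 ≤ φ x)
    (h : ∀ (p : ℕ → α) (s : Finset ℕ), (∀ k ∈ s, p k ∈ T k) → ∑ k ∈ s, φ (p k) ^ 2 ≤ C) :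
    ∃ a : ℕ → ℝ, (∀ k, 0 ≤ a k) ∧ (Summable fun k => a k ^ 2) ∧
      ∀ k, ∀ x ∈ T k, φ x ≤ a k := by
  classical
  have hC : 0 ≤ C ∨ IsEmpty α := by
    by_cases hα : Nonempty α
    · left
      obtain ⟨x⟩ := hα
      simpa using h (fun _ => x) ∅ (by simp)
    · right; exact not_nonempty_iff.1 hα
  rcases hC with hC | hα
  swap
  · exact ⟨fun _ => 0, fun _ => le_rfl, by simp,
      fun _ x _ => (hα.false x).elim⟩
  have hbdd : ∀ k, BddAbove (φ '' T k) := fun k => by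
    refine ⟨Real.sqrt C, ?_⟩
    rintro _ ⟨x, hx, rfl⟩
    refine Real.le_sqrt_of_sq_le ?_
    simpa using h (fun _ => x) {k} (by simpa using hx)
  set a : ℕ → ℝ := fun k => sSup (φ '' T k) with ha
  have ha0 : ∀ k, 0 ≤ a k := fun k => Real.sSup_nonneg (by rintro _ ⟨x, -, rfl⟩; exact h0 x)
  -- A half-maximizer exists only where the supremum is positive. Selecting these points costs a
  -- factor `4` in the squares; the other indices contribute zero.
  have hex : ∀ k, 0 < a k → ∃ x, x ∈ T k ∧ a k / 2 < φ x := fun k hk => by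
    have hne : (φ '' T k).Nonempty := by
      by_contra hne
      rw [not_nonempty_iff_eq_empty] at hne
      simp [ha, hne] at hk
    obtain ⟨_, ⟨x, hx, rfl⟩, hlt⟩ := exists_lt_of_lt_csSup hne (half_lt_self hk)
    exact ⟨x, hx, hlt⟩
  refine ⟨a, ha0, ?_, fun k x hx => le_csSup (hbdd k) ⟨x, hx, rfl⟩⟩
  refine summable_of_sum_le (c := 4 * C) (fun k => sq_nonneg _) fun s => ?_
  by_cases hα : Nonempty α
  · have := hα
    choose! p hp using hex
    have h1 := h p (s.filter fun k => 0 < a k) fun k hk => (hp k (Finset.mem_filter.1 hk).2).1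
    have h2 : ∑ k ∈ s, a k ^ 2 = ∑ k ∈ s.filter (fun k => 0 < a k), a k ^ 2 := by
      refine (Finset.sum_filter_of_ne fun k _ hk => ?_).symm
      exact lt_of_le_of_ne (ha0 k) fun h => hk (by rw [← h]; ring)
    rw [h2]
    calc ∑ k ∈ s.filter (fun k => 0 < a k), a k ^ 2
        ≤ ∑ k ∈ s.filter (fun k => 0 < a k), 4 * φ (p k) ^ 2 := by
          refine Finset.sum_le_sum fun k hk => ?_
          have h3 := (hp k (Finset.mem_filter.1 hk).2).2
          nlinarith [ha0 k]
      _ ≤ 4 * C := by rw [← Finset.mul_sum]; linarith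
  · have : ∀ k, a k = 0 := fun k => le_antisymm (not_lt.1 fun hk =>
      hα ⟨(hex k hk).choose⟩) (ha0 k)
    simp [this, hC]

theorem exists_remainder_bound (hu : ContinuousOn u (Icc 0 1)) :
    ∃ R : ℝ, 0 ≤ R ∧ ∀ x ∈ Icc (0 : ℝ) 1, ∀ μ ε : ℂ, ‖ε‖ = 1 →
      ‖diagRemainder u μ ε x‖ ≤ R * ‖μ‖⁻¹ ∧ ‖offDiagRemainder u μ ε x‖ ≤ R * ‖μ‖⁻¹ := by
  obtain ⟨R₁, h₁⟩ := isCompact_Icc.exists_bound_of_continuousOn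
    (f := fun x => Complex.I / 8 * (Complex.exp (-u x) + Complex.exp (u x) - 2))
    (continuousOn_const.mul ((hu.neg.cexp.add hu.cexp).sub continuousOn_const))
  obtain ⟨R₂, h₂⟩ := isCompact_Icc.exists_bound_of_continuousOn
    (f := fun x => Complex.I / 8 * (Complex.exp (u x) - Complex.exp (-u x)))
    (continuousOn_const.mul (hu.cexp.sub hu.neg.cexp))
  have hR₁ : 0 ≤ R₁ := (norm_nonneg _).trans (h₁ 0 (by simp))
  have hR₂ : 0 ≤ R₂ := (norm_nonneg _).trans (h₂ 0 (by simp))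
  refine ⟨R₁ + R₂, add_nonneg hR₁ hR₂, fun x hx μ ε hε => ⟨?_, ?_⟩⟩
  · have e : diagRemainder u μ ε x
        = ε * (Complex.I / 8 * (Complex.exp (-u x) + Complex.exp (u x) - 2) * μ⁻¹) := by
      unfold diagRemainder; ring
    rw [e, norm_mul, hε, one_mul, norm_mul, norm_inv]
    gcongr
    linarith [h₁ x hx]
  · have e : offDiagRemainder u μ ε x
        = ε * (Complex.I / 8 * (Complex.exp (u x) - Complex.exp (-u x)) * μ⁻¹) := by
      unfold offDiagRemainder; ring
    rw [e, norm_mul, hε, one_mul, norm_mul, norm_inv]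
    gcongr
    linarith [h₂ x hx]

theorem IsACPotential.exists_monodromyDeviation_bound (h : IsACPotential u w uy)
    {M : ℂ → Matrix (Fin 2) (Fin 2) ℂ} (hM : ∀ lam, lam ≠ 0 → IsMonodromy u uy lam (M lam)) :
    ∃ a : ℕ → ℝ, (∀ k, 0 ≤ a k) ∧ (Summable fun k => a k ^ 2) ∧
      ∀ k : ℕ, ∀ lam ∈ S ((k : ℤ) + 1),
        monodromyDeviation (Complex.exp (-(u 0 / 2))) lam (M lam) ≤ a k := by
  obtain ⟨R, hR, hRb⟩ := exists_remainder_bound h.isPrim.continuousOn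
  have hq : MemLp (gaugedPotential w uy) 2 (volume.restrict (Icc (0 : ℝ) 1)) :=
    ((h.memLp_uy.const_mul Complex.I).sub h.memLp_deriv).const_mul (1 / 4)
  obtain ⟨C, hC0, hC⟩ := exists_sum_sq_freeDeviation_le hq hR
  have hex : ∀ lam, lam ≠ 0 → ∃ F, IsFundamentalSolution u uy lam F ∧ F 0 = 1 ∧ F 1 = M lam :=
    fun lam hl => h.isMonodromy_iff.1 (hM lam hl)
  choose! F hF hF0 hF1 using hex
  have hrc : ∀ μ ε : ℂ, ContinuousOn (diagRemainder u μ ε) (Icc 0 1) ∧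
      ContinuousOn (offDiagRemainder u μ ε) (Icc 0 1) := fun μ ε => by
    have hc := h.isPrim.continuousOn
    exact ⟨continuousOn_const.mul (continuousOn_const.mul
      ((hc.neg.cexp.add hc.cexp).sub continuousOn_const)),
      continuousOn_const.mul (continuousOn_const.mul (hc.cexp.sub hc.neg.cexp))⟩
  -- Each column contributes at most `8 C`, through `(2A + 2B)² ≤ 8A² + 8B²`.
  refine exists_summable_sq_bound (C := 16 * C) (fun lam => monodromyDeviation_nonneg _ _ _)
    fun p s hp => ?_
  have hne : ∀ k ∈ s, p k ≠ 0 := fun k hk => (mem_S_succ.1 (hp k hk)).1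
  have hrem : ∀ k ∈ s, ∀ t ∈ Icc (0 : ℝ) 1, ∀ ε : ℂ, ‖ε‖ = 1 →
      ‖diagRemainder u (sqrtLam (p k)) ε t‖ ≤ R * (1 / ((k : ℝ) + 1)) ∧
      ‖offDiagRemainder u (sqrtLam (p k)) ε t‖ ≤ R * (1 / ((k : ℝ) + 1)) := by
    intro k hk t ht ε hε
    have h1 := (norm_sqrtLam_bounds (hp k hk)).1
    have h2 : ‖sqrtLam (p k)‖⁻¹ ≤ 1 / ((k : ℝ) + 1) := by
      rw [one_div]
      exact inv_anti₀ (by positivity) h1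
    have h3 := mul_le_mul_of_nonneg_left h2 hR
    exact ⟨(hRb t ht _ ε hε).1.trans h3, (hRb t ht _ ε hε).2.trans h3⟩
  have key : ∀ j : Fin 2, ∑ k ∈ s,
      (freeDeviation (columnComponent u (sqrtLam (p k)) (F (p k)) j 1) (zeta (p k)) 1
        + freeDeviation (columnComponent u (sqrtLam (p k)) (F (p k)) j (-1)) (-zeta (p k)) 1) ^ 2
      ≤ C := by
    intro j
    refine hC (fun k => zeta (p k)) s
      (fun k => columnComponent u (sqrtLam (p k)) (F (p k)) j 1)
      (fun k => columnComponent u (sqrtLam (p k)) (F (p k)) j (-1))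
      (fun k => diagRemainder u (sqrtLam (p k)) 1) (fun k => offDiagRemainder u (sqrtLam (p k)) 1)
      (fun k => diagRemainder u (sqrtLam (p k)) (-1))
      (fun k => offDiagRemainder u (sqrtLam (p k)) (-1)) ?_ ?_ ?_ ?_ ?_ ?_
    · intro k hk
      obtain ⟨h1, h2, h3, -⟩ := mem_S_succ.1 (hp k hk)
      exact ⟨zeta_re_nonneg h1, h2, h3⟩
    · intro k _
      exact ⟨(hrc _ _).1, (hrc _ _).2, (hrc _ _).1, (hrc _ _).2⟩
    · intro k hk t ht
      have h1 := hrem k hk t ht 1 (by simp)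
      have h2 := hrem k hk t ht (-1) (by simp)
      exact ⟨h1.1, h1.2, h2.1, h2.2⟩
    · intro k hk
      have hμ := sqrtLam_ne_zero (hne k hk)
      simp only [columnComponent_zero hμ (hF0 _ (hne k hk))]
      split_ifs <;> norm_num
    · intro k hk
      obtain ⟨c1, c2⟩ := h.isPrim_column (hF _ (hne k hk)) j
      have h1 := isPrim_gaugedComponent (uy := uy) h.isPrim (sqrtLam_ne_zero (hne k hk))
        (ε := 1) (by norm_num)
        (if j = 0 then Complex.exp (1 / 4 * u 0)
          else sqrtLam (p k) * Complex.exp (-(1 / 4) * u 0))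
        (by rw [sqrtLam_sq]; exact c1) (by rw [sqrtLam_sq]; exact c2)
      simp only [one_mul] at h1
      exact h1
    · intro k hk
      obtain ⟨c1, c2⟩ := h.isPrim_column (hF _ (hne k hk)) j
      have h1 := isPrim_gaugedComponent (uy := uy) h.isPrim (sqrtLam_ne_zero (hne k hk))
        (ε := -1) (by norm_num)
        (if j = 0 then Complex.exp (1 / 4 * u 0)
          else sqrtLam (p k) * Complex.exp (-(1 / 4) * u 0))
        (by rw [sqrtLam_sq]; exact c1) (by rw [sqrtLam_sq]; exact c2)
      simp only [neg_one_mul, neg_neg] at h1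
      exact h1
  have hterm : ∀ k ∈ s, monodromyDeviation (Complex.exp (-(u 0 / 2))) (p k) (M (p k)) ^ 2
      ≤ 8 * (freeDeviation (columnComponent u (sqrtLam (p k)) (F (p k)) 0 1) (zeta (p k)) 1
        + freeDeviation (columnComponent u (sqrtLam (p k)) (F (p k)) 0 (-1)) (-zeta (p k)) 1) ^ 2
      + 8 * (freeDeviation (columnComponent u (sqrtLam (p k)) (F (p k)) 1 1) (zeta (p k)) 1
        + freeDeviation (columnComponent u (sqrtLam (p k)) (F (p k)) 1 (-1)) (-zeta (p k)) 1) ^ 2 := by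
    intro k hk
    have h1 := monodromyDeviation_le h.periodic (hne k hk) (hF0 _ (hne k hk))
    rw [hF1 _ (hne k hk)] at h1
    have h2 := pow_le_pow_left₀ (monodromyDeviation_nonneg _ _ _) h1 2
    refine h2.trans ?_
    generalize freeDeviation (columnComponent u (sqrtLam (p k)) (F (p k)) 0 1) (zeta (p k)) 1
        + freeDeviation (columnComponent u (sqrtLam (p k)) (F (p k)) 0 (-1)) (-zeta (p k)) 1 = A
    generalize freeDeviation (columnComponent u (sqrtLam (p k)) (F (p k)) 1 1) (zeta (p k)) 1
        + freeDeviation (columnComponent u (sqrtLam (p k)) (F (p k)) 1 (-1)) (-zeta (p k)) 1 = B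
    nlinarith [sq_nonneg (A - B)]
  refine (Finset.sum_le_sum hterm).trans ?_
  rw [Finset.sum_add_distrib, ← Finset.mul_sum, ← Finset.mul_sum]
  linarith [key 0, key 1]

/-! ### Membership in the asymptotic spaces -/

theorem mem_S_zero {lam : ℂ} : lam ∈ S 0 ↔ lam ≠ 0 ∧ ‖zeta lam‖ ≤ Real.pi / 2 := by
  simp [S]

/-- Here `4|ζ| ≤ 2π < 8` bounds the difference of `|μ|` and `|μ|⁻¹`, whose product is `1`; hence
both are at most `10`. -/
theorem norm_mem_Icc_of_mem_S_zero {lam : ℂ} (h : lam ∈ S 0) :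
    1 / 100 ≤ ‖lam‖ ∧ ‖lam‖ ≤ 100 := by
  obtain ⟨h0, h1⟩ := mem_S_zero.1 h
  have hμ := norm_pos_iff.2 (sqrtLam_ne_zero h0)
  have h4 := four_mul_norm_zeta lam
  have h5 := norm_sub_le (sqrtLam lam + (sqrtLam lam)⁻¹) (sqrtLam lam)⁻¹
  have h6 := norm_sub_le (sqrtLam lam + (sqrtLam lam)⁻¹) (sqrtLam lam)
  rw [add_sub_cancel_right] at h5
  rw [add_sub_cancel_left] at h6
  rw [norm_inv] at h5 h6
  have hpi := Real.pi_lt_four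
  have hinv : ‖sqrtLam lam‖ * ‖sqrtLam lam‖⁻¹ = 1 := mul_inv_cancel₀ hμ.ne'
  have hipos := inv_pos.2 hμ
  rw [← norm_sqrtLam_sq]
  generalize ‖sqrtLam lam‖ = x at *
  generalize x⁻¹ = y at *
  have hx : x ≤ 10 := by
    by_contra hx
    push Not at hx
    nlinarith
  have hy : y ≤ 10 := by
    by_contra hy
    push Not at hy
    nlinarith
  have hx' : 1 / 10 ≤ x := by nlinarith
  constructor <;> nlinarith

theorem exists_bound_on_S_zero {f : ℂ → ℂ} (hf : DifferentiableOn ℂ f {0}ᶜ) :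
    ∃ c : ℝ, 0 ≤ c ∧ ∀ lam ∈ S 0, ‖f lam‖ ≤ c * Real.exp (1 * |(zeta lam).im|) := by
  have hK : IsCompact (Metric.closedBall (0 : ℂ) 100 \ Metric.ball 0 (1 / 100)) :=
    (isCompact_closedBall _ _).diff Metric.isOpen_ball
  have hsub : Metric.closedBall (0 : ℂ) 100 \ Metric.ball 0 (1 / 100) ⊆ {0}ᶜ := by
    rintro x ⟨-, hx⟩ rfl
    exact hx (Metric.mem_ball_self (by norm_num))
  obtain ⟨c, hc⟩ := hK.exists_bound_of_continuousOn (hf.continuousOn.mono hsub)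
  refine ⟨max c 0, le_max_right _ _, fun lam hl => ?_⟩
  obtain ⟨h1, h2⟩ := norm_mem_Icc_of_mem_S_zero hl
  have h3 := hc lam ⟨by simpa using h2, by simpa using h1⟩
  calc ‖f lam‖ ≤ max c 0 * 1 := by rw [mul_one]; exact h3.trans (le_max_left _ _)
    _ ≤ _ := mul_le_mul_of_nonneg_left (Real.one_le_exp (by positivity)) (le_max_right _ _)

theorem summable_sq_weighted {a : ℕ → ℝ} (ha : Summable fun k => a k ^ 2) (C : ℝ) (n : ℤ) :
    Summable fun k : ℕ => |((k : ℝ) + 1) ^ n * (C * (((k : ℝ) + 1) ^ (-n) * a k))| ^ 2 := by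
  refine (ha.mul_left (C ^ 2)).congr fun k => ?_
  have hk : ((k : ℝ) + 1) ^ n * ((k : ℝ) + 1) ^ (-n) = 1 := by
    rw [← zpow_add₀ (by positivity), add_neg_cancel, zpow_zero]
  rw [sq_abs, ← mul_pow]
  congr 1
  linear_combination (-(C * a k)) * hk

theorem mem_asInfty {f : ℂ → ℂ} (hf : DifferentiableOn ℂ f {0}ᶜ) (n : ℤ) {a : ℕ → ℝ}
    (ha0 : ∀ k, 0 ≤ a k) (ha : Summable fun k => a k ^ 2) {C : ℝ} (hC : 0 ≤ C)
    (h : ∀ k : ℕ, ∀ lam ∈ S ((k : ℤ) + 1),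
      ‖f lam‖ ≤ C * (((k : ℝ) + 1) ^ (-n) * a k) * Real.exp |(zeta lam).im|) :
    f ∈ AsInfty n 1 := by
  obtain ⟨c, hc0, hc⟩ := exists_bound_on_S_zero hf
  -- The sequence on `ℕ` is indexed from `S 1`, hence the shift by one; the value `c` serves `S 0`.
  refine ⟨hf, fun k => if 0 < k then C * ((k : ℝ) ^ (-n) * a (k.toNat - 1)) else c, ?_, ?_, ?_⟩
  · intro k
    dsimp only
    split_ifs with hk
    · have hk' : (0 : ℝ) < k := by exact_mod_cast hk
      have := ha0 (k.toNat - 1)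
      positivity
    · exact hc0
  · refine (summable_sq_weighted ha C n).congr fun k => ?_
    have hk : (0 : ℤ) < (k : ℤ) + 1 := by omega
    have hk' : ((k : ℤ) + 1).toNat - 1 = k := by omega
    simp only [hk, if_true, hk']
    push_cast
    rfl
  · intro k hk lam hl
    rcases hk.eq_or_lt with rfl | hk
    · simpa using hc lam hl
    · obtain ⟨l, rfl⟩ : ∃ l : ℕ, k = (l : ℤ) + 1 := ⟨(k - 1).toNat, by omega⟩
      have hl' : ((l : ℤ) + 1).toNat - 1 = l := by omega
      simp only [hk, if_true, hl', one_mul]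
      push_cast
      exact h l lam hl

theorem mem_asZero {f : ℂ → ℂ} (hf : DifferentiableOn ℂ f {0}ᶜ) (m : ℤ) {a : ℕ → ℝ}
    (ha0 : ∀ k, 0 ≤ a k) (ha : Summable fun k => a k ^ 2) {C : ℝ} (hC : 0 ≤ C)
    (h : ∀ k : ℕ, ∀ lam ∈ S (-((k : ℤ) + 1)),
      ‖f lam‖ ≤ C * (((k : ℝ) + 1) ^ (-m) * a k) * Real.exp |(zeta lam).im|) :
    f ∈ AsZero m 1 := by
  obtain ⟨c, hc0, hc⟩ := exists_bound_on_S_zero hf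
  refine ⟨hf, fun k => if k < 0 then C * ((-(k : ℝ)) ^ (-m) * a ((-k).toNat - 1)) else c,
    ?_, ?_, ?_⟩
  · intro k
    dsimp only
    split_ifs with hk
    · have hk' : (0 : ℝ) < -(k : ℝ) := by rw [neg_pos]; exact_mod_cast hk
      have := ha0 ((-k).toNat - 1)
      positivity
    · exact hc0
  · refine (summable_sq_weighted ha C m).congr fun k => ?_
    have hk : -((k : ℤ) + 1) < 0 := by omega
    have hk' : (-(-((k : ℤ) + 1))).toNat - 1 = k := by omega
    simp only [hk, if_true, hk']
    rw [abs_mul, abs_mul (_ ^ m), abs_zpow, abs_zpow, abs_neg]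
    push_cast
    rw [neg_neg]
  · intro k hk lam hl
    rcases hk.eq_or_lt with rfl | hk
    · simpa using hc lam hl
    · obtain ⟨l, rfl⟩ : ∃ l : ℕ, k = -((l : ℤ) + 1) := ⟨(-k - 1).toNat, by omega⟩
      have hl' : (-(-((l : ℤ) + 1))).toNat - 1 = l := by omega
      simp only [hk, if_true, hl', one_mul]
      push_cast
      rw [neg_neg]
      exact h l lam hl

theorem mem_as_of_mem_asInfty_of_mem_asZero {f : ℂ → ℂ} {n m : ℤ} {s : ℝ}
    (h₁ : f ∈ AsInfty n s) (h₂ : f ∈ AsZero m s) : f ∈ As n m s := by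
  obtain ⟨hf, a, ha0, ha, hab⟩ := h₁
  obtain ⟨-, b, hb0, hb, hbb⟩ := h₂
  refine ⟨hf, fun k => if 0 ≤ k then a k else b k, ?_, ⟨?_, ?_⟩, ?_⟩
  · intro k
    dsimp only
    split_ifs
    exacts [ha0 k, hb0 k]
  · refine hb.congr fun k => ?_
    simp only [if_neg (show ¬ (0 : ℤ) ≤ -((k : ℤ) + 1) by omega)]
  · refine ha.congr fun k => ?_
    simp only [if_pos (show (0 : ℤ) ≤ (k : ℤ) + 1 by omega)]
  · intro k lam hl
    dsimp only
    split_ifs with hk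
    exacts [hab k hk lam hl, hbb k (by omega) lam hl]

/-! ### The involution `λ ↦ λ⁻¹` -/

/-- The sign is genuinely ambiguous: on the negative axis the principal root of `λ⁻¹` is minus the
inverse root. The quantities `|ζ|` and `|Im ζ|` do not see it. -/
theorem sqrtLam_inv {lam : ℂ} :
    sqrtLam lam⁻¹ = (sqrtLam lam)⁻¹ ∨ sqrtLam lam⁻¹ = -(sqrtLam lam)⁻¹ := by
  refine sq_eq_sq_iff_eq_or_eq_neg.1 ?_
  rw [inv_pow, sqrtLam_sq, sqrtLam_sq]

theorem zeta_inv (lam : ℂ) : zeta lam⁻¹ = zeta lam ∨ zeta lam⁻¹ = -zeta lam := by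
  unfold zeta
  rcases sqrtLam_inv (lam := lam) with h | h <;> rw [h]
  · left; rw [inv_inv]; ring
  · right; rw [inv_neg, inv_inv]; ring

theorem norm_zeta_inv (lam : ℂ) : ‖zeta lam⁻¹‖ = ‖zeta lam‖ := by
  rcases zeta_inv lam with h | h <;> simp [h]

theorem abs_im_zeta_inv (lam : ℂ) : |(zeta lam⁻¹).im| = |(zeta lam).im| := by
  rcases zeta_inv lam with h | h <;> simp [h]

theorem inv_mem_S_succ {k : ℕ} {lam : ℂ} (h : lam ∈ S (-((k : ℤ) + 1))) :
    lam⁻¹ ∈ S ((k : ℤ) + 1) := by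
  obtain ⟨h1, h2, h3, h4⟩ := mem_S_neg_succ.1 h
  rw [mem_S_succ, norm_zeta_inv, norm_inv]
  exact ⟨inv_ne_zero h1, h2, h3, (one_lt_inv₀ (norm_pos_iff.2 h1)).2 h4⟩

/-! ### Entrywise estimates -/

/-- The deviations of the single entries are controlled by the total one. -/
theorem entry_bounds_of_monodromyDeviation_le {k : ℕ} {lam τ : ℂ} (hl : lam ∈ S ((k : ℤ) + 1))
    (hτ : τ ≠ 0) {N : Matrix (Fin 2) (Fin 2) ℂ} {A : ℝ} (hA : monodromyDeviation τ lam N ≤ A) :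
    ‖N 0 0 - a₀ lam‖ ≤ A * Real.exp |(zeta lam).im| ∧
    ‖N 0 1 - τ⁻¹ * b₀ lam‖ ≤ ‖τ⁻¹‖ * (((k : ℝ) + 1)⁻¹ * A) * Real.exp |(zeta lam).im| ∧
    ‖N 1 0 - τ * c₀ lam‖ ≤ 25 * ‖τ‖ * (((k : ℝ) + 1) * A) * Real.exp |(zeta lam).im| ∧
    ‖N 1 1 - d₀ lam‖ ≤ A * Real.exp |(zeta lam).im| := by
  obtain ⟨hb1, hb2⟩ := norm_sqrtLam_bounds hl
  have hμ := sqrtLam_ne_zero (mem_S_succ.1 hl).1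
  have hA0 := (monodromyDeviation_nonneg _ _ _).trans hA
  have hk : (0 : ℝ) < (k : ℝ) + 1 := by positivity
  unfold monodromyDeviation at hA
  rw [Real.exp_neg, inv_mul_le_iff₀ (Real.exp_pos _), mul_comm _ A] at hA
  have e1 : N 0 1 - τ⁻¹ * b₀ lam = τ⁻¹ * ((sqrtLam lam)⁻¹
      * (sqrtLam lam * τ * N 0 1 + Complex.sin (zeta lam))) := by
    unfold b₀; field_simp; ring
  have e2 : N 1 0 - τ * c₀ lam = τ * (sqrtLam lam
      * ((sqrtLam lam)⁻¹ * τ⁻¹ * N 1 0 - Complex.sin (zeta lam))) := by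
    unfold c₀; field_simp
  have n1 := norm_nonneg (N 0 0 - a₀ lam)
  have n2 := norm_nonneg (sqrtLam lam * τ * N 0 1 + Complex.sin (zeta lam))
  have n3 := norm_nonneg ((sqrtLam lam)⁻¹ * τ⁻¹ * N 1 0 - Complex.sin (zeta lam))
  have n4 := norm_nonneg (N 1 1 - d₀ lam)
  have hE := Real.exp_pos |(zeta lam).im|
  refine ⟨by linarith, ?_, ?_, by linarith⟩
  · rw [e1, norm_mul, norm_mul, norm_inv (sqrtLam lam)]
    calc ‖τ⁻¹‖ * (‖sqrtLam lam‖⁻¹ * ‖sqrtLam lam * τ * N 0 1 + Complex.sin (zeta lam)‖)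
        ≤ ‖τ⁻¹‖ * (((k : ℝ) + 1)⁻¹ * (A * Real.exp |(zeta lam).im|)) :=
          mul_le_mul_of_nonneg_left (mul_le_mul (inv_anti₀ hk hb1) (by linarith) n2 (by positivity))
            (norm_nonneg _)
      _ = _ := by ring
  · rw [e2, norm_mul, norm_mul]
    calc ‖τ‖ * (‖sqrtLam lam‖ * ‖(sqrtLam lam)⁻¹ * τ⁻¹ * N 1 0 - Complex.sin (zeta lam)‖)
        ≤ ‖τ‖ * (25 * ((k : ℝ) + 1) * (A * Real.exp |(zeta lam).im|)) :=
          mul_le_mul_of_nonneg_left (mul_le_mul hb2 (by linarith) n3 (by positivity))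
            (norm_nonneg _)
      _ = _ := by ring

theorem IsACPotential.asymptotics_infty (h : IsACPotential u w uy)
    {M : ℂ → Matrix (Fin 2) (Fin 2) ℂ} (hM : ∀ lam, lam ≠ 0 → IsMonodromy u uy lam (M lam)) :
    ∃ a : ℕ → ℝ, (∀ k, 0 ≤ a k) ∧ (Summable fun k => a k ^ 2) ∧
      ∀ k : ℕ, ∀ lam ∈ S ((k : ℤ) + 1),
        ‖M lam 0 0 - a₀ lam‖ ≤ a k * Real.exp |(zeta lam).im| ∧
        ‖M lam 0 1 - (Complex.exp (-(u 0 / 2)))⁻¹ * b₀ lam‖ ≤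
          ‖(Complex.exp (-(u 0 / 2)))⁻¹‖ * (((k : ℝ) + 1)⁻¹ * a k)
            * Real.exp |(zeta lam).im| ∧
        ‖M lam 1 0 - Complex.exp (-(u 0 / 2)) * c₀ lam‖ ≤
          25 * ‖Complex.exp (-(u 0 / 2))‖ * (((k : ℝ) + 1) * a k)
            * Real.exp |(zeta lam).im| ∧
        ‖M lam 1 1 - d₀ lam‖ ≤ a k * Real.exp |(zeta lam).im| := by
  obtain ⟨a, ha0, ha, hb⟩ := h.exists_monodromyDeviation_bound hM
  exact ⟨a, ha0, ha, fun k lam hl =>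
    entry_bounds_of_monodromyDeviation_le hl (Complex.exp_ne_zero _) (hb k lam hl)⟩

/-- The estimate at infinity is applied to `(-u, u_y)` at `λ⁻¹`, where `τ` becomes `τ⁻¹`. Undoing
the conjugation multiplies the off-diagonal errors by `λ^{∓1}`, which exchanges the weights `k` and
`k⁻¹`. -/
theorem IsACPotential.asymptotics_zero (h : IsACPotential u w uy)
    {M : ℂ → Matrix (Fin 2) (Fin 2) ℂ} (hM : ∀ lam, lam ≠ 0 → IsMonodromy u uy lam (M lam)) :
    ∃ a : ℕ → ℝ, (∀ k, 0 ≤ a k) ∧ (Summable fun k => a k ^ 2) ∧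
      ∀ k : ℕ, ∀ lam ∈ S (-((k : ℤ) + 1)),
        ‖M lam 0 0 - a₀ lam‖ ≤ a k * Real.exp |(zeta lam).im| ∧
        ‖M lam 0 1 - Complex.exp (-(u 0 / 2)) * b₀ lam‖ ≤
          625 * ‖Complex.exp (-(u 0 / 2))‖ * (((k : ℝ) + 1) * a k)
            * Real.exp |(zeta lam).im| ∧
        ‖M lam 1 0 - (Complex.exp (-(u 0 / 2)))⁻¹ * c₀ lam‖ ≤
          25 * ‖(Complex.exp (-(u 0 / 2)))⁻¹‖ * (((k : ℝ) + 1)⁻¹ * a k)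
            * Real.exp |(zeta lam).im| ∧
        ‖M lam 1 1 - d₀ lam‖ ≤ a k * Real.exp |(zeta lam).im| := by
  have hM' : ∀ lam, lam ≠ 0 → IsMonodromy (fun x => -u x) uy lam
      (swapMonodromy lam⁻¹ (M lam⁻¹)) := fun lam hl => by
    have := h.isMonodromy_swap (inv_ne_zero hl) (hM lam⁻¹ (inv_ne_zero hl))
    rwa [inv_inv] at this
  obtain ⟨a, ha0, ha, hb⟩ := h.neg.asymptotics_infty hM'
  refine ⟨a, ha0, ha, fun k lam hl => ?_⟩
  have hl0 := (mem_S_neg_succ.1 hl).1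
  have hk : (0 : ℝ) < (k : ℝ) + 1 := by positivity
  obtain ⟨p1, p2, p3, p4⟩ := hb k lam⁻¹ (inv_mem_S_succ hl)
  obtain ⟨hb1, hb2⟩ := norm_sqrtLam_bounds (inv_mem_S_succ hl)
  have hsq := norm_sqrtLam_sq lam⁻¹
  have hτ : Complex.exp (-(-u 0 / 2)) = (Complex.exp (-(u 0 / 2)))⁻¹ := by
    rw [← Complex.exp_neg]; congr 1; ring
  have hv := vacuumMonodromy_inv hl0
  have v1 : a₀ lam⁻¹ = a₀ lam := congrFun (congrFun hv 0) 0
  have v2 : b₀ lam⁻¹ = lam * b₀ lam := congrFun (congrFun hv 0) 1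
  have v3 : c₀ lam⁻¹ = lam⁻¹ * c₀ lam := congrFun (congrFun hv 1) 0
  have v4 : d₀ lam⁻¹ = d₀ lam := congrFun (congrFun hv 1) 1
  have m1 : swapMonodromy lam (M lam) 0 0 = M lam 0 0 := rfl
  have m2 : swapMonodromy lam (M lam) 0 1 = lam * M lam 0 1 := rfl
  have m3 : swapMonodromy lam (M lam) 1 0 = lam⁻¹ * M lam 1 0 := rfl
  have m4 : swapMonodromy lam (M lam) 1 1 = M lam 1 1 := rfl
  rw [inv_inv, abs_im_zeta_inv] at p1 p2 p3 p4
  rw [m1, v1] at p1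
  rw [m2, v2, hτ, inv_inv, mul_left_comm _ lam, ← mul_sub, norm_mul] at p2
  rw [m3, v3, hτ, mul_left_comm _ lam⁻¹, ← mul_sub, norm_mul] at p3
  rw [m4, v4] at p4
  rw [norm_inv] at hsq p3
  have hn := norm_pos_iff.2 hl0
  refine ⟨p1, ?_, ?_, p4⟩
  · have h1 : ‖lam‖⁻¹ ≤ 625 * ((k : ℝ) + 1) ^ 2 := by
      rw [← hsq]
      calc ‖sqrtLam lam⁻¹‖ ^ 2 ≤ (25 * ((k : ℝ) + 1)) ^ 2 := by gcongr
        _ = _ := by ring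
    rw [← le_inv_mul_iff₀ hn] at p2
    refine p2.trans ((mul_le_mul_of_nonneg_right h1 ?_).trans (le_of_eq ?_))
    · have := ha0 k
      positivity
    · field_simp
  · have h1 : ‖lam‖ ≤ (((k : ℝ) + 1) ^ 2)⁻¹ := by
      rw [← inv_inv ‖lam‖, ← hsq]
      gcongr
    rw [inv_mul_le_iff₀ hn] at p3
    refine p3.trans ((mul_le_mul_of_nonneg_right h1 ?_).trans (le_of_eq ?_))
    · have := ha0 k
      positivity
    · field_simp

end SinhGordon

/-! ### Conclusion -/

theorem theoremT (u uy : ℝ → ℂ) (hpot : SinhGordon.IsPotential u uy) :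
    (∀ lam : ℂ, lam ≠ 0 → ∃! N : Matrix (Fin 2) (Fin 2) ℂ, SinhGordon.IsMonodromy u uy lam N) ∧
    ∀ M : ℂ → Matrix (Fin 2) (Fin 2) ℂ,
      (∀ lam : ℂ, lam ≠ 0 → SinhGordon.IsMonodromy u uy lam (M lam)) →
      ∀ τ : ℂ, τ = Complex.exp (-(u 0 / 2)) →
        (fun lam => M lam 0 0 - SinhGordon.a₀ lam) ∈ SinhGordon.As 0 0 1 ∧
        ((fun lam => M lam 0 1 - τ⁻¹ * SinhGordon.b₀ lam) ∈ SinhGordon.AsInfty 1 1 ∧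
          (fun lam => M lam 0 1 - τ * SinhGordon.b₀ lam) ∈ SinhGordon.AsZero (-1) 1) ∧
        ((fun lam => M lam 1 0 - τ * SinhGordon.c₀ lam) ∈ SinhGordon.AsInfty (-1) 1 ∧
          (fun lam => M lam 1 0 - τ⁻¹ * SinhGordon.c₀ lam) ∈ SinhGordon.AsZero 1 1) ∧
        (fun lam => M lam 1 1 - SinhGordon.d₀ lam) ∈ SinhGordon.As 0 0 1 := by
  obtain ⟨w, h⟩ := hpot.exists_isACPotential
  refine ⟨fun lam _ => h.existsUnique_isMonodromy lam, ?_⟩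
  rintro M hM τ rfl
  obtain ⟨a, ha0, ha, hab⟩ := h.asymptotics_infty hM
  obtain ⟨b, hb0, hb, hbb⟩ := h.asymptotics_zero hM
  have hd := h.differentiableOn_monodromy hM
  -- The vacuum entries are defined through a discontinuous root; they are holomorphic on all of
  -- `ℂ*` because they are themselves entries of a monodromy.
  have hv := SinhGordon.isACPotential_zero.differentiableOn_monodromy
    (M := SinhGordon.vacuumMonodromy) fun lam hl => SinhGordon.isMonodromy_vacuum hl
  have da : DifferentiableOn ℂ SinhGordon.a₀ {0}ᶜ := hv 0 0
  have db : DifferentiableOn ℂ SinhGordon.b₀ {0}ᶜ := hv 0 1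
  have dc : DifferentiableOn ℂ SinhGordon.c₀ {0}ᶜ := hv 1 0
  have dd : DifferentiableOn ℂ SinhGordon.d₀ {0}ᶜ := hv 1 1
  have fa := (hd 0 0).sub da
  have fd := (hd 1 1).sub dd
  refine ⟨?_, ⟨?_, ?_⟩, ⟨?_, ?_⟩, ?_⟩
  · refine SinhGordon.mem_as_of_mem_asInfty_of_mem_asZero
      (SinhGordon.mem_asInfty fa 0 ha0 ha zero_le_one fun k lam hl => ?_)
      (SinhGordon.mem_asZero fa 0 hb0 hb zero_le_one fun k lam hl => ?_)
    · simpa using (hab k lam hl).1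
    · simpa using (hbb k lam hl).1
  · refine SinhGordon.mem_asInfty ((hd 0 1).sub (db.const_mul _)) 1 ha0 ha
      (norm_nonneg (Complex.exp (-(u 0 / 2)))⁻¹)
      fun k lam hl => ?_
    rw [zpow_neg_one]
    exact (hab k lam hl).2.1
  · refine SinhGordon.mem_asZero ((hd 0 1).sub (db.const_mul _)) (-1) hb0 hb
      (C := 625 * ‖Complex.exp (-(u 0 / 2))‖)
      (by positivity) fun k lam hl => ?_
    rw [neg_neg, zpow_one]
    exact (hbb k lam hl).2.1
  · refine SinhGordon.mem_asInfty ((hd 1 0).sub (dc.const_mul _)) (-1) ha0 ha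
      (C := 25 * ‖Complex.exp (-(u 0 / 2))‖)
      (by positivity) fun k lam hl => ?_
    rw [neg_neg, zpow_one]
    exact (hab k lam hl).2.2.1
  · refine SinhGordon.mem_asZero ((hd 1 0).sub (dc.const_mul _)) 1 hb0 hb
      (C := 25 * ‖(Complex.exp (-(u 0 / 2)))⁻¹‖)
      (by positivity) fun k lam hl => ?_
    rw [zpow_neg_one]
    exact (hbb k lam hl).2.2.1
  · refine SinhGordon.mem_as_of_mem_asInfty_of_mem_asZero
      (SinhGordon.mem_asInfty fd 0 ha0 ha zero_le_one fun k lam hl => ?_)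
      (SinhGordon.mem_asZero fd 0 hb0 hb zero_le_one fun k lam hl => ?_)
    · simpa using (hab k lam hl).2.2.2
    · simpa using (hbb k lam hl).2.2.2
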